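/- Let $\Gamma\subset\mathbb R^n$ be an open symmetric convex cone containing the positive ray $\{(c,\dots,c):c>0\}$, and let $f:\Gamma\to\mathbb R$ be a symmetric $C^2$ function which is monotone increasing in its arguments and homogeneous of degree one. Let $M^n$ be a compact smooth manifold without boundary and let $X:M\times[0,T)\to\mathbb R^{n+1}$ be a smooth family of embeddings such that, for each $t$, $X(M,t)$ is the boundary of a bounded open set $\Omega_t$. Let $\nu(x,t)$ be the unit normal pointing out of $\Omega_t$, and let $\kappa_1,\dots,\kappa_n$ be the principal curvatures with respect to $\nu$ (positive for round spheres). Suppose that $(\kappa_1,\dots,\kappa_n)\in\Gamma$ everywhere, that $X$ solves $$\frac{\partial X}{\partial t}=-F\nu,\qquad F(x,t)=f(\kappa_1(x,t),\dots,\kappa_n(x,t)),$$ and that $F(x,t)>0$ for all $(x,t)\in M\times[0,T)$. For $x\neq y$ put $$Z(x,y,t)=\frac{2\langle X(x,t)-X(y,t),\nu(x,t)\rangle}{\|X(x,t)-X(y,t)\|^2},\qquad \overline Z(x,t)=\sup_{y\neq x}Z(x,y,t),\qquad \underline Z(x,t)=\inf_{y\neq x}Z(x,y,t).$$ 1. If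 $f$ is convex, then $\inf_{x\in M}\underline Z(x,t)/F(x,t)$ is non-decreasing in $t\in[0,T)$. Moreover, exterior $\delta$-non-collapsing on the scale of $F$ is preserved: for $\delta>0$ and $0\le t_1\le t_2<T$, if every point $X(x,t_1)$ lies on the boundary of an open ball of radius $\delta/F(x,t_1)$ contained in $\mathbb R^{n+1}\setminus\overline{\Omega_{t_1}}$, then the same holds with $t_2$ in place of $t_1$. 2. If $f$ is concave, then $\sup_{x\in M}\overline Z(x,t)/F(x,t)$ is non-increasing in $t\in[0,T)$. Moreover, interior $\delta$-non-collapsing on the scale of $F$ is preserved: for $\delta>0$ and $0\le t_1\le t_2<T$, if every point $X(x,t_1)$ lies on the boundary of an open ball of radius $\delta/F(x,t_1)$ contained in $\Omega_{t_1}$, then the same holds with $t_2$ in place of $t_1$. -/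

import Mathlib

open Set Filter Topology
open scoped Manifold ContDiff

noncomputable section

namespace CurvatureFlow

/-- `Γ ⊆ ℝⁿ` is an open symmetric convex cone containing the positive ray, and `f : Γ → ℝ` is a
symmetric `C²` function, monotone increasing in its arguments and homogeneous of degree one. -/
structure IsSpeedFunction {n : ℕ} (Γ : Set (Fin n → ℝ)) (f : (Fin n → ℝ) → ℝ) : Prop where
  isOpen_cone : IsOpen Γ
  convex_cone : Convex ℝ Γ
  smul_mem : ∀ κ ∈ Γ, ∀ c : ℝ, 0 < c → c • κ ∈ Γ
  perm_mem : ∀ κ ∈ Γ, ∀ σ : Equiv.Perm (Fin n), κ ∘ σ ∈ Γ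
  ray_mem : ∀ c : ℝ, 0 < c → (fun _ => c) ∈ Γ
  contDiffOn : ContDiffOn ℝ 2 f Γ
  symmetric : ∀ κ ∈ Γ, ∀ σ : Equiv.Perm (Fin n), f (κ ∘ σ) = f κ
  monotoneOn : MonotoneOn f Γ
  homogeneous : ∀ κ ∈ Γ, ∀ c : ℝ, 0 < c → f (c • κ) = c * f κ

section Hypersurface

variable {n : ℕ} {M : Type*} [TopologicalSpace M] [ChartedSpace (EuclideanSpace ℝ (Fin n)) M]

/-- The differential `dX_x : T_x M → ℝⁿ⁺¹`; the tangent space `T_x M` is identified with `ℝⁿ`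
through the preferred chart at `x`. -/
def differential (X : M → EuclideanSpace ℝ (Fin (n + 1))) (x : M) :
    EuclideanSpace ℝ (Fin n) →L[ℝ] EuclideanSpace ℝ (Fin (n + 1)) :=
  mfderiv (𝓡 n) 𝓘(ℝ, EuclideanSpace ℝ (Fin (n + 1))) X x

/-- The second derivative of `X` at `x` in the preferred chart at `x`. -/
def secondDerivative (X : M → EuclideanSpace ℝ (Fin (n + 1))) (x : M) :
    EuclideanSpace ℝ (Fin n) →L[ℝ] EuclideanSpace ℝ (Fin n) →L[ℝ]
      EuclideanSpace ℝ (Fin (n + 1)) :=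
  fderiv ℝ (fderiv ℝ (X ∘ (extChartAt (𝓡 n) x).symm)) (extChartAt (𝓡 n) x x)

/-- The induced metric `g_{ij} = ⟨∂_i X, ∂_j X⟩` at `x`, in the preferred chart at `x`. -/
def metricMatrix (X : M → EuclideanSpace ℝ (Fin (n + 1))) (x : M) : Matrix (Fin n) (Fin n) ℝ :=
  Matrix.of fun i j => inner ℝ
    (differential X x (EuclideanSpace.single i 1)) (differential X x (EuclideanSpace.single j 1))

/-- The second fundamental form `h_{ij} = -⟨∂_i ∂_j X, ν⟩` at `x`, in the preferred chart at `x`.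
With this sign, round spheres have positive curvature with respect to the outward normal. -/
def secondFundamentalMatrix (X ν : M → EuclideanSpace ℝ (Fin (n + 1))) (x : M) :
    Matrix (Fin n) (Fin n) ℝ :=
  Matrix.of fun i j => - inner ℝ
    (secondDerivative X x (EuclideanSpace.single i 1) (EuclideanSpace.single j 1)) (ν x)

/-- The matrix `h_i^j = (g⁻¹ h)` of the Weingarten map at `x`. -/
def weingartenMatrix (X ν : M → EuclideanSpace ℝ (Fin (n + 1))) (x : M) :
    Matrix (Fin n) (Fin n) ℝ :=
  (metricMatrix X x)⁻¹ * secondFundamentalMatrix X ν x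

/-- The principal curvatures at `x`: the eigenvalues of the Weingarten map, repeated according to
multiplicity and listed in increasing order. The default value `0` is never used for an immersion,
since the Weingarten map then has `n` real eigenvalues. -/
def principalCurvatures (X ν : M → EuclideanSpace ℝ (Fin (n + 1))) (x : M) : Fin n → ℝ :=
  fun i => ((weingartenMatrix X ν x).charpoly.roots.sort (· ≤ ·)).getD i 0

/-- The speed `F(x) = f(κ₁(x), …, κₙ(x))`. -/
def speed (f : (Fin n → ℝ) → ℝ) (X ν : M → EuclideanSpace ℝ (Fin (n + 1))) (x : M) : ℝ :=
  f (principalCurvatures X ν x)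

/-- `X` is an embedding of `M` onto the boundary of the bounded open set `Ω`, and `ν` is the unit
normal along `X` which points out of `Ω`. -/
structure IsOutwardNormal (Ω : Set (EuclideanSpace ℝ (Fin (n + 1))))
    (X ν : M → EuclideanSpace ℝ (Fin (n + 1))) : Prop where
  isOpen : IsOpen Ω
  isBounded : Bornology.IsBounded Ω
  frontier_eq : frontier Ω = range X
  norm_eq_one : ∀ x, ‖ν x‖ = 1
  orthogonal : ∀ x v, inner ℝ (differential X x v) (ν x) = 0
  inward : ∀ x, ∀ᶠ s : ℝ in 𝓝[>] 0, X x - s • ν x ∈ Ω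
  outward : ∀ x, ∀ᶠ s : ℝ in 𝓝[>] 0, X x + s • ν x ∉ closure Ω

end Hypersurface

section Flow

variable {n : ℕ} {M : Type*} [TopologicalSpace M] [ChartedSpace (EuclideanSpace ℝ (Fin n)) M]

/-- `X : M × [0, T) → ℝⁿ⁺¹` is a smooth family of embeddings `X(·, t)` of `M` onto the boundary of
`Ω t`, with outward unit normal `ν(·, t)` and principal curvatures in `Γ`, which solves
`∂X/∂t = -F ν` with speed `F = f(κ₁, …, κₙ)`. -/
structure IsEmbeddedSolution (Γ : Set (Fin n → ℝ)) (f : (Fin n → ℝ) → ℝ) (T : ℝ)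
    (Ω : ℝ → Set (EuclideanSpace ℝ (Fin (n + 1))))
    (X ν : ℝ → M → EuclideanSpace ℝ (Fin (n + 1))) : Prop where
  smooth : ContMDiffOn ((𝓡 n).prod 𝓘(ℝ, ℝ)) 𝓘(ℝ, EuclideanSpace ℝ (Fin (n + 1))) ∞
    (fun p : M × ℝ => X p.2 p.1) (univ ×ˢ Ico 0 T)
  isEmbedding : ∀ t ∈ Ico 0 T, IsEmbedding (X t)
  immersion : ∀ t ∈ Ico 0 T, ∀ x, Function.Injective (differential (X t) x)
  outwardNormal : ∀ t ∈ Ico 0 T, IsOutwardNormal (Ω t) (X t) (ν t)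
  curvatures_mem : ∀ t ∈ Ico 0 T, ∀ x, principalCurvatures (X t) (ν t) x ∈ Γ
  flow : ∀ t ∈ Ico 0 T, ∀ x,
    HasDerivWithinAt (fun s => X s x) (-(speed f (X t) (ν t) x • ν t x)) (Ico 0 T) t

end Flow

section Collapsing

variable {n : ℕ} {M : Type*}

/-- `Z(x, y) = 2 ⟨X(x) - X(y), ν(x)⟩ / ‖X(x) - X(y)‖²`. -/
def sphereZ (X ν : M → EuclideanSpace ℝ (Fin (n + 1))) (x y : M) : ℝ :=
  2 * inner ℝ (X x - X y) (ν x) / ‖X x - X y‖ ^ 2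

/-- The interior sphere curvature `sup {Z(x, y) : y ≠ x}`. -/
def interiorSphereCurvature (X ν : M → EuclideanSpace ℝ (Fin (n + 1))) (x : M) : ℝ :=
  ⨆ y : {y : M // y ≠ x}, sphereZ X ν x y

/-- The exterior sphere curvature `inf {Z(x, y) : y ≠ x}`. -/
def exteriorSphereCurvature (X ν : M → EuclideanSpace ℝ (Fin (n + 1))) (x : M) : ℝ :=
  ⨅ y : {y : M // y ≠ x}, sphereZ X ν x y

/-- Every point `X(x)` lies on the boundary of an open ball of radius `δ / F(x)` inside `Ω`. -/
def InteriorNonCollapsed (δ : ℝ) (Ω : Set (EuclideanSpace ℝ (Fin (n + 1))))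
    (X : M → EuclideanSpace ℝ (Fin (n + 1))) (F : M → ℝ) : Prop :=
  ∀ x, ∃ p, Metric.ball p (δ / F x) ⊆ Ω ∧ X x ∈ Metric.sphere p (δ / F x)

/-- Every point `X(x)` lies on the boundary of an open ball of radius `δ / F(x)` outside `Ω`. -/
def ExteriorNonCollapsed (δ : ℝ) (Ω : Set (EuclideanSpace ℝ (Fin (n + 1))))
    (X : M → EuclideanSpace ℝ (Fin (n + 1))) (F : M → ℝ) : Prop :=
  ∀ x, ∃ p, Metric.ball p (δ / F x) ⊆ (closure Ω)ᶜ ∧ X x ∈ Metric.sphere p (δ / F x)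

end Collapsing

end CurvatureFlow

end

open Set Filter Topology
open scoped Manifold ContDiff

noncomputable section

namespace CurvatureFlow

section Calculus

variable {E : Type*} [NormedAddCommGroup E] [NormedSpace ℝ E]
variable {V : Type*} [NormedAddCommGroup V] [NormedSpace ℝ V]

/-- The directional derivative of a scalar function in the constant direction `v`. -/
def dirDeriv (v : E) (g : E → ℝ) : E → ℝ := fun z => fderiv ℝ g z v

lemma ContDiffAt.dirDeriv {g : E → ℝ} {z₀ : E} (hg : ContDiffAt ℝ ∞ g z₀) (v : E) :
    ContDiffAt ℝ ∞ (dirDeriv v g) z₀ :=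
  (hg.fderiv_right (m := ∞) (by simp)).clm_apply contDiffAt_const

lemma eventually_contDiffAt_two {F : Type*} [NormedAddCommGroup F] [NormedSpace ℝ F]
    {g : E → F} {z₀ : E} (hg : ContDiffAt ℝ ∞ g z₀) :
    ∀ᶠ z in 𝓝 z₀, ContDiffAt ℝ 2 g z :=
  (hg.of_le (m := 2) (WithTop.coe_le_coe.2 le_top)).eventually (by simp)

lemma dirDeriv_dirDeriv_eq {g : E → ℝ} {z : E} (hg : ContDiffAt ℝ 2 g z) (v w : E) :
    dirDeriv v (dirDeriv w g) z = fderiv ℝ (fderiv ℝ g) z v w := by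
  have h : DifferentiableAt ℝ (fderiv ℝ g) z :=
    (hg.fderiv_right (m := 1) (by norm_num)).differentiableAt (by simp)
  unfold dirDeriv
  rw [fderiv_clm_apply h (differentiableAt_const w)]
  simp

lemma dirDeriv_comm_of_contDiffAt_two {g : E → ℝ} {z : E} (hg : ContDiffAt ℝ 2 g z) (v w : E) :
    dirDeriv v (dirDeriv w g) z = dirDeriv w (dirDeriv v g) z := by
  rw [dirDeriv_dirDeriv_eq hg, dirDeriv_dirDeriv_eq hg]
  exact (hg.isSymmSndFDerivAt (by simp)) v w

lemma dirDeriv_comm {g : E → ℝ} {z₀ : E} (hg : ContDiffAt ℝ ∞ g z₀) (v w : E) :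
    dirDeriv v (dirDeriv w g) =ᶠ[𝓝 z₀] dirDeriv w (dirDeriv v g) :=
  (eventually_contDiffAt_two hg).mono fun _ hz => dirDeriv_comm_of_contDiffAt_two hz v w

lemma dirDeriv_congr {g g' : E → ℝ} {z₀ : E} (h : g =ᶠ[𝓝 z₀] g') (v : E) :
    dirDeriv v g =ᶠ[𝓝 z₀] dirDeriv v g' :=
  (h.fderiv (𝕜 := ℝ)).mono fun z hz => by simp only [dirDeriv]; rw [hz]

/-- `g` is twice differentiable at `0` with value `a` and first two derivatives `b` and `c`. -/
def Jet2 (g : ℝ → V) (a b c : V) : Prop :=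
  ∃ g' : ℝ → V, (∀ᶠ s in 𝓝 0, HasDerivAt g (g' s) s) ∧ g 0 = a ∧ g' 0 = b ∧ HasDerivAt g' c 0

namespace Jet2

lemma hasDerivAt {g : ℝ → V} {a b c : V} (h : Jet2 g a b c) : HasDerivAt g b 0 := by
  obtain ⟨g', h1, _, h3, _⟩ := h
  exact h3 ▸ h1.self_of_nhds

lemma const (a : V) : Jet2 (fun _ => a) a 0 0 :=
  ⟨fun _ => 0, Eventually.of_forall fun s => hasDerivAt_const s a, rfl, rfl, hasDerivAt_const _ _⟩

lemma smul_const (v : V) : Jet2 (fun s : ℝ => s • v) 0 v 0 := by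
  refine ⟨fun _ => v, Eventually.of_forall fun s => ?_, by simp, rfl, hasDerivAt_const _ _⟩
  simpa using (hasDerivAt_id s).smul_const v

protected lemma add {g h : ℝ → V} {a b c a' b' c' : V} (hg : Jet2 g a b c) (hh : Jet2 h a' b' c') :
    Jet2 (fun s => g s + h s) (a + a') (b + b') (c + c') := by
  obtain ⟨g', h1, h2, h3, h4⟩ := hg
  obtain ⟨k', k1, k2, k3, k4⟩ := hh
  refine ⟨fun s => g' s + k' s, ?_, by simp [h2, k2], by simp [h3, k3], h4.add k4⟩
  filter_upwards [h1, k1] with s hs ks using hs.add ks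

protected lemma neg {g : ℝ → V} {a b c : V} (hg : Jet2 g a b c) :
    Jet2 (fun s => -g s) (-a) (-b) (-c) := by
  obtain ⟨g', h1, h2, h3, h4⟩ := hg
  refine ⟨fun s => -g' s, ?_, by simp [h2], by simp [h3], h4.neg⟩
  filter_upwards [h1] with s hs using hs.neg

protected lemma sub {g h : ℝ → V} {a b c a' b' c' : V} (hg : Jet2 g a b c) (hh : Jet2 h a' b' c') :
    Jet2 (fun s => g s - h s) (a - a') (b - b') (c - c') := by
  simpa only [sub_eq_add_neg] using hg.add hh.neg

protected lemma sum {ι : Type*} (t : Finset ι) {g : ι → ℝ → V} {a b c : ι → V}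
    (h : ∀ i ∈ t, Jet2 (g i) (a i) (b i) (c i)) :
    Jet2 (fun s => ∑ i ∈ t, g i s) (∑ i ∈ t, a i) (∑ i ∈ t, b i) (∑ i ∈ t, c i) := by
  classical
  induction t using Finset.induction_on with
  | empty => simpa using const (0 : V)
  | insert j t hj ih =>
    simp only [Finset.sum_insert hj]
    exact (h j (by simp)).add (ih fun i hi => h i (by simp [hi]))

protected lemma smul {g : ℝ → ℝ} {h : ℝ → V} {a b c : ℝ} {a' b' c' : V} (hg : Jet2 g a b c)
    (hh : Jet2 h a' b' c') :
    Jet2 (fun s => g s • h s) (a • a') (a • b' + b • a') (a • c' + (2 * b) • b' + c • a') := by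
  obtain ⟨g', h1, h2, h3, h4⟩ := hg
  obtain ⟨k', k1, k2, k3, k4⟩ := hh
  refine ⟨fun s => g s • k' s + g' s • h s, ?_, by simp [h2, k2], by simp [h2, h3, k2, k3], ?_⟩
  · filter_upwards [h1, k1] with s hs ks using hs.smul ks
  · have := (h1.self_of_nhds.smul k4).add (h4.smul k1.self_of_nhds)
    rw [h2, h3, k2, k3] at this
    have e : a • c' + (2 * b) • b' + c • a' = a • c' + b • b' + (b • b' + c • a') := by
      rw [two_mul, add_smul]
      abel
    rw [e]
    exact this

protected lemma mul {g h : ℝ → ℝ} {a b c a' b' c' : ℝ} (hg : Jet2 g a b c) (hh : Jet2 h a' b' c') :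
    Jet2 (fun s => g s * h s) (a * a') (a * b' + b * a') (a * c' + 2 * b * b' + c * a') :=
  hg.smul hh

protected lemma inner {V : Type*} [NormedAddCommGroup V] [InnerProductSpace ℝ V] {g h : ℝ → V}
    {a b c a' b' c' : V} (hg : Jet2 g a b c) (hh : Jet2 h a' b' c') :
    Jet2 (fun s => inner ℝ (g s) (h s)) (inner ℝ a a') (inner ℝ a b' + inner ℝ b a')
      (inner ℝ a c' + 2 * inner ℝ b b' + inner ℝ c a') := by
  obtain ⟨g', h1, h2, h3, h4⟩ := hg
  obtain ⟨k', k1, k2, k3, k4⟩ := hh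
  refine ⟨fun s => inner ℝ (g s) (k' s) + inner ℝ (g' s) (h s), ?_, by simp [h2, k2],
    by simp [h2, h3, k2, k3], ?_⟩
  · filter_upwards [h1, k1] with s hs ks using hs.inner ℝ ks
  · have := (h1.self_of_nhds.inner ℝ k4).add (h4.inner ℝ k1.self_of_nhds)
    rw [h2, h3, k2, k3] at this
    have e : inner ℝ a c' + 2 * inner ℝ b b' + inner ℝ c a' =
        inner ℝ a c' + inner ℝ b b' + (inner ℝ b b' + inner ℝ c a') := by ring
    rw [e]
    exact this

lemma of_eq {g : ℝ → V} {a b c a' b' c' : V} (h : Jet2 g a b c) (ha : a = a') (hb : b = b')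
    (hc : c = c') : Jet2 g a' b' c' := by subst ha hb hc; exact h

lemma congr {g h : ℝ → V} {a b c : V} (hg : Jet2 g a b c) (h' : g =ᶠ[𝓝 0] h) : Jet2 h a b c := by
  obtain ⟨g', h1, h2, h3, h4⟩ := hg
  refine ⟨g', ?_, h'.self_of_nhds ▸ h2, h3, h4⟩
  filter_upwards [h1, h'.eventuallyEq_nhds] with s hs hs' using hs.congr_of_eventuallyEq hs'.symm

lemma of_contDiffAt_two {g : E → ℝ} {z₀ : E} (hg : ContDiffAt ℝ 2 g z₀) (v : E) :
    Jet2 (fun s : ℝ => g (z₀ + s • v)) (g z₀) (dirDeriv v g z₀) (dirDeriv v (dirDeriv v g) z₀) := by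
  have hline : ∀ s : ℝ, HasDerivAt (fun s : ℝ => z₀ + s • v) v s := fun s => by
    simpa using ((hasDerivAt_id s).smul_const v).const_add z₀
  have hcont : Tendsto (fun s : ℝ => z₀ + s • v) (𝓝 0) (𝓝 z₀) := by
    simpa using (hline 0).continuousAt.tendsto
  refine ⟨fun s => dirDeriv v g (z₀ + s • v), ?_, by simp, by simp, ?_⟩
  · filter_upwards [hcont.eventually (hg.eventually (by simp))] with s hs
    exact (hs.differentiableAt (by simp)).hasFDerivAt.comp_hasDerivAt s (hline s)
  · have h0 : DifferentiableAt ℝ (dirDeriv v g) z₀ :=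
      (((hg.fderiv_right (m := 1) (by norm_num)).clm_apply contDiffAt_const).differentiableAt
        (by simp))
    have h1 : DifferentiableAt ℝ (dirDeriv v g) (z₀ + (0 : ℝ) • v) := by simpa using h0
    have := h1.hasFDerivAt.comp_hasDerivAt (0 : ℝ) (hline 0)
    rw [zero_smul, add_zero] at this
    exact this

lemma of_contDiffAt {g : E → ℝ} {z₀ : E} (hg : ContDiffAt ℝ ∞ g z₀) (v : E) :
    Jet2 (fun s : ℝ => g (z₀ + s • v)) (g z₀) (dirDeriv v g z₀) (dirDeriv v (dirDeriv v g) z₀) :=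
  of_contDiffAt_two (hg.of_le (WithTop.coe_le_coe.2 le_top)) v

/-- The first and second derivative tests at an interior minimum. -/
lemma eq_zero_and_nonneg {q : ℝ → ℝ} {a b c : ℝ} (h : Jet2 q a b c)
    (hmin : ∀ᶠ s in 𝓝 0, a ≤ q s) : b = 0 ∧ 0 ≤ c := by
  have hd := h.hasDerivAt
  obtain ⟨q', h1, h2, h3, h4⟩ := h
  have hloc : IsLocalMin q 0 := by simpa [IsLocalMin, IsMinFilter, h2] using hmin
  have hb : b = 0 := hloc.hasDerivAt_eq_zero hd
  refine ⟨hb, ?_⟩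
  by_contra! hc
  have hder : deriv q =ᶠ[𝓝 0] q' := h1.mono fun s hs => hs.deriv
  have hdd : deriv (deriv q) 0 = c := by rw [hder.deriv_eq]; exact h4.deriv
  have hmax : IsLocalMax q 0 := by
    refine isLocalMax_of_deriv_deriv_neg (by rw [hdd]; exact hc) ?_ hd.continuousAt
    rw [hd.deriv, hb]
  have hconst : q =ᶠ[𝓝 0] fun _ => q 0 := by
    filter_upwards [hloc, hmax] with s h1 h2 using le_antisymm h2 h1
  have : deriv (deriv q) 0 = 0 := by
    rw [hconst.deriv.deriv_eq]; simp
  linarith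

end Jet2

lemma hasDerivAt_nonpos_of_nonneg_left {q : ℝ → ℝ} {b : ℝ} (h : HasDerivAt q b 0) (h0 : q 0 = 0)
    (hq : ∀ᶠ s in 𝓝 0, s ≤ 0 → 0 ≤ q s) : b ≤ 0 := by
  have h1 : Tendsto (slope q 0) (𝓝[<] 0) (𝓝 b) :=
    (hasDerivAt_iff_tendsto_slope.1 h).mono_left
      (nhdsWithin_mono _ fun s (hs : s < 0) => ne_of_lt hs)
  refine le_of_tendsto h1 ?_
  filter_upwards [self_mem_nhdsWithin, mem_nhdsWithin_of_mem_nhds hq] with s hs hqs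
  have hs' : s < 0 := hs
  rw [slope_def_field, h0]
  exact div_nonpos_of_nonneg_of_nonpos (by simpa using hqs hs'.le) (by linarith)

end Calculus

section Concave

variable {n : ℕ}

/-- A symmetric differentiable function on an open symmetric convex cone which is concave,
monotone and homogeneous of degree one. -/
structure IsConcaveSpeed (Γ : Set (Fin n → ℝ)) (f : (Fin n → ℝ) → ℝ) : Prop where
  isOpen_cone : IsOpen Γ
  smul_mem : ∀ κ ∈ Γ, ∀ c : ℝ, 0 < c → c • κ ∈ Γ
  perm_mem : ∀ κ ∈ Γ, ∀ σ : Equiv.Perm (Fin n), κ ∘ σ ∈ Γ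
  differentiableOn : DifferentiableOn ℝ f Γ
  symmetric : ∀ κ ∈ Γ, ∀ σ : Equiv.Perm (Fin n), f (κ ∘ σ) = f κ
  monotoneOn : MonotoneOn f Γ
  homogeneous : ∀ κ ∈ Γ, ∀ c : ℝ, 0 < c → f (c • κ) = c * f κ
  concaveOn : ConcaveOn ℝ Γ f

/-- `p` is a supporting covector of the homogeneous concave function `f` at `κ`. -/
structure IsSupport (Γ : Set (Fin n → ℝ)) (f : (Fin n → ℝ) → ℝ) (κ p : Fin n → ℝ) : Prop where
  nonneg : ∀ i, 0 ≤ p i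
  euler : ∑ i, p i * κ i = f κ
  le : ∀ μ ∈ Γ, f μ ≤ ∑ i, p i * μ i

lemma IsConcaveSpeed.exists_support {Γ : Set (Fin n → ℝ)} {f : (Fin n → ℝ) → ℝ}
    (hf : IsConcaveSpeed Γ f) {κ : Fin n → ℝ} (hκ : κ ∈ Γ) : ∃ p, IsSupport Γ f κ p := by
  have hd : HasFDerivAt f (fderiv ℝ f κ) κ :=
    (hf.differentiableOn.differentiableAt (hf.isOpen_cone.mem_nhds hκ)).hasFDerivAt
  have hline : ∀ v : Fin n → ℝ, HasDerivAt (fun s : ℝ => f (κ + s • v)) (fderiv ℝ f κ v) 0 := by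
    intro v
    have h1 : HasDerivAt (fun s : ℝ => κ + s • v) v 0 := by
      simpa using ((hasDerivAt_id (0 : ℝ)).smul_const v).const_add κ
    have h2 : HasFDerivAt f (fderiv ℝ f κ) (κ + (0 : ℝ) • v) := by simpa using hd
    exact h2.comp_hasDerivAt (0 : ℝ) h1
  have hmem : ∀ v : Fin n → ℝ, ∀ᶠ s : ℝ in 𝓝 0, κ + s • v ∈ Γ := by
    intro v
    have : ContinuousAt (fun s : ℝ => κ + s • v) 0 := by fun_prop
    exact this.eventually_mem (by simpa using hf.isOpen_cone.mem_nhds hκ)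
  have hsum : ∀ v : Fin n → ℝ, fderiv ℝ f κ v = ∑ i, fderiv ℝ f κ (Pi.single i 1) * v i := by
    intro v
    conv_lhs => rw [pi_eq_sum_univ' v]
    rw [map_sum]
    refine Finset.sum_congr rfl fun i _ => ?_
    rw [map_smul, smul_eq_mul, mul_comm]
  have hE : fderiv ℝ f κ κ = f κ := by
    have h1 : HasDerivAt (fun s : ℝ => f (κ + s • κ)) (f κ) 0 := by
      have h2 : HasDerivAt (fun s : ℝ => (1 + s) * f κ) (f κ) 0 := by
        simpa using ((hasDerivAt_id (0 : ℝ)).const_add 1).mul_const (f κ)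
      refine h2.congr_of_eventuallyEq ?_
      filter_upwards [lt_mem_nhds (show (-1 : ℝ) < 0 by norm_num)] with s hs
      rw [← hf.homogeneous κ hκ (1 + s) (by linarith), add_smul, one_smul]
    exact (hline κ).unique h1
  refine ⟨fun i => fderiv ℝ f κ (Pi.single i 1), fun i => ?_, ?_, fun μ hμ => ?_⟩
  · have h1 : HasDerivAt (fun s : ℝ => f κ - f (κ + s • Pi.single i 1))
        (-(fderiv ℝ f κ (Pi.single i 1))) 0 := by
      simpa using (hline (Pi.single i 1)).const_sub (f κ)
    have := hasDerivAt_nonpos_of_nonneg_left h1 (by simp) ?_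
    · linarith
    · filter_upwards [hmem (Pi.single i 1)] with s hs hs0
      have : f (κ + s • Pi.single i 1) ≤ f κ := by
        refine hf.monotoneOn hs hκ fun j => ?_
        simp only [Pi.add_apply, Pi.smul_apply, smul_eq_mul, Pi.single_apply]
        split_ifs <;> linarith
      linarith
  · rw [← hsum, hE]
  · rw [← hsum]
    have h1 : HasDerivAt (fun s : ℝ => f (κ + s • (κ - μ)) - f κ - s * (f κ - f μ))
        (fderiv ℝ f κ (κ - μ) - (f κ - f μ)) 0 := by
      have := ((hline (κ - μ)).sub_const (f κ)).sub
        ((hasDerivAt_id (0 : ℝ)).mul_const (f κ - f μ))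
      simp only [one_mul] at this
      exact this
    have h2 := hasDerivAt_nonpos_of_nonneg_left h1 (by simp) ?_
    · rw [map_sub, hE] at h2
      linarith
    · filter_upwards [lt_mem_nhds (show (-1 : ℝ) < 0 by norm_num)] with s hs hs0
      have h3 := hf.concaveOn.2 hκ hμ (by linarith : 0 ≤ 1 + s)
        (by linarith : 0 ≤ -s) (by ring)
      have h4 : (1 + s) • κ + (-s) • μ = κ + s • (κ - μ) := by
        ext j; simp; ring
      rw [h4] at h3
      simp only [smul_eq_mul] at h3
      nlinarith

lemma IsSupport.le_sum_orthogonal {Γ : Set (Fin n → ℝ)} {f : (Fin n → ℝ) → ℝ}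
    (hf : IsConcaveSpeed Γ f) {κ p : Fin n → ℝ} (hp : IsSupport Γ f κ p) {μ : Fin n → ℝ}
    (hμ : μ ∈ Γ) {O : Matrix (Fin n) (Fin n) ℝ} (hO : O.transpose * O = 1) :
    f μ ≤ ∑ i, p i * (O.transpose * Matrix.diagonal μ * O) i i := by
  have hO' : O * O.transpose = 1 := mul_eq_one_comm.1 hO
  let S : Matrix (Fin n) (Fin n) ℝ := Matrix.of fun i j => O j i ^ 2
  have hS : S ∈ doublyStochastic ℝ (Fin n) := by
    rw [mem_doublyStochastic_iff_sum]
    refine ⟨fun i j => sq_nonneg _, fun i => ?_, fun j => ?_⟩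
    · have := congrFun (congrFun hO i) i
      simpa [Matrix.mul_apply, S, sq] using this
    · have := congrFun (congrFun hO' j) j
      simpa [Matrix.mul_apply, S, sq] using this
  obtain ⟨w, hw0, hw1, hw⟩ := exists_eq_sum_perm_of_mem_doublyStochastic hS
  have hentry : ∀ i, (O.transpose * Matrix.diagonal μ * O) i i = ∑ j, S i j * μ j := by
    intro i
    rw [Matrix.mul_apply]
    simp only [Matrix.mul_diagonal, Matrix.transpose_apply, S, Matrix.of_apply]
    exact Finset.sum_congr rfl fun j _ => by ring
  have hperm : ∀ i, ∑ j, S i j * μ j = ∑ σ : Equiv.Perm (Fin n), w σ * μ (σ i) := by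
    intro i
    have h1 : S.mulVec μ = ∑ σ : Equiv.Perm (Fin n), w σ • (μ ∘ σ) := by
      rw [← hw, Matrix.sum_mulVec]
      exact Finset.sum_congr rfl fun σ _ => by
        rw [Matrix.smul_mulVec, Matrix.permMatrix_mulVec]
    have h2 := congrFun h1 i
    simpa [Matrix.mulVec, dotProduct] using h2
  calc f μ = ∑ σ : Equiv.Perm (Fin n), w σ * f μ := by rw [← Finset.sum_mul, hw1, one_mul]
    _ ≤ ∑ σ : Equiv.Perm (Fin n), w σ * ∑ i, p i * μ (σ i) := by
        refine Finset.sum_le_sum fun σ _ => mul_le_mul_of_nonneg_left ?_ (hw0 σ)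
        rw [← hf.symmetric μ hμ σ]
        exact hp.le _ (hf.perm_mem μ hμ σ)
    _ = ∑ i, p i * (O.transpose * Matrix.diagonal μ * O) i i := by
        simp_rw [hentry, hperm, Finset.mul_sum]
        rw [Finset.sum_comm]
        exact Finset.sum_congr rfl fun i _ => Finset.sum_congr rfl fun σ _ => by ring

/-- The factor `1 / (w (1 + w))`, `w = √(1 + |Φ|²)`, for which `1 - tiltFactor Φ • Φ Φᵀ` is the
inverse square root of `1 + Φ Φᵀ`. -/
def tiltFactor (Φ : Fin n → ℝ) : ℝ :=
  (√(1 + ∑ i, Φ i ^ 2) * (1 + √(1 + ∑ i, Φ i ^ 2)))⁻¹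

/-- The inverse square root of the graph metric `1 + Φ Φᵀ`. -/
def tiltMatrix (Φ : Fin n → ℝ) : Matrix (Fin n) (Fin n) ℝ :=
  1 - tiltFactor Φ • Matrix.vecMulVec Φ Φ

lemma tiltMatrix_mul_metric_mul (Φ : Fin n → ℝ) :
    tiltMatrix Φ * (1 + Matrix.vecMulVec Φ Φ) * tiltMatrix Φ = 1 := by
  set N := Matrix.vecMulVec Φ Φ with hN
  set q := ∑ i, Φ i ^ 2 with hq
  set w := √(1 + q) with hw
  have hq0 : 0 ≤ q := Finset.sum_nonneg fun i _ => sq_nonneg _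
  have hww : w ^ 2 = 1 + q := Real.sq_sqrt (by linarith)
  have hw0 : 0 < w := Real.sqrt_pos.2 (by linarith)
  have hNN : N * N = q • N := by
    rw [hN, Matrix.vecMulVec_mul_vecMulVec, hq]
    have : Φ ⬝ᵥ Φ = ∑ i, Φ i ^ 2 := Finset.sum_congr rfl fun i _ => by ring
    rw [this]
    ext i j
    simp [Matrix.vecMulVec_apply]
    ring
  set r := tiltFactor Φ with hr
  have hr' : r = (w * (1 + w))⁻¹ := rfl
  have key : 1 + (-2 * r + r ^ 2 * q) * (1 + q) = 0 := by
    have : q = w ^ 2 - 1 := by linarith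
    rw [this, hr']
    field_simp
    ring
  have expand : tiltMatrix Φ * (1 + N) * tiltMatrix Φ
      = 1 + (1 + (-2 * r + r ^ 2 * q) * (1 + q)) • N := by
    have h1 : tiltMatrix Φ = 1 - r • N := rfl
    rw [h1]
    have h2 : (1 - r • N) * (1 + N) * (1 - r • N) =
        1 + N - (2 * r) • N - (2 * r) • (N * N) + (r ^ 2) • (N * N) + (r ^ 2) • (N * N * N) := by
      simp only [sub_mul, mul_sub, add_mul, mul_add, one_mul, mul_one, Matrix.smul_mul,
        Matrix.mul_smul, smul_smul]
      module
    rw [h2, hNN, Matrix.smul_mul, hNN]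
    module
  rw [expand, key, zero_smul, add_zero]

lemma transpose_tiltMatrix (Φ : Fin n → ℝ) : (tiltMatrix Φ).transpose = tiltMatrix Φ := by
  simp [tiltMatrix, Matrix.transpose_vecMulVec]

lemma IsSupport.mul_le_sum_tilt {Γ : Set (Fin n → ℝ)} {f : (Fin n → ℝ) → ℝ}
    (hf : IsConcaveSpeed Γ f) {κ p : Fin n → ℝ} (hp : IsSupport Γ f κ p) {μ : Fin n → ℝ}
    (hμ : μ ∈ Γ) {Φ : Fin n → ℝ} {H B : Matrix (Fin n) (Fin n) ℝ} {w : ℝ} (hw : 0 ≤ w)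
    (hB : B.transpose * (1 + Matrix.vecMulVec Φ Φ) * B = 1)
    (hH : B.transpose * H * B = w • Matrix.diagonal μ) :
    w * f μ ≤ ∑ i, p i * (tiltMatrix Φ * H * tiltMatrix Φ) i i := by
  set g := 1 + Matrix.vecMulVec Φ Φ with hg
  set P := tiltMatrix Φ with hP
  have hgt : g.transpose = g := by simp [hg, Matrix.transpose_vecMulVec]
  have hPg : P * g * P = 1 := tiltMatrix_mul_metric_mul Φ
  have hBB : B * B.transpose * g = 1 := by
    rw [mul_assoc]; exact mul_eq_one_comm.1 hB
  have hgB : g * (B * B.transpose) = 1 := mul_eq_one_comm.1 hBB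
  set O := B.transpose * g * P with hO
  have hBO : B * O = P := by
    rw [hO, ← mul_assoc, ← mul_assoc, hBB, one_mul]
  have hOO : O.transpose * O = 1 := by
    have : O.transpose = P * g * B := by
      rw [hO]; simp [Matrix.transpose_mul, hgt, hP, transpose_tiltMatrix, mul_assoc]
    rw [this, mul_assoc, hBO, hPg]
  have hPt : P = O.transpose * B.transpose := by
    rw [← Matrix.transpose_mul, hBO, hP, transpose_tiltMatrix]
  have hPHP : P * H * P = w • (O.transpose * Matrix.diagonal μ * O) := by
    calc P * H * P = O.transpose * B.transpose * H * (B * O) := by rw [hBO, ← hPt]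
      _ = O.transpose * (B.transpose * H * B) * O := by simp only [mul_assoc]
      _ = _ := by rw [hH]; simp
  have := hp.le_sum_orthogonal hf hμ hOO
  calc w * f μ ≤ w * ∑ i, p i * (O.transpose * Matrix.diagonal μ * O) i i :=
        mul_le_mul_of_nonneg_left this hw
    _ = _ := by
        rw [hPHP, Finset.mul_sum]
        exact Finset.sum_congr rfl fun i _ => by simp only [Matrix.smul_apply, smul_eq_mul]; ring

end Concave

section ScalarGraph

variable {n : ℕ}

/-- The `i`-th space direction in `ℝⁿ × ℝ`. -/
def spaceDir (i : Fin n) : EuclideanSpace ℝ (Fin n) × ℝ := (EuclideanSpace.single i 1, 0)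

/-- The time direction in `ℝⁿ × ℝ`. -/
def timeDir : EuclideanSpace ℝ (Fin n) × ℝ := (0, 1)

/-- The spatial gradient of a function on `ℝⁿ × ℝ`. -/
def spaceGrad (φ : EuclideanSpace ℝ (Fin n) × ℝ → ℝ) (z : EuclideanSpace ℝ (Fin n) × ℝ) :
    Fin n → ℝ := fun i => dirDeriv (spaceDir i) φ z

/-- The spatial Hessian of a function on `ℝⁿ × ℝ`. -/
def spaceHess (φ : EuclideanSpace ℝ (Fin n) × ℝ → ℝ) (z : EuclideanSpace ℝ (Fin n) × ℝ) :
    Matrix (Fin n) (Fin n) ℝ :=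
  Matrix.of fun i j => dirDeriv (spaceDir i) (dirDeriv (spaceDir j) φ) z

/-- The weighted trace of the Hessian in the tilted orthonormal frame of the graph of `φ`. -/
def tiltedTrace (p : Fin n → ℝ) (φ : EuclideanSpace ℝ (Fin n) × ℝ → ℝ)
    (z : EuclideanSpace ℝ (Fin n) × ℝ) : ℝ :=
  ∑ i, p i * (tiltMatrix (spaceGrad φ z) * spaceHess φ z * tiltMatrix (spaceGrad φ z)) i i

/-- `φ` is smooth at `z₀` with vanishing spatial gradient there, and its time derivative is bounded
by the tilted trace of its Hessian. -/
structure IsSpeedGraph (p : Fin n → ℝ) (φ : EuclideanSpace ℝ (Fin n) × ℝ → ℝ)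
    (z₀ : EuclideanSpace ℝ (Fin n) × ℝ) : Prop where
  smooth : ContDiffAt ℝ ∞ φ z₀
  grad_eq_zero : ∀ i, dirDeriv (spaceDir i) φ z₀ = 0
  le_tiltedTrace : ∀ᶠ z in 𝓝 z₀, dirDeriv timeDir φ z ≤ tiltedTrace p φ z

variable {φ : EuclideanSpace ℝ (Fin n) × ℝ → ℝ} {z₀ : EuclideanSpace ℝ (Fin n) × ℝ}
  {p : Fin n → ℝ}

lemma contDiffAt_tiltFactor (hφ : ContDiffAt ℝ ∞ φ z₀) :
    ContDiffAt ℝ ∞ (fun z => tiltFactor (spaceGrad φ z)) z₀ := by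
  have h1 : ContDiffAt ℝ ∞ (fun z => 1 + ∑ i, spaceGrad φ z i ^ 2) z₀ :=
    contDiffAt_const.add (ContDiffAt.sum fun i _ => (ContDiffAt.dirDeriv hφ (spaceDir i)).pow 2)
  have hpos : 0 < 1 + ∑ i, spaceGrad φ z₀ i ^ 2 := by
    have : 0 ≤ ∑ i, spaceGrad φ z₀ i ^ 2 := Finset.sum_nonneg fun i _ => sq_nonneg _
    linarith
  have h2 := h1.sqrt hpos.ne'
  have hpos2 := Real.sqrt_pos.2 hpos
  exact (h2.mul (contDiffAt_const.add h2)).inv (by positivity)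

lemma jet2_tiltMatrix (hφ : ContDiffAt ℝ ∞ φ z₀) (h0 : ∀ i, dirDeriv (spaceDir i) φ z₀ = 0)
    (v : EuclideanSpace ℝ (Fin n) × ℝ) (i k : Fin n) :
    Jet2 (fun s : ℝ => tiltMatrix (spaceGrad φ (z₀ + s • v)) i k)
      ((1 : Matrix (Fin n) (Fin n) ℝ) i k) 0
      (-(dirDeriv v (dirDeriv (spaceDir i) φ) z₀ * dirDeriv v (dirDeriv (spaceDir k) φ) z₀)) := by
  have hr := Jet2.of_contDiffAt (contDiffAt_tiltFactor hφ) v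
  have hi := Jet2.of_contDiffAt (ContDiffAt.dirDeriv hφ (spaceDir i)) v
  have hk := Jet2.of_contDiffAt (ContDiffAt.dirDeriv hφ (spaceDir k)) v
  have hr0 : tiltFactor (spaceGrad φ z₀) = 1 / 2 := by
    have : spaceGrad φ z₀ = 0 := funext h0
    rw [this, tiltFactor]
    simp
    norm_num
  refine ((Jet2.const ((1 : Matrix (Fin n) (Fin n) ℝ) i k)).sub (hr.mul (hi.mul hk))).of_eq
    ?_ ?_ ?_
  · rw [h0 i]; ring
  · rw [h0 i, h0 k]; ring
  · rw [h0 i, h0 k, hr0]; ring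

lemma jet2_tiltedTrace (hφ : ContDiffAt ℝ ∞ φ z₀) (h0 : ∀ i, dirDeriv (spaceDir i) φ z₀ = 0)
    (v : EuclideanSpace ℝ (Fin n) × ℝ) :
    Jet2 (fun s : ℝ => tiltedTrace p φ (z₀ + s • v)) (∑ i, p i * spaceHess φ z₀ i i)
      (∑ i, p i * dirDeriv v (dirDeriv (spaceDir i) (dirDeriv (spaceDir i) φ)) z₀)
      (∑ i, p i * (dirDeriv v (dirDeriv v (dirDeriv (spaceDir i) (dirDeriv (spaceDir i) φ))) z₀
        - ∑ k, dirDeriv v (dirDeriv (spaceDir i) φ) z₀ * dirDeriv v (dirDeriv (spaceDir k) φ) z₀ *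
          (spaceHess φ z₀ i k + spaceHess φ z₀ k i))) := by
  have hH : ∀ i k, Jet2 (fun s : ℝ => spaceHess φ (z₀ + s • v) i k) (spaceHess φ z₀ i k)
      (dirDeriv v (dirDeriv (spaceDir i) (dirDeriv (spaceDir k) φ)) z₀)
      (dirDeriv v (dirDeriv v (dirDeriv (spaceDir i) (dirDeriv (spaceDir k) φ))) z₀) :=
    fun i k => Jet2.of_contDiffAt
      (ContDiffAt.dirDeriv (ContDiffAt.dirDeriv hφ (spaceDir k)) (spaceDir i)) v
  have hP := jet2_tiltMatrix hφ h0 v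
  have hfun : (fun s : ℝ => tiltedTrace p φ (z₀ + s • v)) = fun s : ℝ =>
      ∑ i, p i * ∑ l, (∑ k, tiltMatrix (spaceGrad φ (z₀ + s • v)) i k *
        spaceHess φ (z₀ + s • v) k l) * tiltMatrix (spaceGrad φ (z₀ + s • v)) l i := by
    funext s
    simp only [tiltedTrace, Matrix.mul_apply]
  rw [hfun]
  refine (Jet2.sum Finset.univ fun i _ => (Jet2.const (p i)).mul (Jet2.sum Finset.univ fun l _ =>
    (Jet2.sum Finset.univ fun k _ => (hP i k).mul (hH k l)).mul (hP l i))).of_eq ?_ ?_ ?_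
  · refine Finset.sum_congr rfl fun i _ => ?_
    simp [Matrix.one_apply]
  · refine Finset.sum_congr rfl fun i _ => ?_
    simp [Matrix.one_apply]
  · refine Finset.sum_congr rfl fun i _ => ?_
    simp only [Matrix.one_apply, ite_mul, one_mul, zero_mul, mul_ite, mul_one, mul_zero,
      Finset.sum_add_distrib, Finset.sum_ite_eq, Finset.sum_ite_eq', Finset.mem_univ, if_true,
      add_zero, zero_add, mul_neg, neg_mul, Finset.sum_neg_distrib]
    have e : ∀ A B C : ℝ, B + C = A → ∀ H : ℝ, -B + (H + -C) = H - A := fun A B C h H => by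
      rw [← h]; ring
    congr 1
    refine e _ _ _ ?_ _
    rw [← Finset.sum_add_distrib]
    exact Finset.sum_congr rfl fun k _ => by ring

/-- If the speed inequality is an equality at `z₀`, then it can be differentiated there once, and
its second derivative has a sign. -/
lemma IsSpeedGraph.dirDeriv_time (h : IsSpeedGraph p φ z₀)
    (heq : dirDeriv timeDir φ z₀ = ∑ i, p i * spaceHess φ z₀ i i)
    (v : EuclideanSpace ℝ (Fin n) × ℝ) :
    dirDeriv v (dirDeriv timeDir φ) z₀ =
      ∑ i, p i * dirDeriv v (dirDeriv (spaceDir i) (dirDeriv (spaceDir i) φ)) z₀ ∧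
    dirDeriv v (dirDeriv v (dirDeriv timeDir φ)) z₀ ≤
      ∑ i, p i * (dirDeriv v (dirDeriv v (dirDeriv (spaceDir i) (dirDeriv (spaceDir i) φ))) z₀
        - ∑ k, dirDeriv v (dirDeriv (spaceDir i) φ) z₀ * dirDeriv v (dirDeriv (spaceDir k) φ) z₀ *
          (spaceHess φ z₀ i k + spaceHess φ z₀ k i)) := by
  have h1 := (jet2_tiltedTrace (p := p) h.smooth h.grad_eq_zero v).sub
    (Jet2.of_contDiffAt (ContDiffAt.dirDeriv h.smooth timeDir) v)
  have hcont : Tendsto (fun s : ℝ => z₀ + s • v) (𝓝 0) (𝓝 z₀) := by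
    have : Continuous (fun s : ℝ => z₀ + s • v) := by fun_prop
    simpa using this.tendsto 0
  have h2 := h1.eq_zero_and_nonneg (by
    filter_upwards [hcont.eventually h.le_tiltedTrace] with s hs
    rw [heq]
    linarith)
  constructor <;> linarith [h2.1, h2.2]

lemma dirDeriv_comm_three (hφ : ContDiffAt ℝ ∞ φ z₀) (v w : EuclideanSpace ℝ (Fin n) × ℝ) :
    dirDeriv v (dirDeriv w (dirDeriv w φ)) =ᶠ[𝓝 z₀] dirDeriv w (dirDeriv w (dirDeriv v φ)) :=
  (dirDeriv_comm (ContDiffAt.dirDeriv hφ w) v w).trans (dirDeriv_congr (dirDeriv_comm hφ v w) w)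

lemma dirDeriv_comm_four (hφ : ContDiffAt ℝ ∞ φ z₀) (v w : EuclideanSpace ℝ (Fin n) × ℝ) :
    dirDeriv v (dirDeriv v (dirDeriv w (dirDeriv w φ))) =ᶠ[𝓝 z₀]
      dirDeriv w (dirDeriv w (dirDeriv v (dirDeriv v φ))) :=
  (dirDeriv_congr (dirDeriv_comm_three hφ v w) v).trans
    (dirDeriv_comm_three (ContDiffAt.dirDeriv hφ v) v w)

lemma IsSpeedGraph.dirDeriv_time_time (h : IsSpeedGraph p φ z₀)
    (heq : dirDeriv timeDir φ z₀ = ∑ i, p i * spaceHess φ z₀ i i) :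
    dirDeriv timeDir (dirDeriv timeDir φ) z₀ =
      ∑ i, p i * dirDeriv (spaceDir i) (dirDeriv (spaceDir i) (dirDeriv timeDir φ)) z₀ := by
  rw [(h.dirDeriv_time heq timeDir).1]
  exact Finset.sum_congr rfl fun i _ => by
    rw [(dirDeriv_comm_three h.smooth timeDir (spaceDir i)).self_of_nhds]

/-- The largest principal curvature cannot touch `a F` from below at `z₀` if `a' F > 0`. -/
theorem IsSpeedGraph.not_diagonal_touching (h : IsSpeedGraph p φ z₀) (hp : ∀ i, 0 ≤ p i)
    (heq : dirDeriv timeDir φ z₀ = ∑ i, p i * spaceHess φ z₀ i i)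
    {κ : Fin n → ℝ} (hκ : spaceHess φ z₀ = Matrix.diagonal κ) {a : ℝ → ℝ} {a' a'' : ℝ}
    (ha : Jet2 (fun s => a (z₀.2 + s)) (a z₀.2) a' a'') (j : Fin n)
    (htouch : a z₀.2 * dirDeriv timeDir φ z₀ = κ j)
    (hge : ∀ᶠ z in 𝓝 z₀, z.2 ≤ z₀.2 → 0 ≤ a z.2 * dirDeriv timeDir φ z *
      (1 + dirDeriv (spaceDir j) φ z * dirDeriv (spaceDir j) φ z) -
        dirDeriv (spaceDir j) (dirDeriv (spaceDir j) φ) z)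
    (hpos : 0 < a' * dirDeriv timeDir φ z₀) : False := by
  have hφ := h.smooth
  have hcont : ∀ v, Tendsto (fun s : ℝ => z₀ + s • v) (𝓝 0) (𝓝 z₀) := fun v => by
    have : Continuous (fun s : ℝ => z₀ + s • v) := by fun_prop
    simpa using this.tendsto 0
  have hent : ∀ i k, dirDeriv (spaceDir i) (dirDeriv (spaceDir k) φ) z₀ =
      if i = k then κ i else 0 := fun i k => by
    have := congrFun (congrFun hκ i) k
    simpa [spaceHess, Matrix.diagonal_apply] using this
  have hspace : ∀ i, 0 ≤ a z₀.2 *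
      dirDeriv (spaceDir i) (dirDeriv (spaceDir i) (dirDeriv timeDir φ)) z₀ +
      (if i = j then 2 * κ j ^ 3 else 0) -
      dirDeriv (spaceDir j) (dirDeriv (spaceDir j) (dirDeriv (spaceDir i) (dirDeriv (spaceDir i) φ)))
        z₀ := by
    intro i
    have hj := Jet2.of_contDiffAt (ContDiffAt.dirDeriv hφ (spaceDir j)) (spaceDir i)
    have ht := Jet2.of_contDiffAt (ContDiffAt.dirDeriv hφ timeDir) (spaceDir i)
    have hjj := Jet2.of_contDiffAt
      (ContDiffAt.dirDeriv (ContDiffAt.dirDeriv hφ (spaceDir j)) (spaceDir j)) (spaceDir i)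
    have hq := (((Jet2.const (a z₀.2)).mul ht).mul ((Jet2.const 1).add (hj.mul hj))).sub hjj
    have h2 := (hq.eq_zero_and_nonneg (by
      filter_upwards [(hcont (spaceDir i)).eventually hge] with s hs
      have := hs (by simp [spaceDir])
      rw [htouch, hent j j, h.grad_eq_zero]
      simpa [spaceDir] using this)).2
    rw [h.grad_eq_zero, hent i j,
      (dirDeriv_comm_four hφ (spaceDir i) (spaceDir j)).self_of_nhds] at h2
    split_ifs at h2 ⊢ with hij
    · subst hij
      have e : 2 * κ i ^ 3 = 2 * (a z₀.2 * dirDeriv timeDir φ z₀) * κ i ^ 2 := by rw [htouch]; ring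
      rw [e]
      linarith
    · linarith
  have hsum : 0 ≤ ∑ i, p i * (a z₀.2 *
      dirDeriv (spaceDir i) (dirDeriv (spaceDir i) (dirDeriv timeDir φ)) z₀ +
      (if i = j then 2 * κ j ^ 3 else 0) -
      dirDeriv (spaceDir j) (dirDeriv (spaceDir j) (dirDeriv (spaceDir i) (dirDeriv (spaceDir i) φ)))
        z₀) := Finset.sum_nonneg fun i _ => mul_nonneg (hp i) (hspace i)
  have htt := h.dirDeriv_time_time heq
  have hjj := (h.dirDeriv_time heq (spaceDir j)).2
  have hcorr : ∀ i, ∑ k, dirDeriv (spaceDir j) (dirDeriv (spaceDir i) φ) z₀ *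
      dirDeriv (spaceDir j) (dirDeriv (spaceDir k) φ) z₀ *
      (spaceHess φ z₀ i k + spaceHess φ z₀ k i) = if i = j then 2 * κ j ^ 3 else 0 := by
    intro i
    rw [hκ]
    simp only [hent]
    by_cases hij : i = j
    · subst hij
      rw [Finset.sum_eq_single i (fun k _ hk => by simp [Ne.symm hk]) (by simp)]
      simp
      ring
    · simp [hij, Ne.symm hij]
  simp only [hcorr] at hjj
  have hkey : dirDeriv (spaceDir j) (dirDeriv (spaceDir j) (dirDeriv timeDir φ)) z₀ ≤
      a z₀.2 * dirDeriv timeDir (dirDeriv timeDir φ) z₀ := by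
    rw [htt, Finset.mul_sum]
    refine hjj.trans ?_
    rw [← sub_nonneg, ← Finset.sum_sub_distrib]
    refine hsum.trans_eq (Finset.sum_congr rfl fun i _ => ?_)
    ring
  have htime : a z₀.2 * dirDeriv timeDir (dirDeriv timeDir φ) z₀ + a' * dirDeriv timeDir φ z₀ -
      dirDeriv (spaceDir j) (dirDeriv (spaceDir j) (dirDeriv timeDir φ)) z₀ ≤ 0 := by
    have hj := Jet2.of_contDiffAt (ContDiffAt.dirDeriv hφ (spaceDir j)) timeDir
    have ht := Jet2.of_contDiffAt (ContDiffAt.dirDeriv hφ timeDir) timeDir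
    have hjj := Jet2.of_contDiffAt
      (ContDiffAt.dirDeriv (ContDiffAt.dirDeriv hφ (spaceDir j)) (spaceDir j)) timeDir
    have hq := ((ha.mul ht).mul ((Jet2.const 1).add (hj.mul hj))).sub hjj
    have h2 := hasDerivAt_nonpos_of_nonneg_left hq.hasDerivAt
      (by simp [h.grad_eq_zero, htouch, hent]) (by
      filter_upwards [(hcont timeDir).eventually hge] with s hs hs0
      have := hs (by simpa [timeDir] using hs0)
      simpa [timeDir] using this)
    rw [h.grad_eq_zero, (dirDeriv_comm_three hφ timeDir (spaceDir j)).self_of_nhds] at h2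
    linarith
  linarith

/-- The point over `u` at time `t` of the graph of `-φ` in the frame `e, ν₀` based at `X₀`. -/
def graphPoint {V : Type*} [NormedAddCommGroup V] [InnerProductSpace ℝ V] (X₀ : V) (e : Fin n → V)
    (ν₀ : V) (φ : EuclideanSpace ℝ (Fin n) × ℝ → ℝ) (z : EuclideanSpace ℝ (Fin n) × ℝ) : V :=
  X₀ + ∑ i, z.1 i • e i - φ z • ν₀

/-- The non-normalized normal `ν₀ + ∑ φ_i e_i` of the graph. -/
def graphNormal {V : Type*} [NormedAddCommGroup V] [InnerProductSpace ℝ V] (e : Fin n → V)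
    (ν₀ : V) (φ : EuclideanSpace ℝ (Fin n) × ℝ → ℝ) (z : EuclideanSpace ℝ (Fin n) × ℝ) : V :=
  ν₀ + ∑ i, dirDeriv (spaceDir i) φ z • e i

/-- Reflection in the hyperplane orthogonal to `D`. -/
def reflectAlong {V : Type*} [NormedAddCommGroup V] [InnerProductSpace ℝ V] (D v : V) : V :=
  v - (2 * inner ℝ D v / inner ℝ D D) • D

section Reflect

variable {V : Type*} [NormedAddCommGroup V] [InnerProductSpace ℝ V] {D : V}

lemma inner_reflectAlong_reflectAlong (hD : D ≠ 0) (v w : V) :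
    inner ℝ (reflectAlong D v) (reflectAlong D w) = inner ℝ v w := by
  have hd : inner ℝ D D ≠ 0 := inner_self_ne_zero.2 hD
  simp only [reflectAlong, inner_sub_left, inner_sub_right, real_inner_smul_left,
    real_inner_smul_right]
  rw [real_inner_comm D v]
  field_simp
  ring

lemma inner_reflectAlong_self (hD : D ≠ 0) (v : V) :
    inner ℝ D (reflectAlong D v) = -inner ℝ D v := by
  have hd : inner ℝ D D ≠ 0 := inner_self_ne_zero.2 hD
  simp only [reflectAlong, inner_sub_right, real_inner_smul_right]
  field_simp
  ring

end Reflect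

lemma jet2_graphPoint {V : Type*} [NormedAddCommGroup V] [InnerProductSpace ℝ V] (X₀ : V)
    (e : Fin n → V) (ν₀ : V) (hφ : ContDiffAt ℝ 2 φ z₀) (v : EuclideanSpace ℝ (Fin n) × ℝ) :
    Jet2 (fun s : ℝ => graphPoint X₀ e ν₀ φ (z₀ + s • v)) (graphPoint X₀ e ν₀ φ z₀)
      (∑ i, v.1 i • e i - dirDeriv v φ z₀ • ν₀) (-(dirDeriv v (dirDeriv v φ) z₀ • ν₀)) := by
  have h1 : Jet2 (fun s : ℝ => ∑ i, (z₀.1 i + s * v.1 i) • e i) (∑ i, z₀.1 i • e i)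
      (∑ i, v.1 i • e i) (∑ _i : Fin n, (0 : V)) := by
    refine Jet2.sum _ fun i _ => ?_
    have := (Jet2.const (z₀.1 i • e i)).add (Jet2.smul_const (v.1 i • e i))
    refine (this.of_eq (by simp) (by simp) (by simp)).congr (Eventually.of_forall fun s => ?_)
    simp [add_smul, mul_smul]
  have h2 := (Jet2.of_contDiffAt_two hφ v).smul (Jet2.const ν₀)
  refine (((Jet2.const X₀).add h1).sub h2).of_eq ?_ ?_ ?_ |>.congr
    (Eventually.of_forall fun s => ?_)
  · simp [graphPoint]
  · simp
  · simp
  · simp [graphPoint]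

lemma jet2_graphNormal {V : Type*} [NormedAddCommGroup V] [InnerProductSpace ℝ V]
    (e : Fin n → V) (ν₀ : V) (hφ : ContDiffAt ℝ ∞ φ z₀) (v : EuclideanSpace ℝ (Fin n) × ℝ) :
    Jet2 (fun s : ℝ => graphNormal e ν₀ φ (z₀ + s • v)) (graphNormal e ν₀ φ z₀)
      (∑ i, dirDeriv v (dirDeriv (spaceDir i) φ) z₀ • e i)
      (∑ i, dirDeriv v (dirDeriv v (dirDeriv (spaceDir i) φ)) z₀ • e i) := by
  refine ((Jet2.const ν₀).add (Jet2.sum Finset.univ fun i _ => (Jet2.of_contDiffAt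
    (ContDiffAt.dirDeriv hφ (spaceDir i)) v).smul (Jet2.const (e i)))).of_eq ?_ ?_ ?_
  · rfl
  · simp
  · simp

/-- Two distinct points of the hypersurface cannot lie on a common touching sphere of curvature
`a F` at the first point if `a' F > 0`. -/
theorem IsSpeedGraph.not_offDiagonal_touching {V : Type*} [NormedAddCommGroup V]
    [InnerProductSpace ℝ V] {X₀ Y₀ ν₀ : V} {e : Fin n → V} {t₀ : ℝ}
    {ψ : EuclideanSpace ℝ (Fin n) × ℝ → ℝ}
    (h : IsSpeedGraph p φ (0, t₀)) (h' : IsSpeedGraph p ψ (0, t₀)) (hp : ∀ i, 0 ≤ p i)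
    (hφ0 : φ (0, t₀) = 0) (hψ0 : ψ (0, t₀) = 0)
    (hν : inner ℝ ν₀ ν₀ = (1 : ℝ)) (heν : ∀ i, inner ℝ (e i) ν₀ = (0 : ℝ))
    (heq : dirDeriv timeDir φ (0, t₀) = ∑ i, p i * spaceHess φ (0, t₀) i i)
    {κ : Fin n → ℝ} (hκ : spaceHess φ (0, t₀) = Matrix.diagonal κ) {a : ℝ → ℝ} {a' a'' : ℝ}
    (ha : Jet2 (fun s => a (t₀ + s)) (a t₀) a' a'')
    (hκle : ∀ i, κ i ≤ a t₀ * dirDeriv timeDir φ (0, t₀)) (hD : X₀ - Y₀ ≠ 0)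
    (htouch : a t₀ * dirDeriv timeDir φ (0, t₀) / 2 * inner ℝ (X₀ - Y₀) (X₀ - Y₀) =
      inner ℝ (X₀ - Y₀) ν₀)
    (hge : ∀ᶠ z : (EuclideanSpace ℝ (Fin n) × ℝ) × (EuclideanSpace ℝ (Fin n) × ℝ) in
      𝓝 ((0, t₀), (0, t₀)), z.1.2 = z.2.2 → z.1.2 ≤ t₀ →
      0 ≤ a z.1.2 * dirDeriv timeDir φ z.1 / 2 *
        inner ℝ (graphPoint X₀ e ν₀ φ z.1 - graphPoint Y₀ (fun i => reflectAlong (X₀ - Y₀) (e i))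
          (reflectAlong (X₀ - Y₀) ν₀) ψ z.2)
          (graphPoint X₀ e ν₀ φ z.1 - graphPoint Y₀ (fun i => reflectAlong (X₀ - Y₀) (e i))
          (reflectAlong (X₀ - Y₀) ν₀) ψ z.2) -
        inner ℝ (graphPoint X₀ e ν₀ φ z.1 - graphPoint Y₀ (fun i => reflectAlong (X₀ - Y₀) (e i))
          (reflectAlong (X₀ - Y₀) ν₀) ψ z.2) (graphNormal e ν₀ φ z.1))
    (hpos : 0 < a' * dirDeriv timeDir φ (0, t₀)) : False := by
  have hφ := h.smooth
  have hψ := h'.smooth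
  have hφ₂ : ContDiffAt ℝ 2 φ (0, t₀) := hφ.of_le ENat.LEInfty.out
  have hψ₂ : ContDiffAt ℝ 2 ψ (0, t₀) := hψ.of_le ENat.LEInfty.out
  set z₀ : EuclideanSpace ℝ (Fin n) × ℝ := (0, t₀) with hz₀
  set D := X₀ - Y₀ with hDdef
  set e' : Fin n → V := fun i => reflectAlong D (e i) with he'
  set ν' : V := reflectAlong D ν₀ with hν'
  set ft := dirDeriv timeDir φ z₀ with hft
  set K := a t₀ * ft with hK
  set d2 : ℝ := inner ℝ D D with hd2
  have hd2pos : 0 < d2 := real_inner_self_pos.2 hD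
  set Dν : ℝ := inner ℝ D ν₀ with hDν
  have hDν' : inner ℝ D ν' = -Dν := inner_reflectAlong_self hD ν₀
  have hνν' : inner ℝ ν' ν₀ = 1 - K * Dν := by
    simp only [hν', reflectAlong, inner_sub_left, real_inner_smul_left]
    rw [hν, ← hDν, ← htouch, ← hd2]
    field_simp
  have hcont : ∀ v w : EuclideanSpace ℝ (Fin n) × ℝ,
      Tendsto (fun s : ℝ => (z₀ + s • v, z₀ + s • w)) (𝓝 0) (𝓝 (z₀, z₀)) := fun v w => by
    have : Continuous (fun s : ℝ => (z₀ + s • v, z₀ + s • w)) := by fun_prop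
    simpa using this.tendsto 0
  have hent : ∀ i k, dirDeriv (spaceDir i) (dirDeriv (spaceDir k) φ) z₀ =
      if i = k then κ i else 0 := fun i k => by
    have := congrFun (congrFun hκ i) k
    simpa [spaceHess, Matrix.diagonal_apply] using this
  have hX0 : graphPoint X₀ e ν₀ φ z₀ = X₀ := by
    rw [graphPoint, hφ0]; simp [hz₀]
  have hY0 : graphPoint Y₀ e' ν' ψ z₀ = Y₀ := by
    rw [graphPoint, hψ0]; simp [hz₀]
  have hN0 : graphNormal e ν₀ φ z₀ = ν₀ := by simp [graphNormal, h.grad_eq_zero]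
  have hsing : ∀ (i : Fin n) (b : Fin n → V),
      ∑ k, (spaceDir i : EuclideanSpace ℝ (Fin n) × ℝ).1 k • b k = b i := fun i b => by
    simp [spaceDir]
  have hfirst : ∀ i, dirDeriv (spaceDir i) (dirDeriv timeDir φ) z₀ * a t₀ * d2 / 2 =
      (κ i - K) * inner ℝ D (e i) := by
    intro i
    have hX := jet2_graphPoint X₀ e ν₀ hφ₂ (spaceDir i)
    have hΔ := hX.sub (Jet2.const Y₀)
    have hN := jet2_graphNormal e ν₀ hφ (spaceDir i)
    have ht := Jet2.of_contDiffAt (ContDiffAt.dirDeriv hφ timeDir) (spaceDir i)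
    have hq := ((((Jet2.const (a t₀)).mul ht).mul (Jet2.const (1 / 2 : ℝ))).mul
      (hΔ.inner hΔ)).sub (hΔ.inner hN)
    have h2 := (hq.eq_zero_and_nonneg (by
      filter_upwards [(hcont (spaceDir i) 0).eventually hge] with s hs
      have := hs (by simp [spaceDir]) (by simp [hz₀, spaceDir])
      simp only [smul_zero, add_zero, hY0] at this
      rw [hX0, hN0, ← hDdef, ← hd2, ← hDν, ← htouch]
      simp only [hz₀, spaceDir, Prod.snd_add, Prod.smul_snd, smul_zero, add_zero] at this ⊢
      linarith)).1
    rw [hX0, hN0, ← hDdef, hsing, h.grad_eq_zero, zero_smul, sub_zero] at h2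
    simp only [hent, ite_smul, zero_smul, Finset.sum_ite_eq, Finset.mem_univ, if_true,
      inner_smul_right, heν, sub_zero, add_zero, zero_mul, zero_add, mul_zero,
      real_inner_comm D (e i)] at h2
    rw [← hft, ← hd2] at h2
    rw [hK]
    linarith
  have hsecond : ∀ i, 0 ≤ a t₀ * d2 / 2 *
      dirDeriv (spaceDir i) (dirDeriv (spaceDir i) (dirDeriv timeDir φ)) z₀ +
      4 * (κ i - K) * inner ℝ D (e i) ^ 2 / d2 - K * κ i * Dν + κ i - spaceHess ψ z₀ i i -
      ∑ k, dirDeriv (spaceDir i) (dirDeriv (spaceDir i) (dirDeriv (spaceDir k) φ)) z₀ *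
        inner ℝ D (e k) := by
    intro i
    have hX := jet2_graphPoint X₀ e ν₀ hφ₂ (spaceDir i)
    have hY := jet2_graphPoint Y₀ e' ν' hψ₂ (spaceDir i)
    have hΔ := hX.sub hY
    have hN := jet2_graphNormal e ν₀ hφ (spaceDir i)
    have ht := Jet2.of_contDiffAt (ContDiffAt.dirDeriv hφ timeDir) (spaceDir i)
    have hq := ((((Jet2.const (a t₀)).mul ht).mul (Jet2.const (1 / 2 : ℝ))).mul
      (hΔ.inner hΔ)).sub (hΔ.inner hN)
    have h2 := (hq.eq_zero_and_nonneg (by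
      filter_upwards [(hcont (spaceDir i) (spaceDir i)).eventually hge] with s hs
      have := hs rfl (by simp [hz₀, spaceDir])
      rw [hX0, hN0, hY0, ← hDdef, ← hd2, ← hDν, ← htouch]
      simp only [hz₀, spaceDir, Prod.snd_add, Prod.smul_snd, smul_zero, add_zero] at this ⊢
      linarith)).2
    set Di : ℝ := inner ℝ D (e i) with hDi
    have hee : e i - e' i = (2 * Di / d2) • D := by simp [he', reflectAlong, hDi, hd2]
    rw [hX0, hY0, hN0, ← hDdef, hsing, hsing, h.grad_eq_zero, h'.grad_eq_zero, zero_smul, zero_smul,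
      sub_zero, sub_zero, hee, hent i i, if_pos rfl] at h2
    simp only [hent, ite_smul, zero_smul, Finset.sum_ite_eq, Finset.mem_univ, if_true,
      inner_smul_right, real_inner_smul_left, inner_sub_left, inner_sub_right, inner_neg_left,
      inner_neg_right, inner_sum, hν, real_inner_comm D ν₀, real_inner_comm D ν', hDν', hνν',
      ← hDi, ← hDν, ← hd2] at h2
    have hf := hfirst i
    rw [← hDi] at hf
    have hf' : dirDeriv (spaceDir i) (dirDeriv timeDir φ) z₀ * a t₀ = 2 * (κ i - K) * Di / d2 := by
      field_simp
      linarith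
    have hψi : dirDeriv (spaceDir i) (dirDeriv (spaceDir i) ψ) z₀ = spaceHess ψ z₀ i i := rfl
    rw [hψi] at h2
    have e1 : 2 * Di / d2 * d2 = 2 * Di := div_mul_cancel₀ _ hd2pos.ne'
    rw [e1, ← hft] at h2
    refine h2.trans_eq ?_
    linear_combination (4 * Di) * hf' - (-κ i * Dν - spaceHess ψ z₀ i i * Dν + 4 * Di ^ 2 / d2) * hK
  have htr : tiltedTrace p ψ z₀ = ∑ i, p i * spaceHess ψ z₀ i i := by
    obtain ⟨_, _, h2, _⟩ := jet2_tiltedTrace (p := p) hψ h'.grad_eq_zero 0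
    simpa using h2
  have hψt : dirDeriv timeDir ψ z₀ ≤ ∑ i, p i * spaceHess ψ z₀ i i :=
    htr ▸ h'.le_tiltedTrace.self_of_nhds
  have hpκ : ∑ i, p i * κ i = ft := by
    rw [heq, hκ]; simp
  set G := ∑ k, dirDeriv (spaceDir k) (dirDeriv timeDir φ) z₀ * inner ℝ D (e k) with hG
  have hGsum : ∑ i, p i * ∑ k, dirDeriv (spaceDir i) (dirDeriv (spaceDir i)
      (dirDeriv (spaceDir k) φ)) z₀ * inner ℝ D (e k) = G := by
    simp_rw [Finset.mul_sum]
    rw [Finset.sum_comm, hG]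
    refine Finset.sum_congr rfl fun k _ => ?_
    rw [(h.dirDeriv_time heq (spaceDir k)).1, Finset.sum_mul]
    refine Finset.sum_congr rfl fun i _ => ?_
    rw [(dirDeriv_comm_three hφ (spaceDir k) (spaceDir i)).self_of_nhds]
    ring
  have hsum : 0 ≤ a t₀ * d2 / 2 * dirDeriv timeDir (dirDeriv timeDir φ) z₀ - K * ft * Dν + ft -
      dirDeriv timeDir ψ z₀ - G := by
    have h1 : ∑ i, p i * (4 * (κ i - K) * inner ℝ D (e i) ^ 2 / d2) ≤ 0 := by
      refine Finset.sum_nonpos fun i _ => mul_nonpos_of_nonneg_of_nonpos (hp i) ?_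
      refine div_nonpos_of_nonpos_of_nonneg (mul_nonpos_of_nonpos_of_nonneg ?_ (sq_nonneg _))
        hd2pos.le
      linarith [hκle i]
    have h2 : 0 ≤ ∑ i, p i * (a t₀ * d2 / 2 *
        dirDeriv (spaceDir i) (dirDeriv (spaceDir i) (dirDeriv timeDir φ)) z₀ +
        4 * (κ i - K) * inner ℝ D (e i) ^ 2 / d2 - K * κ i * Dν + κ i - spaceHess ψ z₀ i i -
        ∑ k, dirDeriv (spaceDir i) (dirDeriv (spaceDir i) (dirDeriv (spaceDir k) φ)) z₀ *
          inner ℝ D (e k)) := Finset.sum_nonneg fun i _ => mul_nonneg (hp i) (hsecond i)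
    simp only [mul_sub, mul_add, Finset.sum_sub_distrib, Finset.sum_add_distrib, hGsum, hpκ] at h2
    have h3 : ∑ i, p i * (a t₀ * d2 / 2 *
        dirDeriv (spaceDir i) (dirDeriv (spaceDir i) (dirDeriv timeDir φ)) z₀) =
        a t₀ * d2 / 2 * dirDeriv timeDir (dirDeriv timeDir φ) z₀ := by
      rw [h.dirDeriv_time_time heq, Finset.mul_sum]
      exact Finset.sum_congr rfl fun i _ => by ring
    have h4 : ∑ i, p i * (K * κ i * Dν) = K * ft * Dν := by
      rw [← hpκ, Finset.mul_sum, Finset.sum_mul]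
      exact Finset.sum_congr rfl fun i _ => by ring
    rw [h3, h4] at h2
    simp only [mul_sub] at h1
    linarith
  have htime : (a t₀ * dirDeriv timeDir (dirDeriv timeDir φ) z₀ + a' * ft) * d2 / 2 -
      K * ft * Dν + ft - dirDeriv timeDir ψ z₀ - G ≤ 0 := by
    have hX := jet2_graphPoint X₀ e ν₀ hφ₂ timeDir
    have hY := jet2_graphPoint Y₀ e' ν' hψ₂ timeDir
    have hΔ := hX.sub hY
    have hN := jet2_graphNormal e ν₀ hφ timeDir
    have ht := Jet2.of_contDiffAt (ContDiffAt.dirDeriv hφ timeDir) timeDir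
    have hq := (((ha.mul ht).mul (Jet2.const (1 / 2 : ℝ))).mul (hΔ.inner hΔ)).sub (hΔ.inner hN)
    have h2 := hasDerivAt_nonpos_of_nonneg_left hq.hasDerivAt (by
      simp only [zero_smul, add_zero, hX0, hY0, hN0, ← hDdef, ← hd2, ← hDν, ← hft]
      linarith) (by
      filter_upwards [(hcont timeDir timeDir).eventually hge] with s hs hs0
      have := hs rfl (by simpa [hz₀, timeDir] using hs0)
      simp only [hz₀, timeDir, Prod.snd_add, Prod.smul_snd, smul_eq_mul, mul_one] at this ⊢
      linarith)
    have hzero : ∀ b : Fin n → V, ∑ i, (timeDir : EuclideanSpace ℝ (Fin n) × ℝ).1 i • b i = 0 :=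
      fun b => by simp [timeDir]
    have hG' : ∑ k, dirDeriv timeDir (dirDeriv (spaceDir k) φ) z₀ * inner ℝ D (e k) = G := by
      rw [hG]
      exact Finset.sum_congr rfl fun k _ => by rw [(dirDeriv_comm hφ _ _).self_of_nhds]
    rw [hX0, hY0, hN0, ← hDdef, hzero, hzero] at h2
    simp only [inner_smul_right, real_inner_smul_left, inner_sub_left, inner_sub_right,
      inner_neg_left, inner_neg_right, inner_sum, hν, real_inner_comm D ν₀, real_inner_comm D ν',
      hDν', hνν', ← hDν, ← hd2, ← hft, zero_sub, hG'] at h2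
    refine le_of_eq_of_le ?_ h2
    linear_combination ((ft + dirDeriv timeDir ψ z₀) * Dν) * hK
  have : 0 < a' * ft * d2 := mul_pos hpos hd2pos
  linarith

end ScalarGraph

section PrincipalFrame

variable {n : ℕ}

lemma exists_perm_sort_roots (μ : Fin n → ℝ) :
    ∃ σ : Equiv.Perm (Fin n), ∀ i : Fin n,
      ((Matrix.diagonal μ).charpoly.roots.sort (· ≤ ·)).getD i 0 = μ (σ i) := by
  refine ⟨Tuple.sort μ, fun i => ?_⟩
  have hroots : (Matrix.diagonal μ).charpoly.roots = Multiset.map μ Finset.univ.val := by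
    rw [Matrix.charpoly_diagonal, Polynomial.roots_prod]
    · simp
    · simp [Finset.prod_ne_zero_iff, Polynomial.X_sub_C_ne_zero]
  have hl : (Matrix.diagonal μ).charpoly.roots.sort (· ≤ ·) = List.ofFn (μ ∘ Tuple.sort μ) := by
    refine List.Perm.eq_of_pairwise' (r := (· ≤ ·)) ?_ ?_ ?_
    · exact Multiset.pairwise_sort _ _
    · exact (List.sortedLE_ofFn_iff.2 (Tuple.monotone_sort μ)).pairwise
    · refine List.Perm.trans ?_ ((Tuple.sort μ).ofFn_comp_perm μ).symm
      rw [← Multiset.coe_eq_coe, Multiset.sort_eq, hroots, Fin.univ_val_map]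
  rw [hl]
  simp [List.getD_eq_getElem?_getD]

variable {M : Type*} [TopologicalSpace M] [ChartedSpace (EuclideanSpace ℝ (Fin n)) M]

/-- `b` is an orthonormal frame of principal directions of `X` at `x`, with principal
curvatures `μ`. -/
structure IsPrincipalFrame (X ν : M → EuclideanSpace ℝ (Fin (n + 1))) (x : M) (μ : Fin n → ℝ)
    (b : Fin n → EuclideanSpace ℝ (Fin n)) : Prop where
  metric : ∀ i j, inner ℝ (differential X x (b i)) (differential X x (b j)) =
    if i = j then (1 : ℝ) else 0
  curvature : ∀ i j, -inner ℝ (secondDerivative X x (b i) (b j)) (ν x) =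
    if i = j then μ i else 0

lemma euclidean_eq_sum_single (u : EuclideanSpace ℝ (Fin n)) :
    u = ∑ k, u k • EuclideanSpace.single k (1 : ℝ) := by
  ext j
  simp [Pi.single_apply]

lemma map_euclidean_eq_sum {V : Type*} [NormedAddCommGroup V] [NormedSpace ℝ V]
    (L : EuclideanSpace ℝ (Fin n) →L[ℝ] V) (u : EuclideanSpace ℝ (Fin n)) :
    L u = ∑ k, u k • L (EuclideanSpace.single k (1 : ℝ)) := by
  conv_lhs => rw [euclidean_eq_sum_single u]
  rw [map_sum]
  exact Finset.sum_congr rfl fun k _ => map_smul _ _ _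

lemma inner_differential_eq (X : M → EuclideanSpace ℝ (Fin (n + 1))) (x : M)
    (C : Matrix (Fin n) (Fin n) ℝ) (i j : Fin n) :
    inner ℝ (differential X x (WithLp.toLp 2 fun k => C k i))
      (differential X x (WithLp.toLp 2 fun k => C k j)) =
      (C.transpose * metricMatrix X x * C) i j := by
  rw [map_euclidean_eq_sum, map_euclidean_eq_sum (differential X x) (WithLp.toLp 2 fun k => C k j),
    mul_assoc]
  simp only [sum_inner, inner_sum, inner_smul_right, real_inner_smul_left, Matrix.mul_apply,
    Matrix.transpose_apply, metricMatrix, Matrix.of_apply, Finset.mul_sum]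
  rw [Finset.sum_comm]
  exact Finset.sum_congr rfl fun k _ => Finset.sum_congr rfl fun l _ => by ring

lemma inner_secondDerivative_eq (X ν : M → EuclideanSpace ℝ (Fin (n + 1))) (x : M)
    (C : Matrix (Fin n) (Fin n) ℝ) (i j : Fin n) :
    -inner ℝ (secondDerivative X x (WithLp.toLp 2 fun k => C k i)
      (WithLp.toLp 2 fun k => C k j)) (ν x) =
      (C.transpose * secondFundamentalMatrix X ν x * C) i j := by
  rw [map_euclidean_eq_sum (secondDerivative X x) (WithLp.toLp 2 fun k => C k i), sum_apply,
    mul_assoc]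
  simp only [smul_apply]
  simp_rw [fun k => map_euclidean_eq_sum (secondDerivative X x (EuclideanSpace.single k 1))
    (WithLp.toLp 2 fun k => C k j)]
  simp only [sum_inner, real_inner_smul_left, Matrix.mul_apply,
    Matrix.transpose_apply, secondFundamentalMatrix, Matrix.of_apply, Finset.mul_sum,
    ← Finset.sum_neg_distrib]
  exact Finset.sum_congr rfl fun k _ => Finset.sum_congr rfl fun l _ => by ring

lemma exists_orthonormalizing_matrix (X : M → EuclideanSpace ℝ (Fin (n + 1))) (x : M)
    (hinj : Function.Injective (differential X x)) :
    ∃ C : Matrix (Fin n) (Fin n) ℝ, C.transpose * metricMatrix X x * C = 1 := by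
  let R := LinearMap.range (differential X x).toLinearMap
  have hfin : Module.finrank ℝ R = n := by
    have := LinearMap.finrank_range_of_inj (f := (differential X x).toLinearMap) hinj
    simpa [R] using this
  let e := (stdOrthonormalBasis ℝ R).reindex (finCongr hfin)
  have hex : ∀ i, ∃ c, differential X x c = e i := fun i => (e i).2
  choose c hc using hex
  refine ⟨Matrix.of fun k i => c i k, ?_⟩
  ext i j
  rw [← inner_differential_eq]
  have h1 : ∀ i, (WithLp.toLp 2 fun k => (Matrix.of fun k i => c i k : Matrix _ _ ℝ) k i) = c i :=
    fun i => by ext k; rfl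
  rw [h1, h1, hc, hc, ← Submodule.coe_inner, e.inner_eq_ite, Matrix.one_apply]

theorem exists_isPrincipalFrame (X ν : M → EuclideanSpace ℝ (Fin (n + 1))) (x : M)
    (hinj : Function.Injective (differential X x))
    (hsymm : ∀ u v, secondDerivative X x u v = secondDerivative X x v u) :
    ∃ b, IsPrincipalFrame X ν x (principalCurvatures X ν x) b := by
  obtain ⟨C, hC⟩ := exists_orthonormalizing_matrix X x hinj
  set g := metricMatrix X x with hg
  set h := secondFundamentalMatrix X ν x with hh
  have hht : h.transpose = h := by
    ext i j
    simp [hh, secondFundamentalMatrix, hsymm (EuclideanSpace.single j 1)]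
  have hS : (C.transpose * h * C).IsHermitian := by
    rw [Matrix.IsHermitian, Matrix.conjTranspose_eq_transpose_of_trivial]
    simp [Matrix.transpose_mul, hht, mul_assoc]
  set U : Matrix (Fin n) (Fin n) ℝ := hS.eigenvectorUnitary.1 with hU
  set μ := hS.eigenvalues with hμ
  have hUU : U.transpose * U = 1 := by
    have := Unitary.coe_star_mul_self hS.eigenvectorUnitary
    rwa [Matrix.star_eq_conjTranspose, Matrix.conjTranspose_eq_transpose_of_trivial] at this
  have hdiag : U.transpose * (C.transpose * h * C) * U = Matrix.diagonal μ := by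
    have := hS.conjStarAlgAut_star_eigenvectorUnitary
    rw [Unitary.conjStarAlgAut_star_apply, Matrix.star_eq_conjTranspose,
      Matrix.conjTranspose_eq_transpose_of_trivial] at this
    exact this
  set B := C * U with hB
  have hBg : B.transpose * g * B = 1 := by
    calc B.transpose * g * B = U.transpose * (C.transpose * g * C) * U := by
          simp only [hB, Matrix.transpose_mul, mul_assoc]
      _ = 1 := by rw [hC, mul_one, hUU]
  have hBh : B.transpose * h * B = Matrix.diagonal μ := by
    rw [← hdiag]; simp only [hB, Matrix.transpose_mul, mul_assoc]
  have hinv : g⁻¹ = B * B.transpose := by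
    refine Matrix.inv_eq_left_inv ?_
    rw [mul_assoc]; exact mul_eq_one_comm.1 hBg
  have hchar : (weingartenMatrix X ν x).charpoly = (Matrix.diagonal μ).charpoly := by
    rw [weingartenMatrix, ← hg, ← hh, hinv, mul_assoc, Matrix.charpoly_mul_comm, hBh]
  obtain ⟨σ, hσ⟩ := exists_perm_sort_roots μ
  have hpc : ∀ i, principalCurvatures X ν x i = μ (σ i) := fun i => by
    rw [principalCurvatures, hchar, hσ]
  refine ⟨fun i => WithLp.toLp 2 fun k => B k (σ i), fun i j => ?_, fun i j => ?_⟩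
  · rw [inner_differential_eq, ← hg, hBg, Matrix.one_apply]
    simp
  · rw [inner_secondDerivative_eq, ← hh, hBh, Matrix.diagonal_apply, hpc]
    simp

lemma IsPrincipalFrame.neg {X ν : M → EuclideanSpace ℝ (Fin (n + 1))} {x : M} {μ : Fin n → ℝ}
    {b : Fin n → EuclideanSpace ℝ (Fin n)} (h : IsPrincipalFrame X ν x μ b) :
    IsPrincipalFrame X (fun y => -ν y) x (fun i => -μ i) b := by
  refine ⟨h.metric, fun i j => ?_⟩
  have := h.curvature i j
  rw [inner_neg_right, neg_neg]
  split_ifs at this ⊢ with hij <;> linarith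

end PrincipalFrame

section LocalCoordinates

/-- The model space `ℝⁿ`. -/
abbrev Model (n : ℕ) := EuclideanSpace ℝ (Fin n)

/-- The ambient space `ℝⁿ⁺¹`. -/
abbrev Ambient (n : ℕ) := EuclideanSpace ℝ (Fin (n + 1))

variable {n : ℕ} {M : Type*} [TopologicalSpace M] [ChartedSpace (Model n) M]

lemma differential_eq_fderiv {X : M → Ambient n} {x : M}
    (hX : MDifferentiableAt (𝓡 n) 𝓘(ℝ, Ambient n) X x) :
    differential X x =
      fderiv ℝ (X ∘ (extChartAt (𝓡 n) x).symm) (extChartAt (𝓡 n) x x) := by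
  have h : fderivWithin ℝ (writtenInExtChartAt (𝓡 n) 𝓘(ℝ, Ambient n) x X) (range (𝓡 n))
      (extChartAt (𝓡 n) x x) = fderiv ℝ (X ∘ (extChartAt (𝓡 n) x).symm) (extChartAt (𝓡 n) x x) := by
    rw [ModelWithCorners.Boundaryless.range_eq_univ, fderivWithin_univ]
    rfl
  exact hX.mfderiv.trans h

variable [IsManifold (𝓡 n) ∞ M]

lemma contDiffAt_comp_extChartAt_symm {X : M → Ambient n} {x₀ : M} {z : Model n}
    (hz : z ∈ (extChartAt (𝓡 n) x₀).target)
    (hX : ContMDiffAt (𝓡 n) 𝓘(ℝ, Ambient n) ∞ X ((extChartAt (𝓡 n) x₀).symm z)) :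
    ContDiffAt ℝ ∞ (X ∘ (extChartAt (𝓡 n) x₀).symm) z := by
  rw [← contMDiffAt_iff_contDiffAt]
  refine hX.comp z ?_
  exact (contMDiffOn_extChartAt_symm x₀).contMDiffAt
    ((isOpen_extChartAt_target x₀).mem_nhds hz)

lemma contDiffAt_coord_change {x₀ x : M} {z : Model n} (hz : z ∈ (extChartAt (𝓡 n) x₀).target)
    (hx : (extChartAt (𝓡 n) x₀).symm z = x) :
    ContDiffAt ℝ ∞ (extChartAt (𝓡 n) x ∘ (extChartAt (𝓡 n) x₀).symm) z := by
  rw [← contMDiffAt_iff_contDiffAt]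
  refine ContMDiffAt.comp z ?_ ((contMDiffOn_extChartAt_symm x₀).contMDiffAt
    ((isOpen_extChartAt_target x₀).mem_nhds hz))
  rw [hx]
  exact contMDiffAt_extChartAt

/-- The first and second derivatives of a local parametrization `Y` of `X`, in terms of the
preferred chart. -/
lemma exists_fderiv_eq_differential {X ν : M → Ambient n} {x : M}
    (hX : ContMDiffAt (𝓡 n) 𝓘(ℝ, Ambient n) ∞ X x)
    (hν : ∀ v, inner ℝ (differential X x v) (ν x) = 0) {ψ : Model n → Model n} {u : Model n}
    (hψ : ContDiffAt ℝ 2 ψ u) (hψu : ψ u = extChartAt (𝓡 n) x x) {Y : Model n → Ambient n}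
    (hY : Y =ᶠ[𝓝 u] X ∘ (extChartAt (𝓡 n) x).symm ∘ ψ) :
    ∃ J : Model n →L[ℝ] Model n, (∀ b, differential X x (J b) = fderiv ℝ Y u b) ∧
      ∀ b c, inner ℝ (secondDerivative X x (J b) (J c)) (ν x) =
        inner ℝ (fderiv ℝ (fderiv ℝ Y) u b c) (ν x) := by
  set G := X ∘ (extChartAt (𝓡 n) x).symm with hG
  have hGs : ContDiffAt ℝ ∞ G (ψ u) := by
    rw [hψu]
    refine contDiffAt_comp_extChartAt_symm (mem_extChartAt_target x) ?_
    rwa [extChartAt_to_inv]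
  have hdX : differential X x = fderiv ℝ G (ψ u) := by
    rw [hψu]
    exact differential_eq_fderiv (hX.mdifferentiableAt (by simp))
  have hYG : Y =ᶠ[𝓝 u] G ∘ ψ := hY
  have hψd : ∀ᶠ u' in 𝓝 u, DifferentiableAt ℝ ψ u' :=
    (hψ.eventually (by simp)).mono fun u' h => h.differentiableAt (by simp)
  have hGd : ∀ᶠ u' in 𝓝 u, DifferentiableAt ℝ G (ψ u') :=
    (hψ.continuousAt.eventually (eventually_contDiffAt_two hGs)).mono
      fun u' h => h.differentiableAt (by simp)
  have hfd : fderiv ℝ Y =ᶠ[𝓝 u] fun u' => (fderiv ℝ G (ψ u')).comp (fderiv ℝ ψ u') := by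
    filter_upwards [hψd, hGd, hYG.fderiv (𝕜 := ℝ)] with u' h1 h2 h3
    rw [h3]
    exact fderiv_comp u' h2 h1
  refine ⟨fderiv ℝ ψ u, fun b => ?_, fun b c => ?_⟩
  · rw [hdX, hfd.self_of_nhds]; rfl
  · have h1 : HasFDerivAt (fun u' => fderiv ℝ G (ψ u'))
        ((fderiv ℝ (fderiv ℝ G) (ψ u)).comp (fderiv ℝ ψ u)) u := by
      have h2 : DifferentiableAt ℝ (fderiv ℝ G) (ψ u) :=
        (hGs.fderiv_right (m := ∞) (by simp)).differentiableAt (by simp)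
      exact h2.hasFDerivAt.comp u hψd.self_of_nhds.hasFDerivAt
    have h2 : HasFDerivAt (fderiv ℝ ψ) (fderiv ℝ (fderiv ℝ ψ) u) u :=
      ((hψ.fderiv_right (m := 1) (by norm_num)).differentiableAt (by simp)).hasFDerivAt
    have h3 := h1.clm_comp h2
    rw [hfd.fderiv_eq, h3.fderiv]
    have h4 : inner ℝ (fderiv ℝ G (ψ u) (fderiv ℝ (fderiv ℝ ψ) u b c)) (ν x) = 0 := by
      rw [← hdX]; exact hν _
    simp only [add_apply, ContinuousLinearMap.comp_apply,
      ContinuousLinearMap.compL_apply, ContinuousLinearMap.flip_apply, inner_add_left, h4, zero_add]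
    rw [secondDerivative, hψu]

lemma secondDerivative_symm {X : M → Ambient n} {x : M}
    (hX : ContMDiffAt (𝓡 n) 𝓘(ℝ, Ambient n) ∞ X x) (u v : Model n) :
    secondDerivative X x u v = secondDerivative X x v u := by
  have hGs : ContDiffAt ℝ ∞ (X ∘ (extChartAt (𝓡 n) x).symm) (extChartAt (𝓡 n) x x) := by
    refine contDiffAt_comp_extChartAt_symm (mem_extChartAt_target x) ?_
    rwa [extChartAt_to_inv]
  exact (hGs.isSymmSndFDerivAt (by simpa using ENat.LEInfty.out)).eq u v

/-- Expansion of a vector in an orthonormal frame of a hyperplane and its unit normal. -/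
lemma eq_sum_frame_add_normal {e : Fin n → Ambient n} {ν₀ : Ambient n}
    (he : ∀ i j, inner ℝ (e i) (e j) = if i = j then (1 : ℝ) else 0)
    (hν : inner ℝ ν₀ ν₀ = (1 : ℝ)) (heν : ∀ i, inner ℝ (e i) ν₀ = (0 : ℝ)) (v : Ambient n) :
    v = ∑ i, inner ℝ v (e i) • e i + inner ℝ v ν₀ • ν₀ := by
  have hon : Orthonormal ℝ (Fin.cons ν₀ e : Fin (n + 1) → Ambient n) := by
    rw [orthonormal_iff_ite]
    intro i j
    refine Fin.cases ?_ (fun i => ?_) i <;> refine Fin.cases ?_ (fun j => ?_) j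
    · simp only [Fin.cons_zero, hν, if_true]
    · simp only [Fin.cons_zero, Fin.cons_succ, real_inner_comm (e j) ν₀ ▸ heν j]
      rw [if_neg (Fin.succ_ne_zero j).symm]
    · simp only [Fin.cons_zero, Fin.cons_succ, heν i]
      rw [if_neg (Fin.succ_ne_zero i)]
    · simp [he]
  have hsp := (basisOfOrthonormalOfCardEqFinrank hon (by simp)).span_eq
  rw [coe_basisOfOrthonormalOfCardEqFinrank] at hsp
  let B := OrthonormalBasis.mk hon hsp.ge
  have := B.sum_repr' v
  rw [Fin.sum_univ_succ] at this
  simp only [B, OrthonormalBasis.coe_mk, Fin.cons_zero, Fin.cons_succ] at this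
  rw [add_comm] at this
  conv_lhs => rw [← this]
  simp only [real_inner_comm]

end LocalCoordinates

section Flow

variable {n : ℕ} {M : Type*} [TopologicalSpace M] [ChartedSpace (Model n) M]

/-- A smooth family of embedded hypersurfaces moving with normal velocity `-F ν`, where `F` is a
concave speed function of the principal curvatures and `σ F > 0` for a sign `σ`. The normal `ν`
points out of the open set `Ω t`. -/
structure IsConcaveFlow (Γ : Set (Fin n → ℝ)) (f : (Fin n → ℝ) → ℝ) (T : ℝ)
    (Ω : ℝ → Set (Ambient n)) (X ν : ℝ → M → Ambient n) (F : ℝ → M → ℝ) (σ : ℝ) : Prop where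
  speed : IsConcaveSpeed Γ f
  smooth : ContMDiffOn ((𝓡 n).prod 𝓘(ℝ, ℝ)) 𝓘(ℝ, Ambient n) ∞
    (fun p : M × ℝ => X p.2 p.1) (univ ×ˢ Ico 0 T)
  injective : ∀ t ∈ Ico 0 T, Function.Injective (X t)
  immersion : ∀ t ∈ Ico 0 T, ∀ x, Function.Injective (differential (X t) x)
  norm_eq_one : ∀ t ∈ Ico 0 T, ∀ x, ‖ν t x‖ = 1
  orthogonal : ∀ t ∈ Ico 0 T, ∀ x v, inner ℝ (differential (X t) x v) (ν t x) = 0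
  flow : ∀ t ∈ Ico 0 T, ∀ x, HasDerivWithinAt (fun s => X s x) (-(F t x • ν t x)) (Ico 0 T) t
  frame : ∀ t ∈ Ico 0 T, ∀ x, ∃ μ ∈ Γ, F t x = f μ ∧ ∃ b, IsPrincipalFrame (X t) (ν t) x μ b
  sign : σ * σ = 1
  pos : ∀ t ∈ Ico 0 T, ∀ x, 0 < σ * F t x
  isOpen : ∀ t ∈ Ico 0 T, IsOpen (Ω t)
  frontier_subset : ∀ t ∈ Ico 0 T, frontier (Ω t) ⊆ range (X t)
  inward : ∀ t ∈ Ico 0 T, ∀ x, ∀ᶠ s : ℝ in 𝓝[>] 0, X t x - s • ν t x ∈ Ω t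
  outward : ∀ t ∈ Ico 0 T, ∀ x, ∀ᶠ s : ℝ in 𝓝[>] 0, X t x + s • ν t x ∉ Ω t

/-- The family `X` in the preferred chart at `x₀`. -/
def chartFlow (X : ℝ → M → Ambient n) (x₀ : M) (p : Model n × ℝ) : Ambient n :=
  X p.2 ((extChartAt (𝓡 n) x₀).symm p.1)

/-- The area factor `√(1 + |Dφ|²)` of the graph of `φ`. -/
def graphSlope (φ : Model n × ℝ → ℝ) (z : Model n × ℝ) : ℝ := √(1 + ∑ i, spaceGrad φ z i ^ 2)

lemma graphSlope_pos (φ : Model n × ℝ → ℝ) (z : Model n × ℝ) : 0 < graphSlope φ z := by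
  have : 0 ≤ ∑ i, spaceGrad φ z i ^ 2 := Finset.sum_nonneg fun i _ => sq_nonneg _
  exact Real.sqrt_pos.2 (by linarith)

lemma graphSlope_sq (φ : Model n × ℝ → ℝ) (z : Model n × ℝ) :
    graphSlope φ z ^ 2 = 1 + ∑ i, spaceGrad φ z i ^ 2 := by
  have : 0 ≤ ∑ i, spaceGrad φ z i ^ 2 := Finset.sum_nonneg fun i _ => sq_nonneg _
  exact Real.sq_sqrt (by linarith)

/-- At `z`, the moving hypersurface is parametrized by `α` as the graph of `-φ` in the frame
`e, ν₀`; the normal, the speed and the second fundamental form are those of the graph. -/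
structure IsGraphAt (X ν : ℝ → M → Ambient n) (F : ℝ → M → ℝ) (X₀ : Ambient n)
    (e : Fin n → Ambient n) (ν₀ : Ambient n) (φ : Model n × ℝ → ℝ) (α : Model n × ℝ → M)
    (z : Model n × ℝ) : Prop where
  point : X z.2 (α z) = graphPoint X₀ e ν₀ φ z
  normal : graphNormal e ν₀ φ z = graphSlope φ z • ν z.2 (α z)
  time : dirDeriv timeDir φ z = graphSlope φ z * F z.2 (α z)
  chart : ∃ J : Model n →L[ℝ] Model n,
    (∀ b, differential (X z.2) (α z) (J b) = ∑ i, b i • e i - fderiv ℝ φ z (b, 0) • ν₀) ∧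
    ∀ b c, -inner ℝ (secondDerivative (X z.2) (α z) (J b) (J c)) (ν z.2 (α z)) * graphSlope φ z =
      fderiv ℝ (fderiv ℝ φ) z (b, 0) (c, 0)

variable {Γ : Set (Fin n → ℝ)} {f : (Fin n → ℝ) → ℝ} {T : ℝ} {Ω : ℝ → Set (Ambient n)}
  {X ν : ℝ → M → Ambient n} {F : ℝ → M → ℝ} {σ : ℝ}

lemma contMDiffAt_slice
    (hX : ContMDiffOn ((𝓡 n).prod 𝓘(ℝ, ℝ)) 𝓘(ℝ, Ambient n) ∞
      (fun p : M × ℝ => X p.2 p.1) (univ ×ˢ Ico 0 T)) {t : ℝ}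
    (ht : t ∈ Ico 0 T) (x : M) : ContMDiffAt (𝓡 n) 𝓘(ℝ, Ambient n) ∞ (X t) x := by
  have h1 : ContMDiff (𝓡 n) ((𝓡 n).prod 𝓘(ℝ, ℝ)) ∞ (fun y : M => (y, t)) :=
    contMDiff_id.prodMk contMDiff_const
  have h2 := hX.comp (s := univ) h1.contMDiffOn (fun y _ => ⟨mem_univ _, ht⟩)
  exact (contMDiffOn_univ.1 h2) x

variable [IsManifold (𝓡 n) ∞ M]

lemma contDiffOn_chartFlow
    (hX : ContMDiffOn ((𝓡 n).prod 𝓘(ℝ, ℝ)) 𝓘(ℝ, Ambient n) ∞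
      (fun p : M × ℝ => X p.2 p.1) (univ ×ˢ Ico 0 T)) (x₀ : M) :
    ContDiffOn ℝ ∞ (chartFlow X x₀) ((extChartAt (𝓡 n) x₀).target ×ˢ Ico 0 T) := by
  rw [← contMDiffOn_iff_contDiffOn]
  have h1 : ContMDiffOn 𝓘(ℝ, Model n × ℝ) (𝓡 n) ∞
      (fun p : Model n × ℝ => (extChartAt (𝓡 n) x₀).symm p.1)
      ((extChartAt (𝓡 n) x₀).target ×ˢ Ico 0 T) :=
    (contMDiffOn_extChartAt_symm x₀).comp contDiff_fst.contMDiff.contMDiffOn fun p hp => hp.1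
  have h2 : ContMDiffOn 𝓘(ℝ, Model n × ℝ) 𝓘(ℝ, ℝ) ∞ (fun p : Model n × ℝ => p.2)
      ((extChartAt (𝓡 n) x₀).target ×ˢ Ico 0 T) := contDiff_snd.contMDiff.contMDiffOn
  exact hX.comp (h1.prodMk h2) fun p hp => ⟨mem_univ _, hp.2⟩

lemma contDiffAt_chartFlow
    (hX : ContMDiffOn ((𝓡 n).prod 𝓘(ℝ, ℝ)) 𝓘(ℝ, Ambient n) ∞
      (fun p : M × ℝ => X p.2 p.1) (univ ×ˢ Ico 0 T)) (x₀ : M) {p : Model n × ℝ}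
    (hp : p ∈ (extChartAt (𝓡 n) x₀).target ×ˢ Ioo 0 T) :
    ContDiffAt ℝ ∞ (chartFlow X x₀) p := by
  refine (contDiffOn_chartFlow hX x₀).contDiffAt ?_
  exact mem_of_superset (((isOpen_extChartAt_target x₀).prod isOpen_Ioo).mem_nhds hp)
    (prod_mono subset_rfl Ioo_subset_Ico_self)

lemma IsConcaveFlow.fderiv_chartFlow_time (h : IsConcaveFlow Γ f T Ω X ν F σ) (x₀ : M)
    {p : Model n × ℝ} (hp : p ∈ (extChartAt (𝓡 n) x₀).target ×ˢ Ioo 0 T) :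
    fderiv ℝ (chartFlow X x₀) p (0, 1) =
      -(F p.2 ((extChartAt (𝓡 n) x₀).symm p.1) • ν p.2 ((extChartAt (𝓡 n) x₀).symm p.1)) := by
  have h1 : HasFDerivAt (chartFlow X x₀) (fderiv ℝ (chartFlow X x₀) p) (p.1, p.2) :=
    ((contDiffAt_chartFlow h.smooth x₀ hp).differentiableAt (by simp)).hasFDerivAt
  have h2 : HasDerivAt (fun s : ℝ => (p.1, s)) ((0 : Model n), (1 : ℝ)) p.2 :=
    (hasDerivAt_const p.2 p.1).prodMk (hasDerivAt_id p.2)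
  have h3 := h1.comp_hasDerivAt p.2 h2
  have h4 := (h.flow p.2 (Ioo_subset_Ico_self hp.2)
    ((extChartAt (𝓡 n) x₀).symm p.1)).hasDerivAt (Ico_mem_nhds hp.2.1 hp.2.2)
  exact h3.unique h4

lemma fderiv_chartFlow_space
    (hX : ContMDiffOn ((𝓡 n).prod 𝓘(ℝ, ℝ)) 𝓘(ℝ, Ambient n) ∞
      (fun p : M × ℝ => X p.2 p.1) (univ ×ˢ Ico 0 T)) (x₀ : M) {p : Model n × ℝ}
    (hp : p ∈ (extChartAt (𝓡 n) x₀).target ×ˢ Ioo 0 T) (v : Model n) :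
    fderiv ℝ (chartFlow X x₀) p (v, 0) =
      fderiv ℝ (X p.2 ∘ (extChartAt (𝓡 n) x₀).symm) p.1 v := by
  have h1 : HasFDerivAt (chartFlow X x₀) (fderiv ℝ (chartFlow X x₀) p) (p.1, p.2) :=
    ((contDiffAt_chartFlow hX x₀ hp).differentiableAt (by simp)).hasFDerivAt
  have h2 : HasFDerivAt (fun z : Model n => (z, p.2)) (ContinuousLinearMap.inl ℝ (Model n) ℝ) p.1 :=
    hasFDerivAt_prodMk_left p.1 p.2
  have h3 := h1.comp p.1 h2
  have h4 : fderiv ℝ (X p.2 ∘ (extChartAt (𝓡 n) x₀).symm) p.1 =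
      (fderiv ℝ (chartFlow X x₀) p).comp (ContinuousLinearMap.inl ℝ (Model n) ℝ) := h3.fderiv
  rw [h4]
  rfl

lemma IsConcaveFlow.inner_fderiv_chart (h : IsConcaveFlow Γ f T Ω X ν F σ) (x₀ : M) {t : ℝ}
    (ht : t ∈ Ico 0 T) {z : Model n} (hz : z ∈ (extChartAt (𝓡 n) x₀).target) (v : Model n) :
    inner ℝ (fderiv ℝ (X t ∘ (extChartAt (𝓡 n) x₀).symm) z v)
      (ν t ((extChartAt (𝓡 n) x₀).symm z)) = 0 := by
  set x := (extChartAt (𝓡 n) x₀).symm z with hx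
  have hψ := contDiffAt_coord_change hz hx.symm
  have hcont : ContinuousAt (extChartAt (𝓡 n) x₀).symm z :=
    continuousAt_extChartAt_symm'' hz
  obtain ⟨J, hJ, -⟩ := exists_fderiv_eq_differential (contMDiffAt_slice h.smooth ht x)
    (h.orthogonal t ht x) (hψ.of_le ENat.LEInfty.out) (by rw [Function.comp_apply, ← hx])
    (Y := X t ∘ (extChartAt (𝓡 n) x₀).symm) (by
      have h1 : ∀ᶠ y in 𝓝 x, (extChartAt (𝓡 n) x).symm (extChartAt (𝓡 n) x y) = y := by
        filter_upwards [extChartAt_source_mem_nhds (I := 𝓡 n) x] with y hy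
        exact (extChartAt (𝓡 n) x).left_inv hy
      filter_upwards [hcont.eventually h1] with z' hz'
      simp only [Function.comp_apply, hz'])
  rw [← hJ]
  exact h.orthogonal t ht x _

end Flow

section LocalGraph

variable {n : ℕ} {M : Type*} [TopologicalSpace M] [ChartedSpace (Model n) M]
variable {Γ : Set (Fin n → ℝ)} {f : (Fin n → ℝ) → ℝ} {T : ℝ} {Ω : ℝ → Set (Ambient n)}
  {X ν : ℝ → M → Ambient n} {F : ℝ → M → ℝ} {σ : ℝ}

lemma hasFDerivAt_graphPoint (X₀ : Ambient n) (e : Fin n → Ambient n) (ν₀ : Ambient n)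
    {φ : Model n × ℝ → ℝ} {z : Model n × ℝ} (hφ : DifferentiableAt ℝ φ z) :
    HasFDerivAt (graphPoint X₀ e ν₀ φ)
      (∑ i, ((EuclideanSpace.proj i).comp (ContinuousLinearMap.fst ℝ (Model n) ℝ)).smulRight (e i) -
        (fderiv ℝ φ z).smulRight ν₀) z := by
  have h1 : HasFDerivAt (fun z : Model n × ℝ => ∑ i, z.1 i • e i)
      (∑ i, ((EuclideanSpace.proj i).comp
        (ContinuousLinearMap.fst ℝ (Model n) ℝ)).smulRight (e i)) z := by
    refine HasFDerivAt.fun_sum fun i _ => ?_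
    exact ((EuclideanSpace.proj i : Model n →L[ℝ] ℝ).comp
      (ContinuousLinearMap.fst ℝ (Model n) ℝ)).hasFDerivAt.smul_const (e i)
  exact (h1.const_add X₀).sub (hφ.hasFDerivAt.smul_const ν₀)

lemma fderiv_graphPoint_apply (X₀ : Ambient n) (e : Fin n → Ambient n) (ν₀ : Ambient n)
    {φ : Model n × ℝ → ℝ} {z : Model n × ℝ} (hφ : DifferentiableAt ℝ φ z) (w : Model n × ℝ) :
    fderiv ℝ (graphPoint X₀ e ν₀ φ) z w = ∑ i, w.1 i • e i - fderiv ℝ φ z w • ν₀ := by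
  rw [(hasFDerivAt_graphPoint X₀ e ν₀ hφ).fderiv]
  simp [sum_apply]

lemma fderiv_graphPoint_slice (X₀ : Ambient n) (e : Fin n → Ambient n) (ν₀ : Ambient n)
    {φ : Model n × ℝ → ℝ} {u : Model n} {t : ℝ} (hφ : DifferentiableAt ℝ φ (u, t)) (b : Model n) :
    fderiv ℝ (fun u => graphPoint X₀ e ν₀ φ (u, t)) u b =
      ∑ i, b i • e i - fderiv ℝ φ (u, t) (b, 0) • ν₀ := by
  have h1 := (hasFDerivAt_graphPoint X₀ e ν₀ hφ).differentiableAt.hasFDerivAt.comp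
    (f := fun u : Model n => (u, t)) u (hasFDerivAt_prodMk_left u t)
  have h2 := h1.fderiv
  have h3 : fderiv ℝ (fun u => graphPoint X₀ e ν₀ φ (u, t)) u b =
      fderiv ℝ (graphPoint X₀ e ν₀ φ) (u, t) (b, 0) := by
    rw [show (fun u => graphPoint X₀ e ν₀ φ (u, t)) = graphPoint X₀ e ν₀ φ ∘ fun u => (u, t) from
      rfl, h2]
    rfl
  rw [h3, fderiv_graphPoint_apply X₀ e ν₀ hφ]

lemma fderiv_fderiv_graphPoint_slice (X₀ : Ambient n) (e : Fin n → Ambient n) (ν₀ : Ambient n)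
    {φ : Model n × ℝ → ℝ} {u : Model n} {t : ℝ} (hφ : ContDiffAt ℝ 2 φ (u, t)) (b c : Model n) :
    fderiv ℝ (fderiv ℝ (fun u => graphPoint X₀ e ν₀ φ (u, t))) u b c =
      -(fderiv ℝ (fderiv ℝ φ) (u, t) (b, 0) (c, 0) • ν₀) := by
  have hline : Tendsto (fun u' : Model n => (u', t)) (𝓝 u) (𝓝 (u, t)) :=
    (hasFDerivAt_prodMk_left (𝕜 := ℝ) u t).continuousAt
  have hev : ∀ᶠ u' in 𝓝 u, DifferentiableAt ℝ φ (u', t) :=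
    hline.eventually ((hφ.eventually (by simp)).mono fun z hz => hz.differentiableAt (by simp))
  set A : Model n →L[ℝ] Ambient n := ∑ i, (EuclideanSpace.proj i : Model n →L[ℝ] ℝ).smulRight (e i)
    with hA
  set R : ((Model n × ℝ) →L[ℝ] ℝ) →L[ℝ] (Model n →L[ℝ] Ambient n) :=
    ((ContinuousLinearMap.smulRightL ℝ (Model n) (Ambient n)).flip ν₀).comp
      ((ContinuousLinearMap.compL ℝ (Model n) (Model n × ℝ) ℝ).flip
        (ContinuousLinearMap.inl ℝ (Model n) ℝ)) with hR
  have h1 : fderiv ℝ (fun u => graphPoint X₀ e ν₀ φ (u, t)) =ᶠ[𝓝 u]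
      fun u' => A - R (fderiv ℝ φ (u', t)) := by
    filter_upwards [hev] with u' hu'
    ext1 c
    rw [fderiv_graphPoint_slice X₀ e ν₀ hu']
    simp [hA, hR, sum_apply]
  have h2 : HasFDerivAt (fun u' => A - R (fderiv ℝ φ (u', t)))
      (-(R.comp ((fderiv ℝ (fderiv ℝ φ) (u, t)).comp (ContinuousLinearMap.inl ℝ (Model n) ℝ)))) u := by
    have h3 : DifferentiableAt ℝ (fderiv ℝ φ) (u, t) :=
      (hφ.fderiv_right (m := 1) (by norm_num)).differentiableAt (by simp)
    have h4 := R.hasFDerivAt.comp u (h3.hasFDerivAt.comp u (hasFDerivAt_prodMk_left u t))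
    exact h4.const_sub A
  rw [h1.fderiv_eq, h2.fderiv]
  simp [hR]

variable [IsManifold (𝓡 n) ∞ M]

/-- A local inverse of the projection of the moving hypersurface to the tangent hyperplane turns it
into a moving graph. -/
lemma IsConcaveFlow.isGraphAt (h : IsConcaveFlow Γ f T Ω X ν F σ) (x₀ : M) {X₀ ν₀ : Ambient n}
    {e : Fin n → Ambient n} (he : ∀ i j, inner ℝ (e i) (e j) = if i = j then (1 : ℝ) else 0)
    (hν : inner ℝ ν₀ ν₀ = (1 : ℝ)) (heν : ∀ i, inner ℝ (e i) ν₀ = (0 : ℝ))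
    {ξ : Model n × ℝ → Model n × ℝ} {φ : Model n × ℝ → ℝ} {z : Model n × ℝ}
    (hφ : φ = fun z => -inner ℝ (chartFlow X x₀ (ξ z) - X₀) ν₀)
    (hξ : ∀ᶠ z' in 𝓝 z, (ξ z').2 = z'.2 ∧ ∀ i, inner ℝ (e i) (chartFlow X x₀ (ξ z') - X₀) = z'.1 i)
    (hmem : ξ z ∈ (extChartAt (𝓡 n) x₀).target ×ˢ Ioo 0 T) (hsmooth : ContDiffAt ℝ 2 ξ z)
    (hsign : 0 < σ * dirDeriv timeDir φ z) :
    IsGraphAt X ν F X₀ e ν₀ φ (fun z => (extChartAt (𝓡 n) x₀).symm (ξ z).1) z := by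
  obtain ⟨u, t⟩ := z
  have hξ2 : (ξ (u, t)).2 = t := hξ.self_of_nhds.1
  have ht : t ∈ Ioo 0 T := hξ2 ▸ hmem.2
  have ht' : t ∈ Ico 0 T := Ioo_subset_Ico_self ht
  set c := extChartAt (𝓡 n) x₀ with hc
  set x := c.symm (ξ (u, t)).1 with hx
  have hXc : ContDiffAt ℝ ∞ (chartFlow X x₀) (ξ (u, t)) := contDiffAt_chartFlow h.smooth x₀ hmem
  have hXh : ContDiffAt ℝ 2 (fun z => chartFlow X x₀ (ξ z)) (u, t) :=
    (hXc.of_le ENat.LEInfty.out).comp (u, t) hsmooth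
  have hφs : ContDiffAt ℝ 2 φ (u, t) := by
    rw [hφ]
    exact ((hXh.sub contDiffAt_const).inner ℝ contDiffAt_const).neg
  have hφd : DifferentiableAt ℝ φ (u, t) := hφs.differentiableAt (by simp)
  have hgraph : (fun z => chartFlow X x₀ (ξ z)) =ᶠ[𝓝 (u, t)] graphPoint X₀ e ν₀ φ := by
    filter_upwards [hξ] with z' hz'
    have h1 := eq_sum_frame_add_normal he hν heν (chartFlow X x₀ (ξ z') - X₀)
    have h2 : ∀ i, inner ℝ (chartFlow X x₀ (ξ z') - X₀) (e i) = z'.1 i := fun i => by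
      rw [real_inner_comm]; exact hz'.2 i
    simp only [h2] at h1
    rw [graphPoint, hφ, neg_smul, sub_neg_eq_add, add_assoc, ← h1]
    abel
  have hline : Tendsto (fun u' : Model n => (u', t)) (𝓝 u) (𝓝 (u, t)) :=
    (hasFDerivAt_prodMk_left (𝕜 := ℝ) u t).continuousAt
  have hcoord : ContDiffAt ℝ 2 (fun u' => extChartAt (𝓡 n) x (c.symm (ξ (u', t)).1)) u := by
    have h1 : ContDiffAt ℝ 2 (fun u' : Model n => (ξ (u', t)).1) u :=
      contDiffAt_fst.comp u (hsmooth.comp u (contDiffAt_id.prodMk contDiffAt_const))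
    have h2 : ContDiffAt ℝ 2 (extChartAt (𝓡 n) x ∘ c.symm) (ξ (u, t)).1 :=
      (contDiffAt_coord_change hmem.1 hx.symm).of_le ENat.LEInfty.out
    exact ContDiffAt.comp (f := fun u' : Model n => (ξ (u', t)).1) u h2 h1
  have hY : (fun u => graphPoint X₀ e ν₀ φ (u, t)) =ᶠ[𝓝 u] X t ∘ (extChartAt (𝓡 n) x).symm ∘
      fun u' => extChartAt (𝓡 n) x (c.symm (ξ (u', t)).1) := by
    have h1 : ∀ᶠ y in 𝓝 x, (extChartAt (𝓡 n) x).symm (extChartAt (𝓡 n) x y) = y := by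
      filter_upwards [extChartAt_source_mem_nhds (I := 𝓡 n) x] with y hy
      exact (extChartAt (𝓡 n) x).left_inv hy
    have h2 : ContinuousAt (fun u' : Model n => c.symm (ξ (u', t)).1) u := by
      have h3 : ContinuousAt c.symm (ξ (u, t)).1 := continuousAt_extChartAt_symm'' hmem.1
      have h4 : ContinuousAt (fun u' : Model n => (ξ (u', t)).1) u :=
        (continuous_fst.tendsto _).comp (hsmooth.continuousAt.tendsto.comp hline)
      exact h3.comp (f := fun u' : Model n => (ξ (u', t)).1) h4
    filter_upwards [hline.eventually hgraph, hline.eventually hξ, h2.eventually h1] with u' g1 g2 g3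
    rw [← g1]
    simp only [Function.comp_apply, g3, chartFlow, g2.1]
    rfl
  obtain ⟨J, hJ1, hJ2⟩ := exists_fderiv_eq_differential (contMDiffAt_slice h.smooth ht' x)
    (h.orthogonal t ht' x) hcoord rfl hY
  set q : ℝ := inner ℝ ν₀ (ν t x) with hq
  have heq : ∀ i, inner ℝ (e i) (ν t x) = spaceGrad φ (u, t) i * q := by
    intro i
    have h1 := h.orthogonal t ht' x (J (EuclideanSpace.single i 1))
    rw [hJ1, fderiv_graphPoint_slice X₀ e ν₀ hφd, inner_sub_left, real_inner_smul_left] at h1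
    have h2 : ∑ k, (EuclideanSpace.single i (1 : ℝ) : Model n) k • e k = e i := by simp
    rw [h2] at h1
    have h3 : spaceGrad φ (u, t) i = fderiv ℝ φ (u, t) (EuclideanSpace.single i 1, 0) := rfl
    rw [h3]
    linarith
  have hνN : ν t x = q • graphNormal e ν₀ φ (u, t) := by
    conv_lhs => rw [eq_sum_frame_add_normal he hν heν (ν t x)]
    simp only [graphNormal, smul_add, Finset.smul_sum, smul_smul]
    rw [add_comm]
    congr 1
    · rw [real_inner_comm]
    · refine Finset.sum_congr rfl fun i _ => ?_
      rw [real_inner_comm, heq, mul_comm]; rfl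
  have hq2 : q ^ 2 * graphSlope φ (u, t) ^ 2 = 1 := by
    have h1 : inner ℝ (ν t x) (ν t x) = (1 : ℝ) := by
      rw [real_inner_self_eq_norm_sq, h.norm_eq_one t ht' x]; norm_num
    have h2 : inner ℝ (ν t x) (graphNormal e ν₀ φ (u, t)) =
        q * graphSlope φ (u, t) ^ 2 := by
      rw [graphSlope_sq, graphNormal, inner_add_right, inner_sum, real_inner_comm ν₀, ← hq, mul_add,
        mul_one, Finset.mul_sum]
      congr 1
      refine Finset.sum_congr rfl fun i _ => ?_
      rw [inner_smul_right, real_inner_comm, heq]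
      simp only [spaceGrad]
      ring
    nth_rewrite 2 [hνN] at h1
    rw [inner_smul_right, h2] at h1
    linarith
  have htime : dirDeriv timeDir φ (u, t) * q = F t x := by
    have h1 : HasFDerivAt (fun z => chartFlow X x₀ (ξ z))
        ((fderiv ℝ (chartFlow X x₀) (ξ (u, t))).comp (fderiv ℝ ξ (u, t))) (u, t) :=
      (hXc.differentiableAt (by simp)).hasFDerivAt.comp (u, t)
        (hsmooth.differentiableAt (by simp)).hasFDerivAt
    have h2 := hgraph.fderiv_eq (𝕜 := ℝ)
    rw [h1.fderiv] at h2
    have h3 := congrArg (fun L => L (timeDir : Model n × ℝ)) h2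
    simp only [ContinuousLinearMap.comp_apply] at h3
    rw [fderiv_graphPoint_apply X₀ e ν₀ hφd] at h3
    have h4 : (fderiv ℝ ξ (u, t) timeDir).2 = 1 := by
      have h5 : (fun z => (ξ z).2) =ᶠ[𝓝 (u, t)] fun z => z.2 := hξ.mono fun z hz => hz.1
      have h6 := h5.fderiv_eq (𝕜 := ℝ)
      have h7 : HasFDerivAt (fun z => (ξ z).2)
          ((ContinuousLinearMap.snd ℝ (Model n) ℝ).comp (fderiv ℝ ξ (u, t))) (u, t) :=
        (hsmooth.differentiableAt (by simp)).hasFDerivAt.snd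
      rw [h7.fderiv, fderiv_snd] at h6
      have h8 := congrArg (fun L => L (timeDir : Model n × ℝ)) h6
      simpa [timeDir] using h8
    have h5 : fderiv ℝ ξ (u, t) timeDir =
        ((fderiv ℝ ξ (u, t) timeDir).1, 0) + ((0 : Model n), (1 : ℝ)) := by
      rw [Prod.mk_add_mk, add_zero, zero_add, ← h4]
    rw [h5, map_add, h.fderiv_chartFlow_time x₀ hmem, fderiv_chartFlow_space h.smooth x₀ hmem, hξ2,
      ← hc, ← hx] at h3
    have h6 := congrArg (fun w => inner ℝ w (ν t x)) h3
    have h7 := h.inner_fderiv_chart x₀ ht' hmem.1 (fderiv ℝ ξ (u, t) timeDir).1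
    rw [← hc, ← hx] at h7
    have h8 : inner ℝ (ν t x) (ν t x) = (1 : ℝ) := by
      rw [real_inner_self_eq_norm_sq, h.norm_eq_one t ht' x]; norm_num
    have h9 : ∑ i, (timeDir : Model n × ℝ).1 i • e i = 0 := by simp [timeDir]
    simp only [inner_add_left, h7, inner_neg_left, real_inner_smul_left, h8, h9, zero_sub] at h6
    rw [← hq] at h6
    simp only [dirDeriv]
    linarith
  have hqpos : 0 < q := by
    have h1 := h.pos t ht' x
    rw [← htime, ← mul_assoc] at h1
    exact (pos_iff_pos_of_mul_pos h1).1 hsign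
  have hw := graphSlope_pos φ (u, t)
  have hqw : q * graphSlope φ (u, t) = 1 := by
    have h1 : (q * graphSlope φ (u, t)) ^ 2 = 1 := by rw [mul_pow]; exact hq2
    nlinarith [mul_pos hqpos hw]
  refine ⟨?_, ?_, ?_, J, fun b => ?_, fun b c => ?_⟩
  · rw [← hgraph.self_of_nhds]
    simp only [chartFlow, hξ2]
    rfl
  · show graphNormal e ν₀ φ (u, t) = graphSlope φ (u, t) • ν t x
    rw [hνN, smul_smul, mul_comm, hqw, one_smul]
  · show _ = graphSlope φ (u, t) * F t x
    rw [← htime]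
    linear_combination -dirDeriv timeDir φ (u, t) * hqw
  · exact (hJ1 b).trans (fderiv_graphPoint_slice X₀ e ν₀ hφd b)
  · show -inner ℝ (secondDerivative (X t) x (J b) (J c)) (ν t x) * graphSlope φ (u, t) = _
    rw [hJ2, fderiv_fderiv_graphPoint_slice X₀ e ν₀ hφs, inner_neg_left, real_inner_smul_left, ← hq]
    linear_combination fderiv ℝ (fderiv ℝ φ) (u, t) (b, 0) (c, 0) * hqw

end LocalGraph

section GraphConsequences

variable {n : ℕ} {M : Type*} [TopologicalSpace M] [ChartedSpace (Model n) M]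
variable {Γ : Set (Fin n → ℝ)} {f : (Fin n → ℝ) → ℝ} {T : ℝ} {Ω : ℝ → Set (Ambient n)}
  {X ν : ℝ → M → Ambient n} {F : ℝ → M → ℝ} {σ : ℝ}

lemma inner_graphTangent {e : Fin n → Ambient n} {ν₀ : Ambient n}
    (he : ∀ i j, inner ℝ (e i) (e j) = if i = j then (1 : ℝ) else 0)
    (hν : inner ℝ ν₀ ν₀ = (1 : ℝ)) (heν : ∀ i, inner ℝ (e i) ν₀ = (0 : ℝ)) (b c : Model n)
    (r s : ℝ) :
    inner ℝ (∑ i, b i • e i - r • ν₀) (∑ i, c i • e i - s • ν₀) = ∑ i, b i * c i + r * s := by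
  have heν' : ∀ i, inner ℝ ν₀ (e i) = (0 : ℝ) := fun i => by rw [real_inner_comm]; exact heν i
  simp only [inner_sub_left, inner_sub_right, sum_inner, inner_sum, real_inner_smul_left,
    inner_smul_right, he, hν, heν, heν', mul_ite, mul_one, mul_zero, Finset.sum_ite_eq',
    Finset.mem_univ, if_true, Finset.sum_const_zero, sub_zero, zero_sub]
  rw [Finset.sum_congr rfl fun i _ => mul_comm (c i) (b i)]
  ring

lemma fderiv_space_eq_sum (φ : Model n × ℝ → ℝ) (z : Model n × ℝ) (b : Model n) :
    fderiv ℝ φ z (b, 0) = ∑ i, b i * spaceGrad φ z i := by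
  have := map_euclidean_eq_sum ((fderiv ℝ φ z).comp (ContinuousLinearMap.inl ℝ (Model n) ℝ)) b
  simpa [spaceGrad, dirDeriv, spaceDir] using this

lemma fderiv_fderiv_space_eq_sum {φ : Model n × ℝ → ℝ} {z : Model n × ℝ}
    (hφ : ContDiffAt ℝ 2 φ z) (b c : Model n) :
    fderiv ℝ (fderiv ℝ φ) z (b, 0) (c, 0) = ∑ i, ∑ j, b i * spaceHess φ z i j * c j := by
  have h1 := map_euclidean_eq_sum
    ((fderiv ℝ (fderiv ℝ φ) z).comp (ContinuousLinearMap.inl ℝ (Model n) ℝ)) b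
  have h2 := congrArg (fun L => L ((c, 0) : Model n × ℝ)) h1
  simp only [ContinuousLinearMap.comp_apply, ContinuousLinearMap.inl_apply, sum_apply,
    smul_apply, smul_eq_mul] at h2
  rw [h2]
  refine Finset.sum_congr rfl fun i _ => ?_
  have h3 := map_euclidean_eq_sum ((fderiv ℝ (fderiv ℝ φ) z (EuclideanSpace.single i 1, 0)).comp
    (ContinuousLinearMap.inl ℝ (Model n) ℝ)) c
  simp only [ContinuousLinearMap.comp_apply, ContinuousLinearMap.inl_apply, smul_eq_mul] at h3
  rw [h3, Finset.mul_sum]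
  refine Finset.sum_congr rfl fun j _ => ?_
  have h4 : spaceHess φ z i j = fderiv ℝ (fderiv ℝ φ) z (EuclideanSpace.single i 1, 0)
      (EuclideanSpace.single j 1, 0) := dirDeriv_dirDeriv_eq hφ _ _
  rw [h4]
  ring

/-- The chart change of a graph is bijective, so that principal frames can be pulled back. -/
lemma injective_of_differential_eq_graph {Y : M → Ambient n} {x : M} {e : Fin n → Ambient n}
    {ν₀ : Ambient n} (he : ∀ i j, inner ℝ (e i) (e j) = if i = j then (1 : ℝ) else 0)
    (hν : inner ℝ ν₀ ν₀ = (1 : ℝ)) (heν : ∀ i, inner ℝ (e i) ν₀ = (0 : ℝ)) {J : Model n →L[ℝ] Model n}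
    {ℓ : Model n → ℝ} (hJ : ∀ b, differential Y x (J b) = ∑ i, b i • e i - ℓ b • ν₀) :
    Function.Injective J := by
  refine (injective_iff_map_eq_zero J).2 fun b hb => ?_
  have h1 := hJ b
  rw [hb, map_zero] at h1
  have h2 := inner_graphTangent he hν heν b b (ℓ b) (ℓ b)
  rw [← h1, inner_zero_left] at h2
  have h3 : 0 ≤ ∑ i, b i * b i := Finset.sum_nonneg fun i _ => mul_self_nonneg _
  have h4 : ∑ i, b i * b i = 0 := by nlinarith [mul_self_nonneg (ℓ b)]
  rw [Finset.sum_eq_zero_iff_of_nonneg fun i _ => mul_self_nonneg _] at h4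
  ext i
  simpa using h4 i (Finset.mem_univ i)

lemma IsGraphAt.dirDeriv_time_le {X₀ ν₀ : Ambient n} {e : Fin n → Ambient n}
    {φ : Model n × ℝ → ℝ} {α : Model n × ℝ → M} {z : Model n × ℝ}
    (hG : IsGraphAt X ν F X₀ e ν₀ φ α z) (h : IsConcaveFlow Γ f T Ω X ν F σ)
    (he : ∀ i j, inner ℝ (e i) (e j) = if i = j then (1 : ℝ) else 0)
    (hν : inner ℝ ν₀ ν₀ = (1 : ℝ)) (heν : ∀ i, inner ℝ (e i) ν₀ = (0 : ℝ))
    (hz : z.2 ∈ Ico 0 T) (hφ : ContDiffAt ℝ 2 φ z) {κ p : Fin n → ℝ} (hp : IsSupport Γ f κ p) :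
    dirDeriv timeDir φ z ≤ tiltedTrace p φ z := by
  obtain ⟨J, hJ1, hJ2⟩ := hG.chart
  have hinj := injective_of_differential_eq_graph he hν heν hJ1
  have hsurj : Function.Surjective J := LinearMap.injective_iff_surjective (f := J.toLinearMap).1 hinj
  obtain ⟨μ, hμ, hFμ, b, hb⟩ := h.frame z.2 hz (α z)
  choose β hβ using fun i => hsurj (b i)
  rw [hG.time, hFμ, tiltedTrace]
  have hw := graphSlope_pos φ z
  refine hp.mul_le_sum_tilt h.speed hμ (B := Matrix.of fun k i => β i k) hw.le ?_ ?_
  · ext i j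
    have h1 := hb.metric i j
    rw [← hβ, ← hβ, hJ1, hJ1, inner_graphTangent he hν heν, fderiv_space_eq_sum,
      fderiv_space_eq_sum] at h1
    rw [Matrix.one_apply, ← h1, mul_add, add_mul, mul_one, Matrix.add_apply, Matrix.mul_vecMulVec,
      Matrix.vecMulVec_mul, Matrix.vecMulVec_apply, Matrix.mul_apply]
    congr 1
    congr 1
    simp only [Matrix.vecMul, dotProduct, Matrix.of_apply]
    exact Finset.sum_congr rfl fun k _ => mul_comm _ _
  · ext i j
    have h1 := hb.curvature i j
    have h2 := hJ2 (β i) (β j)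
    rw [hβ, hβ, h1, fderiv_fderiv_space_eq_sum hφ] at h2
    have h3 : (graphSlope φ z • Matrix.diagonal μ) i j = (if i = j then μ i else 0) * graphSlope φ z := by
      rw [Matrix.smul_apply, Matrix.diagonal_apply, smul_eq_mul, mul_comm]
    rw [h3, h2, mul_assoc, Matrix.mul_apply]
    refine Finset.sum_congr rfl fun k _ => ?_
    rw [Matrix.mul_apply, Finset.mul_sum]
    exact Finset.sum_congr rfl fun l _ => by simp [mul_assoc]

lemma IsGraphAt.grad_eq_zero {X₀ ν₀ : Ambient n} {e : Fin n → Ambient n}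
    {φ : Model n × ℝ → ℝ} {α : Model n × ℝ → M} {z : Model n × ℝ}
    (hG : IsGraphAt X ν F X₀ e ν₀ φ α z)
    (he : ∀ i j, inner ℝ (e i) (e j) = if i = j then (1 : ℝ) else 0)
    (heν : ∀ i, inner ℝ (e i) ν₀ = (0 : ℝ)) (hz : ν z.2 (α z) = ν₀) (i : Fin n) :
    dirDeriv (spaceDir i) φ z = 0 := by
  have h1 := congrArg (fun w => inner ℝ (e i) w) hG.normal
  simp only [hz, graphNormal, inner_add_right, inner_sum, inner_smul_right, heν, he, mul_ite,
    mul_one, mul_zero, Finset.sum_ite_eq, Finset.mem_univ, if_true, zero_add] at h1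
  exact h1

lemma graphSlope_eq_one {φ : Model n × ℝ → ℝ} {z : Model n × ℝ}
    (h : ∀ i, dirDeriv (spaceDir i) φ z = 0) : graphSlope φ z = 1 := by
  simp [graphSlope, spaceGrad, h]

lemma IsGraphAt.spaceHess_eq {X₀ ν₀ : Ambient n} {e : Fin n → Ambient n}
    {φ : Model n × ℝ → ℝ} {α : Model n × ℝ → M} {z : Model n × ℝ}
    (hG : IsGraphAt X ν F X₀ e ν₀ φ α z)
    (hgrad : ∀ i, dirDeriv (spaceDir i) φ z = 0) (hφ : ContDiffAt ℝ 2 φ z)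
    (hinj : Function.Injective (differential (X z.2) (α z))) {μ : Fin n → ℝ}
    {b : Fin n → Model n} (hb : IsPrincipalFrame (X z.2) (ν z.2) (α z) μ b)
    (heb : ∀ i, e i = differential (X z.2) (α z) (b i)) :
    spaceHess φ z = Matrix.diagonal μ := by
  obtain ⟨J, hJ1, hJ2⟩ := hG.chart
  have hJb : ∀ i, J (EuclideanSpace.single i 1) = b i := fun i => by
    refine hinj ?_
    rw [hJ1, ← heb i]
    have h1 : fderiv ℝ φ z (EuclideanSpace.single i 1, 0) = 0 := hgrad i
    rw [h1]
    simp
  ext i j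
  have h1 := hJ2 (EuclideanSpace.single i 1) (EuclideanSpace.single j 1)
  rw [hJb, hJb, hb.curvature i j, graphSlope_eq_one hgrad, mul_one] at h1
  rw [Matrix.diagonal_apply, h1]
  exact dirDeriv_dirDeriv_eq hφ _ _

variable [IsManifold (𝓡 n) ∞ M]

/-- The projection of the moving hypersurface to a tangent hyperplane has a smooth local inverse. -/
lemma IsConcaveFlow.exists_localInverse (h : IsConcaveFlow Γ f T Ω X ν F σ) {t₀ : ℝ}
    (ht₀ : t₀ ∈ Ioo 0 T) (x₀ : M) {e : Fin n → Ambient n}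
    (he : ∀ i j, inner ℝ (e i) (e j) = if i = j then (1 : ℝ) else 0)
    (heν : ∀ i, inner ℝ (e i) (ν t₀ x₀) = (0 : ℝ)) :
    ∃ ξ : Model n × ℝ → Model n × ℝ, ContDiffAt ℝ ∞ ξ (0, t₀) ∧
      ξ (0, t₀) = (extChartAt (𝓡 n) x₀ x₀, t₀) ∧
      ∀ᶠ z in 𝓝 (0, t₀), (ξ z).2 = z.2 ∧
        ∀ i, inner ℝ (e i) (chartFlow X x₀ (ξ z) - X t₀ x₀) = z.1 i := by
  have ht' : t₀ ∈ Ico 0 T := Ioo_subset_Ico_self ht₀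
  set X₀ := X t₀ x₀ with hX₀
  set ν₀ := ν t₀ x₀ with hν₀
  have hν : inner ℝ ν₀ ν₀ = (1 : ℝ) := by
    rw [real_inner_self_eq_norm_sq, h.norm_eq_one t₀ ht' x₀]; norm_num
  set p₀ : Model n × ℝ := (extChartAt (𝓡 n) x₀ x₀, t₀) with hp₀
  have hp₀mem : p₀ ∈ (extChartAt (𝓡 n) x₀).target ×ˢ Ioo 0 T := ⟨mem_extChartAt_target x₀, ht₀⟩
  have hcx : (extChartAt (𝓡 n) x₀).symm p₀.1 = x₀ := extChartAt_to_inv x₀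
  have hXc : ContDiffAt ℝ ∞ (chartFlow X x₀) p₀ := contDiffAt_chartFlow h.smooth x₀ hp₀mem
  have hXc0 : chartFlow X x₀ p₀ = X₀ := by simp only [chartFlow]; rw [hcx]
  let Λ : Ambient n →L[ℝ] Model n :=
    (EuclideanSpace.equiv (Fin n) ℝ).symm.toContinuousLinearMap.comp
      (ContinuousLinearMap.pi fun i => innerSL ℝ (e i))
  have hΛ : ∀ w i, Λ w i = inner ℝ (e i) w := fun w i => rfl
  let Θ : Model n × ℝ → Model n × ℝ := fun p => (Λ (chartFlow X x₀ p - X₀), p.2)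
  have hΘ : ContDiffAt ℝ ∞ Θ p₀ :=
    (Λ.contDiff.contDiffAt.comp p₀ (hXc.sub contDiffAt_const)).prodMk contDiffAt_snd
  set D := fderiv ℝ (chartFlow X x₀) p₀ with hD
  let Θ' : Model n × ℝ →L[ℝ] Model n × ℝ :=
    (Λ.comp D).prod (ContinuousLinearMap.snd ℝ (Model n) ℝ)
  have hΘ' : HasFDerivAt Θ Θ' p₀ := by
    have h1 : HasFDerivAt (fun p => chartFlow X x₀ p - X₀) D p₀ :=
      ((hXc.differentiableAt (by simp)).hasFDerivAt).sub_const X₀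
    exact (Λ.hasFDerivAt.comp p₀ h1).prodMk hasFDerivAt_snd
  have hspace : ∀ v, D (v, 0) = differential (X t₀) x₀ v := fun v => by
    rw [hD, fderiv_chartFlow_space h.smooth x₀ hp₀mem, differential_eq_fderiv
      ((contMDiffAt_slice h.smooth ht' x₀).mdifferentiableAt (by simp))]
  have hinj : Function.Injective Θ' := by
    refine (injective_iff_map_eq_zero Θ').2 fun w hw => ?_
    obtain ⟨v, τ⟩ := w
    have h1 : Λ (D (v, τ)) = 0 := congrArg Prod.fst hw
    have h2 : τ = 0 := congrArg Prod.snd hw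
    subst h2
    have h3 : D (v, 0) = 0 := by
      rw [eq_sum_frame_add_normal he hν heν (D (v, 0))]
      have h4 : ∀ i, inner ℝ (D (v, 0)) (e i) = (0 : ℝ) := fun i => by
        rw [real_inner_comm, ← hΛ, h1]; rfl
      have h5 : inner ℝ (D (v, 0)) ν₀ = (0 : ℝ) := by
        rw [hspace]; exact h.orthogonal t₀ ht' x₀ v
      simp [h4, h5]
    rw [hspace] at h3
    have h4 : v = 0 := h.immersion t₀ ht' x₀ (by rw [h3, map_zero])
    rw [h4]; rfl
  let L : (Model n × ℝ) ≃L[ℝ] (Model n × ℝ) :=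
    (LinearEquiv.ofInjectiveEndo Θ'.toLinearMap hinj).toContinuousLinearEquiv
  have hL : (L : Model n × ℝ →L[ℝ] Model n × ℝ) = Θ' := by ext1 <;> rfl
  have hΘL : HasFDerivAt Θ (L : Model n × ℝ →L[ℝ] Model n × ℝ) p₀ := hL ▸ hΘ'
  have hΘ0 : Θ p₀ = (0, t₀) := by
    show (Λ (chartFlow X x₀ p₀ - X₀), t₀) = _
    rw [hXc0, sub_self, map_zero]
  refine ⟨hΘ.localInverse hΘL (by simp), ?_, ?_, ?_⟩
  · rw [← hΘ0]; exact hΘ.to_localInverse hΘL (by simp)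
  · rw [← hΘ0]; exact hΘ.localInverse_apply_image hΘL (by simp)
  · have hright : ∀ᶠ z in 𝓝 ((0 : Model n), t₀), Θ (hΘ.localInverse hΘL (by simp) z) = z := by
      rw [← hΘ0]; exact (hΘ.hasStrictFDerivAt' hΘL (by simp)).eventually_right_inverse
    filter_upwards [hright] with z hz
    refine ⟨?_, fun i => ?_⟩
    · have h1 := congrArg Prod.snd hz
      exact h1
    · have h1 := congrArg (fun w : Model n × ℝ => w.1 i) hz
      exact h1

lemma IsConcaveFlow.dirDeriv_time_height (h : IsConcaveFlow Γ f T Ω X ν F σ) {t₀ : ℝ}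
    (ht₀ : t₀ ∈ Ioo 0 T) (x₀ : M) {ξ : Model n × ℝ → Model n × ℝ}
    (hξs : DifferentiableAt ℝ ξ (0, t₀)) (hξ0 : ξ (0, t₀) = (extChartAt (𝓡 n) x₀ x₀, t₀))
    (hξ2 : ∀ᶠ z in 𝓝 (0, t₀), (ξ z).2 = z.2) :
    dirDeriv timeDir (fun z => -inner ℝ (chartFlow X x₀ (ξ z) - X t₀ x₀) (ν t₀ x₀)) (0, t₀) =
      F t₀ x₀ := by
  have ht' : t₀ ∈ Ico 0 T := Ioo_subset_Ico_self ht₀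
  set X₀ := X t₀ x₀ with hX₀
  set ν₀ := ν t₀ x₀ with hν₀
  have hν : inner ℝ ν₀ ν₀ = (1 : ℝ) := by
    rw [real_inner_self_eq_norm_sq, h.norm_eq_one t₀ ht' x₀]; norm_num
  set p₀ : Model n × ℝ := (extChartAt (𝓡 n) x₀ x₀, t₀) with hp₀
  have hp₀mem : p₀ ∈ (extChartAt (𝓡 n) x₀).target ×ˢ Ioo 0 T := ⟨mem_extChartAt_target x₀, ht₀⟩
  have hcx : (extChartAt (𝓡 n) x₀).symm p₀.1 = x₀ := extChartAt_to_inv x₀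
  have hXc : DifferentiableAt ℝ (chartFlow X x₀) p₀ :=
    (contDiffAt_chartFlow h.smooth x₀ hp₀mem).differentiableAt (by simp)
  set D := fderiv ℝ (chartFlow X x₀) p₀ with hD
  have hspace : ∀ v, D (v, 0) = differential (X t₀) x₀ v := fun v => by
    rw [hD, fderiv_chartFlow_space h.smooth x₀ hp₀mem, differential_eq_fderiv
      ((contMDiffAt_slice h.smooth ht' x₀).mdifferentiableAt (by simp))]
  have h1 : HasFDerivAt (fun z => -inner ℝ (chartFlow X x₀ (ξ z) - X₀) ν₀)
      (-((innerSL ℝ ν₀).comp (D.comp (fderiv ℝ ξ (0, t₀))))) (0, t₀) := by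
    have h2 : HasFDerivAt (fun z => chartFlow X x₀ (ξ z)) (D.comp (fderiv ℝ ξ (0, t₀)))
        (0, t₀) := by
      refine HasFDerivAt.comp (g := chartFlow X x₀) (0, t₀) ?_ hξs.hasFDerivAt
      rw [hξ0]; exact hXc.hasFDerivAt
    have h3 := ((innerSL ℝ ν₀).hasFDerivAt.comp (0, t₀) (h2.sub_const X₀)).neg
    refine h3.congr_of_eventuallyEq (Eventually.of_forall fun z => ?_)
    show _ = -inner ℝ ν₀ (chartFlow X x₀ (ξ z) - X₀)
    rw [real_inner_comm]
  have h4 : (fderiv ℝ ξ (0, t₀) timeDir).2 = 1 := by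
    have h5 : (fun z => (ξ z).2) =ᶠ[𝓝 (0, t₀)] fun z => z.2 := hξ2
    have h6 := h5.fderiv_eq (𝕜 := ℝ)
    rw [hξs.hasFDerivAt.snd.fderiv, fderiv_snd] at h6
    have h8 := congrArg (fun L => L (timeDir : Model n × ℝ)) h6
    simpa [timeDir] using h8
  have h5 : fderiv ℝ ξ (0, t₀) timeDir =
      ((fderiv ℝ ξ (0, t₀) timeDir).1, 0) + ((0 : Model n), (1 : ℝ)) := by
    rw [Prod.mk_add_mk, add_zero, zero_add, ← h4]
  have h6 : D (0, 1) = -(F t₀ x₀ • ν₀) := by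
    rw [hD, h.fderiv_chartFlow_time x₀ hp₀mem, hcx]
  have h7 : inner ℝ ν₀ (D ((fderiv ℝ ξ (0, t₀) timeDir).1, 0)) = (0 : ℝ) := by
    rw [hspace, real_inner_comm]; exact h.orthogonal t₀ ht' x₀ _
  have h8 : dirDeriv timeDir (fun z => -inner ℝ (chartFlow X x₀ (ξ z) - X₀) ν₀) (0, t₀) =
      -inner ℝ ν₀ (D (fderiv ℝ ξ (0, t₀) timeDir)) := by
    rw [dirDeriv, h1.fderiv]; rfl
  rw [h8, h5, map_add, inner_add_right, h7, h6, inner_neg_right, inner_smul_right, hν]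
  ring

/-- Near an interior time, the moving hypersurface is a moving graph over any given orthonormal
frame of a tangent hyperplane. -/
theorem IsConcaveFlow.exists_isGraphAt (h : IsConcaveFlow Γ f T Ω X ν F σ) {t₀ : ℝ}
    (ht₀ : t₀ ∈ Ioo 0 T) (x₀ : M) {e : Fin n → Ambient n}
    (he : ∀ i j, inner ℝ (e i) (e j) = if i = j then (1 : ℝ) else 0)
    (heν : ∀ i, inner ℝ (e i) (ν t₀ x₀) = (0 : ℝ)) :
    ∃ (φ : Model n × ℝ → ℝ) (α : Model n × ℝ → M), ContDiffAt ℝ ∞ φ (0, t₀) ∧ φ (0, t₀) = 0 ∧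
      α (0, t₀) = x₀ ∧ ∀ᶠ z in 𝓝 (0, t₀), z.2 ∈ Ioo 0 T ∧
        IsGraphAt X ν F (X t₀ x₀) e (ν t₀ x₀) φ α z := by
  have ht' : t₀ ∈ Ico 0 T := Ioo_subset_Ico_self ht₀
  have hν : inner ℝ (ν t₀ x₀) (ν t₀ x₀) = (1 : ℝ) := by
    rw [real_inner_self_eq_norm_sq, h.norm_eq_one t₀ ht' x₀]; norm_num
  obtain ⟨ξ, hξs, hξ0, hξ2⟩ := h.exists_localInverse ht₀ x₀ he heν
  have hp₀mem : (extChartAt (𝓡 n) x₀ x₀, t₀) ∈ (extChartAt (𝓡 n) x₀).target ×ˢ Ioo 0 T :=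
    ⟨mem_extChartAt_target x₀, ht₀⟩
  have hXcξ : ContDiffAt ℝ ∞ (fun z => chartFlow X x₀ (ξ z)) (0, t₀) := by
    refine ContDiffAt.comp (g := chartFlow X x₀) (0, t₀) ?_ hξs
    rw [hξ0]; exact contDiffAt_chartFlow h.smooth x₀ hp₀mem
  set φ : Model n × ℝ → ℝ := fun z => -inner ℝ (chartFlow X x₀ (ξ z) - X t₀ x₀) (ν t₀ x₀) with hφdef
  have hφ : ContDiffAt ℝ ∞ φ (0, t₀) :=
    ((hXcξ.sub contDiffAt_const).inner ℝ contDiffAt_const).neg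
  have hφt : dirDeriv timeDir φ (0, t₀) = F t₀ x₀ :=
    h.dirDeriv_time_height ht₀ x₀ (hξs.differentiableAt (by simp)) hξ0 (hξ2.mono fun z hz => hz.1)
  have hsign : ∀ᶠ z in 𝓝 ((0 : Model n), t₀), 0 < σ * dirDeriv timeDir φ z := by
    have h1 : ContinuousAt (fun z => σ * dirDeriv timeDir φ z) (0, t₀) :=
      continuousAt_const.mul (ContDiffAt.dirDeriv hφ timeDir).continuousAt
    refine h1.eventually (lt_mem_nhds ?_)
    show 0 < σ * dirDeriv timeDir φ (0, t₀)
    rw [hφt]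
    exact h.pos t₀ ht' x₀
  have hmem : ∀ᶠ z in 𝓝 ((0 : Model n), t₀), ξ z ∈ (extChartAt (𝓡 n) x₀).target ×ˢ Ioo 0 T := by
    refine hξs.continuousAt.eventually_mem ?_
    rw [hξ0]
    exact ((isOpen_extChartAt_target x₀).prod isOpen_Ioo).mem_nhds hp₀mem
  refine ⟨φ, fun z => (extChartAt (𝓡 n) x₀).symm (ξ z).1, hφ, ?_, ?_, ?_⟩
  · simp only [hφdef]
    rw [hξ0, chartFlow, extChartAt_to_inv, sub_self, inner_zero_left, neg_zero]
  · show (extChartAt (𝓡 n) x₀).symm (ξ (0, t₀)).1 = x₀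
    rw [hξ0]; exact extChartAt_to_inv x₀
  · filter_upwards [hsign, hmem, hξ2.eventually_nhds, eventually_contDiffAt_two hξs]
      with z h1 h2 h3 h4
    exact ⟨h3.self_of_nhds.1 ▸ h2.2, h.isGraphAt x₀ he hν heν hφdef h3 h2 h4 h1⟩

end GraphConsequences

section Touching

variable {n : ℕ} {M : Type*}

/-- The signed gap between `X(y)` and the sphere of curvature `k` touching at `X(x)`, normalized so
that it is nonnegative if and only if `Z(x, y) ≤ k`. -/
def sphereGap (X ν : M → Ambient n) (k : ℝ) (x y : M) : ℝ :=
  k / 2 * inner ℝ (X x - X y) (X x - X y) - inner ℝ (X x - X y) (ν x)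

lemma subset_of_disjoint_frontier {V : Type*} [TopologicalSpace V] {B Ω : Set V}
    (hB : IsPreconnected B) (hfr : ∀ Y ∈ B, Y ∉ frontier Ω) (hne : (B ∩ Ω).Nonempty) : B ⊆ Ω := by
  intro Y hY
  by_contra hYΩ
  have hcover : B ⊆ interior Ω ∪ (closure Ω)ᶜ := fun Z hZ => by
    by_contra hcon
    simp only [mem_union, mem_compl_iff, not_or, not_not] at hcon
    exact hfr Z hZ ⟨hcon.2, hcon.1⟩
  obtain ⟨Z, hZB, hZΩ⟩ := hne
  have hZ : Z ∈ interior Ω := by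
    by_contra hcon
    exact hfr Z hZB ⟨subset_closure hZΩ, hcon⟩
  have hY' : Y ∈ (closure Ω)ᶜ := fun hcon =>
    hfr Y hY ⟨hcon, fun h => hYΩ (interior_subset h)⟩
  obtain ⟨W, -, hW1, hW2⟩ := hB _ _ isOpen_interior isClosed_closure.isOpen_compl hcover
    ⟨Z, hZB, hZ⟩ ⟨Y, hY, hY'⟩
  exact hW2 (subset_closure (interior_subset hW1))

lemma isPreconnected_compl_closedBall (hn : 1 ≤ n) (c : Ambient n) (R : ℝ) (hR : 0 ≤ R) :
    IsPreconnected {Y : Ambient n | R < ‖Y - c‖} := by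
  have hrank : 1 < Module.rank ℝ (Ambient n) := by
    rw [← Module.finrank_eq_rank, finrank_euclideanSpace_fin]
    exact_mod_cast Nat.lt_succ_of_le hn
  have h1 : IsPreconnected (Metric.sphere (0 : Ambient n) 1 ×ˢ Ioi R) :=
    (isPreconnected_sphere hrank 0 1).prod isPreconnected_Ioi
  have h2 := h1.image (fun p : Ambient n × ℝ => c + p.2 • p.1) (by fun_prop)
  convert h2 using 1
  ext Y
  simp only [mem_ofPred_eq, mem_image, mem_prod, mem_sphere_zero_iff_norm, mem_Ioi, Prod.exists]
  constructor
  · intro hY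
    have hpos : 0 < ‖Y - c‖ := hR.trans_lt hY
    refine ⟨‖Y - c‖⁻¹ • (Y - c), ‖Y - c‖, ⟨?_, hY⟩, ?_⟩
    · rw [norm_smul, norm_inv, norm_norm, inv_mul_cancel₀ hpos.ne']
    · rw [smul_smul, mul_inv_cancel₀ hpos.ne', one_smul]; abel
  · rintro ⟨v, r, ⟨hv, hr⟩, rfl⟩
    have : 0 < r := hR.trans_lt hr
    rw [add_sub_cancel_left, norm_smul, hv, mul_one, Real.norm_of_nonneg this.le]
    exact hr

lemma isPreconnected_touching_side (hn : 1 ≤ n) (X₀ ν₀ : Ambient n) (hν : inner ℝ ν₀ ν₀ = (1 : ℝ))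
    (K : ℝ) : IsPreconnected {Y : Ambient n |
      K / 2 * inner ℝ (X₀ - Y) (X₀ - Y) - inner ℝ (X₀ - Y) ν₀ < 0} := by
  have hsq : ∀ Y : Ambient n, K ≠ 0 →
      K / 2 * inner ℝ (X₀ - Y) (X₀ - Y) - inner ℝ (X₀ - Y) ν₀ =
        K / 2 * (‖Y - (X₀ - K⁻¹ • ν₀)‖ ^ 2 - K⁻¹ ^ 2) := by
    intro Y hK
    have h1 : Y - (X₀ - K⁻¹ • ν₀) = K⁻¹ • ν₀ - (X₀ - Y) := by abel
    rw [h1, ← real_inner_self_eq_norm_sq]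
    generalize X₀ - Y = D
    rw [inner_sub_left, inner_sub_right, inner_sub_right, real_inner_smul_left,
      real_inner_smul_left, inner_smul_right, inner_smul_right, hν, real_inner_comm D ν₀]
    field_simp
    ring
  rcases lt_trichotomy K 0 with hK | hK | hK
  · convert isPreconnected_compl_closedBall hn (X₀ - K⁻¹ • ν₀) (-K⁻¹) (by
      have := inv_neg''.2 hK; linarith) using 1
    ext Y
    have hKi : K⁻¹ < 0 := inv_neg''.2 hK
    rw [mem_ofPred_eq, mem_ofPred_eq, hsq Y hK.ne]
    have hnn := norm_nonneg (Y - (X₀ - K⁻¹ • ν₀))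
    constructor
    · intro h1
      by_contra! h2
      have : ‖Y - (X₀ - K⁻¹ • ν₀)‖ ^ 2 ≤ K⁻¹ ^ 2 := by nlinarith
      nlinarith
    · intro h1
      have : K⁻¹ ^ 2 < ‖Y - (X₀ - K⁻¹ • ν₀)‖ ^ 2 := by nlinarith
      nlinarith
  · subst hK
    have h1 : {Y : Ambient n | (0 : ℝ) / 2 * inner ℝ (X₀ - Y) (X₀ - Y) - inner ℝ (X₀ - Y) ν₀ < 0} =
        {Y : Ambient n | innerSL ℝ ν₀ Y < inner ℝ ν₀ X₀} := by
      ext Y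
      simp only [mem_ofPred_eq, zero_div, zero_mul, zero_sub, inner_sub_left, innerSL_apply_apply]
      rw [real_inner_comm X₀ ν₀, real_inner_comm Y ν₀]
      constructor <;> intro h <;> linarith
    rw [h1]
    exact (convex_halfSpace_lt (innerSL ℝ ν₀).isBoundedLinearMap.toIsLinearMap _).isPreconnected
  · convert (convex_ball (X₀ - K⁻¹ • ν₀) K⁻¹).isPreconnected using 1
    ext Y
    have hKi : 0 < K⁻¹ := inv_pos.2 hK
    rw [mem_ofPred_eq, Metric.mem_ball, dist_eq_norm, hsq Y hK.ne']
    have hnn := norm_nonneg (Y - (X₀ - K⁻¹ • ν₀))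
    constructor
    · intro h1
      by_contra! h2
      have : K⁻¹ ^ 2 ≤ ‖Y - (X₀ - K⁻¹ • ν₀)‖ ^ 2 := by nlinarith
      nlinarith
    · intro h1
      have : ‖Y - (X₀ - K⁻¹ • ν₀)‖ ^ 2 < K⁻¹ ^ 2 := by nlinarith
      nlinarith

/-- If a sphere touching at `X x` from inside touches again at `X y`, then the normals at the two
points are related by reflection. -/
lemma normal_eq_of_touching (hn : 1 ≤ n) {Ω : Set (Ambient n)} {X ν : M → Ambient n}
    (hfr : frontier Ω ⊆ range X) {x y : M} {K : ℝ}
    (hνx : inner ℝ (ν x) (ν x) = (1 : ℝ))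
    (hin : ∀ᶠ s : ℝ in 𝓝[>] 0, X x - s • ν x ∈ Ω)
    (hout : ∀ᶠ s : ℝ in 𝓝[>] 0, X y + s • ν y ∉ Ω)
    (hgap : ∀ y', 0 ≤ sphereGap X ν K x y') (htouch : sphereGap X ν K x y = 0)
    (hpar : ν x - K • (X x - X y) = ν y ∨ ν x - K • (X x - X y) = -ν y) :
    ν x - K • (X x - X y) = ν y := by
  refine hpar.resolve_right fun hneg => ?_
  set B := {Y : Ambient n | K / 2 * inner ℝ (X x - Y) (X x - Y) - inner ℝ (X x - Y) (ν x) < 0}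
    with hB
  have hBpre : IsPreconnected B := isPreconnected_touching_side hn (X x) (ν x) hνx K
  have hBfr : ∀ Y ∈ B, Y ∉ frontier Ω := by
    intro Y hY hYf
    obtain ⟨y', rfl⟩ := hfr hYf
    exact absurd (hgap y') (not_le.2 hY)
  have hsmall : ∀ᶠ s : ℝ in 𝓝[>] 0, K / 2 * s ^ 2 - s < 0 := by
    have h1 : ContinuousAt (fun s : ℝ => K / 2 * s) 0 := by fun_prop
    have h2 : ∀ᶠ s : ℝ in 𝓝 0, K / 2 * s < 1 := h1.eventually (gt_mem_nhds (by simp))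
    filter_upwards [nhdsWithin_le_nhds h2, self_mem_nhdsWithin] with s h3 h4
    have h5 : 0 < s := h4
    nlinarith
  have hinB : ∀ᶠ s : ℝ in 𝓝[>] 0, X x - s • ν x ∈ B := by
    filter_upwards [hsmall] with s hs
    rw [hB, mem_ofPred_eq, sub_sub_cancel, real_inner_smul_left, real_inner_smul_left,
      inner_smul_right, hνx]
    linarith
  have houtB : ∀ᶠ s : ℝ in 𝓝[>] 0, X y + s • ν y ∈ B := by
    filter_upwards [hsmall] with s hs
    have h1 : ν y = K • (X x - X y) - ν x := by rw [← neg_sub, hneg, neg_neg]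
    have h2 : X x - (X y + s • ν y) = (1 - s * K) • (X x - X y) + s • ν x := by
      rw [h1, smul_sub, smul_smul, sub_smul, one_smul]; abel
    rw [hB, mem_ofPred_eq, h2]
    have h3 : K / 2 * inner ℝ (X x - X y) (X x - X y) = inner ℝ (X x - X y) (ν x) := by
      have := htouch; rw [sphereGap] at this; linarith
    set D := X x - X y
    have h4 : inner ℝ (ν x) D = inner ℝ D (ν x) := real_inner_comm _ _
    simp only [inner_add_left, inner_add_right, real_inner_smul_left, inner_smul_right, hνx, h4]
    rw [← h3]
    linarith
  obtain ⟨s, hs1, hs2⟩ := (hin.and hinB).exists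
  obtain ⟨r, hr1, hr2⟩ := (hout.and houtB).exists
  exact hr1 (subset_of_disjoint_frontier hBpre hBfr ⟨_, hs2, hs1⟩ hr2)

end Touching

section FlowTouching

variable {n : ℕ} {M : Type*} [TopologicalSpace M] [ChartedSpace (Model n) M]
variable {Γ : Set (Fin n → ℝ)} {f : (Fin n → ℝ) → ℝ} {T : ℝ} {Ω : ℝ → Set (Ambient n)}
  {X ν : ℝ → M → Ambient n} {F : ℝ → M → ℝ} {σ : ℝ}

lemma inner_graphTangent_graphNormal {e : Fin n → Ambient n} {ν₀ : Ambient n}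
    (he : ∀ i j, inner ℝ (e i) (e j) = if i = j then (1 : ℝ) else 0)
    (hν : inner ℝ ν₀ ν₀ = (1 : ℝ)) (heν : ∀ i, inner ℝ (e i) ν₀ = (0 : ℝ))
    (φ : Model n × ℝ → ℝ) (z : Model n × ℝ) (j : Fin n) :
    inner ℝ ν₀ (graphNormal e ν₀ φ z) = 1 ∧
    inner ℝ (e j - dirDeriv (spaceDir j) φ z • ν₀) (e j - dirDeriv (spaceDir j) φ z • ν₀) =
      1 + dirDeriv (spaceDir j) φ z * dirDeriv (spaceDir j) φ z := by
  have heν' : ∀ i, inner ℝ ν₀ (e i) = (0 : ℝ) := fun i => by rw [real_inner_comm]; exact heν i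
  refine ⟨?_, ?_⟩
  · simp only [graphNormal, inner_add_right, inner_sum, inner_smul_right, hν, heν', mul_zero,
      Finset.sum_const_zero, add_zero]
  · simp only [inner_sub_left, inner_sub_right, real_inner_smul_left, inner_smul_right, he, hν, heν,
      heν', if_true]
    ring

/-- The gap to a touching sphere, in terms of a graph. -/
lemma IsGraphAt.gap_nonneg {X₀ ν₀ : Ambient n} {e : Fin n → Ambient n}
    {φ : Model n × ℝ → ℝ} {α : Model n × ℝ → M} {z : Model n × ℝ}
    (hG : IsGraphAt X ν F X₀ e ν₀ φ α z) {a : ℝ} {y : M}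
    (hgap : 0 ≤ sphereGap (X z.2) (ν z.2) (a * F z.2 (α z)) (α z) y) :
    0 ≤ a * dirDeriv timeDir φ z / 2 *
      inner ℝ (graphPoint X₀ e ν₀ φ z - X z.2 y) (graphPoint X₀ e ν₀ φ z - X z.2 y) -
      inner ℝ (graphPoint X₀ e ν₀ φ z - X z.2 y) (graphNormal e ν₀ φ z) := by
  have h1 := mul_nonneg (graphSlope_pos φ z).le hgap
  rw [sphereGap, hG.point] at h1
  rw [hG.normal, hG.time, inner_smul_right]
  linarith

lemma curvature_le_of_gap_nonneg {X₀ ν₀ : Ambient n} {e : Fin n → Ambient n}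
    {φ : Model n × ℝ → ℝ} {α : Model n × ℝ → M} {z : Model n × ℝ}
    (hG : ∀ᶠ z' in 𝓝 z, IsGraphAt X ν F X₀ e ν₀ φ α z')
    (he : ∀ i j, inner ℝ (e i) (e j) = if i = j then (1 : ℝ) else 0)
    (hν : inner ℝ ν₀ ν₀ = (1 : ℝ)) (heν : ∀ i, inner ℝ (e i) ν₀ = (0 : ℝ))
    (hφ : ContDiffAt ℝ 2 φ z) {a : ℝ}
    (hgap : ∀ y, 0 ≤ sphereGap (X z.2) (ν z.2) (a * F z.2 (α z)) (α z) y) (j : Fin n) :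
    0 ≤ a * dirDeriv timeDir φ z *
      (1 + dirDeriv (spaceDir j) φ z * dirDeriv (spaceDir j) φ z) -
        dirDeriv (spaceDir j) (dirDeriv (spaceDir j) φ) z := by
  have hX := jet2_graphPoint X₀ e ν₀ hφ (spaceDir j)
  have hΔ := (Jet2.const (graphPoint X₀ e ν₀ φ z)).sub hX
  have hq := ((Jet2.const (a * dirDeriv timeDir φ z / 2)).mul (hΔ.inner hΔ)).sub
    (hΔ.inner (Jet2.const (graphNormal e ν₀ φ z)))
  have hcont : Tendsto (fun s : ℝ => z + s • (spaceDir j : Model n × ℝ)) (𝓝 0) (𝓝 z) := by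
    have : Continuous (fun s : ℝ => z + s • (spaceDir j : Model n × ℝ)) := by fun_prop
    simpa using this.tendsto 0
  have h2 := (hq.eq_zero_and_nonneg (by
    filter_upwards [hcont.eventually hG] with s hs
    have h3 := hG.self_of_nhds.gap_nonneg (hgap (α (z + s • spaceDir j)))
    have h4 := hs.point
    have h5 : (z + s • (spaceDir j : Model n × ℝ)).2 = z.2 := by simp [spaceDir]
    rw [h5] at h4
    rw [h4] at h3
    simpa using h3)).2
  have hsing : ∑ k, (spaceDir j : Model n × ℝ).1 k • e k = e j := by simp [spaceDir]
  obtain ⟨g2, g3⟩ := inner_graphTangent_graphNormal he hν heν φ z j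
  rw [hsing] at h2
  simp only [sub_self, zero_sub, neg_neg, inner_zero_left, inner_zero_right, inner_neg_left,
    inner_neg_right, g3, real_inner_smul_left, g2, mul_zero, zero_mul, add_zero, zero_add,
    mul_one] at h2
  linarith

lemma IsConcaveFlow.inner_normal_self (h : IsConcaveFlow Γ f T Ω X ν F σ) {t : ℝ}
    (ht : t ∈ Ico 0 T) (x : M) : inner ℝ (ν t x) (ν t x) = (1 : ℝ) := by
  rw [real_inner_self_eq_norm_sq, h.norm_eq_one t ht x]; norm_num

lemma IsPrincipalFrame.orthonormal_differential {Y N : M → Ambient n} {x : M} {μ : Fin n → ℝ}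
    {b : Fin n → Model n} (hb : IsPrincipalFrame Y N x μ b)
    (hN : ∀ v, inner ℝ (differential Y x v) (N x) = 0) :
    (∀ i j, inner ℝ (differential Y x (b i)) (differential Y x (b j)) =
      if i = j then (1 : ℝ) else 0) ∧ ∀ i, inner ℝ (differential Y x (b i)) (N x) = (0 : ℝ) :=
  ⟨hb.metric, fun i => hN (b i)⟩

variable [IsManifold (𝓡 n) ∞ M]

lemma IsConcaveFlow.exists_isSpeedGraph (h : IsConcaveFlow Γ f T Ω X ν F σ) {t₀ : ℝ}
    (ht₀ : t₀ ∈ Ioo 0 T) (x₀ : M) {e : Fin n → Ambient n}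
    (he : ∀ i j, inner ℝ (e i) (e j) = if i = j then (1 : ℝ) else 0)
    (heν : ∀ i, inner ℝ (e i) (ν t₀ x₀) = (0 : ℝ)) {κ p : Fin n → ℝ} (hp : IsSupport Γ f κ p) :
    ∃ (φ : Model n × ℝ → ℝ) (α : Model n × ℝ → M), IsSpeedGraph p φ (0, t₀) ∧ φ (0, t₀) = 0 ∧
      α (0, t₀) = x₀ ∧ dirDeriv timeDir φ (0, t₀) = F t₀ x₀ ∧
      ∀ᶠ z in 𝓝 (0, t₀), z.2 ∈ Ioo 0 T ∧ IsGraphAt X ν F (X t₀ x₀) e (ν t₀ x₀) φ α z := by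
  have ht' : t₀ ∈ Ico 0 T := Ioo_subset_Ico_self ht₀
  have hν := h.inner_normal_self ht' x₀
  obtain ⟨φ, α, hφ, hφ0, hα, hG⟩ := h.exists_isGraphAt ht₀ x₀ he heν
  have hG0 := hG.self_of_nhds.2
  have hgrad : ∀ i, dirDeriv (spaceDir i) φ (0, t₀) = 0 :=
    hG0.grad_eq_zero he heν (by rw [hα])
  refine ⟨φ, α, ⟨hφ, hgrad, ?_⟩, hφ0, hα, ?_, hG⟩
  · filter_upwards [hG, eventually_contDiffAt_two hφ] with z hz hz2
    exact hz.2.dirDeriv_time_le h he hν heν (Ioo_subset_Ico_self hz.1) hz2 hp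
  · rw [hG0.time, graphSlope_eq_one hgrad, one_mul, hα]

/-- At an interior time, if the gap is nonnegative up to this time, the principal curvatures are
strictly below `a F`. -/
theorem IsConcaveFlow.curvature_lt (h : IsConcaveFlow Γ f T Ω X ν F σ) {t₀ : ℝ}
    (ht₀ : t₀ ∈ Ioo 0 T) {a : ℝ → ℝ} {a' a'' : ℝ}
    (ha : Jet2 (fun s => a (t₀ + s)) (a t₀) a' a'') (hpos : ∀ x, 0 < a' * F t₀ x)
    (hgap : ∀ᶠ t in 𝓝 t₀, t ≤ t₀ → ∀ x y, 0 ≤ sphereGap (X t) (ν t) (a t * F t x) x y)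
    {x₀ : M} {μ : Fin n → ℝ} (hμ : μ ∈ Γ) (hF : F t₀ x₀ = f μ) {b : Fin n → Model n}
    (hb : IsPrincipalFrame (X t₀) (ν t₀) x₀ μ b) (j : Fin n) : μ j < a t₀ * F t₀ x₀ := by
  have ht' : t₀ ∈ Ico 0 T := Ioo_subset_Ico_self ht₀
  have hν := h.inner_normal_self ht' x₀
  obtain ⟨he, heν⟩ := hb.orthonormal_differential (h.orthogonal t₀ ht' x₀)
  obtain ⟨p, hp⟩ := h.speed.exists_support hμ
  obtain ⟨φ, α, hS, hφ0, hα, hφt, hG⟩ := h.exists_isSpeedGraph ht₀ x₀ he heν hp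
  have hG0 := hG.self_of_nhds.2
  have hφ2 : ContDiffAt ℝ 2 φ (0, t₀) := hS.smooth.of_le ENat.LEInfty.out
  have hhess : spaceHess φ (0, t₀) = Matrix.diagonal μ := by
    refine hG0.spaceHess_eq hS.grad_eq_zero hφ2 (h.immersion t₀ ht' _) (b := b) ?_ ?_
    · show IsPrincipalFrame (X t₀) (ν t₀) (α (0, t₀)) μ b
      rw [hα]; exact hb
    · intro i
      show _ = differential (X t₀) (α (0, t₀)) (b i)
      rw [hα]
  have heq : dirDeriv timeDir φ (0, t₀) = ∑ i, p i * spaceHess φ (0, t₀) i i := by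
    rw [hφt, hF, ← hp.euler, hhess]; simp
  have hge : ∀ᶠ z in 𝓝 ((0 : Model n), t₀), z.2 ≤ t₀ → 0 ≤ a z.2 * dirDeriv timeDir φ z *
      (1 + dirDeriv (spaceDir j) φ z * dirDeriv (spaceDir j) φ z) -
        dirDeriv (spaceDir j) (dirDeriv (spaceDir j) φ) z := by
    have h1 : ∀ᶠ z : Model n × ℝ in 𝓝 (0, t₀), z.2 ≤ t₀ → ∀ x y,
        0 ≤ sphereGap (X z.2) (ν z.2) (a z.2 * F z.2 x) x y :=
      (continuous_snd.tendsto ((0 : Model n), t₀)).eventually hgap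
    filter_upwards [h1, hG.eventually_nhds, eventually_contDiffAt_two hS.smooth] with z g1 g2 g3 hz
    exact curvature_le_of_gap_nonneg (g2.mono fun z' hz' => hz'.2) he hν heν g3
      (fun y => g1 hz _ y) j
  have hle : μ j ≤ a t₀ * F t₀ x₀ := by
    have h1 := hge.self_of_nhds le_rfl
    have h2 : dirDeriv (spaceDir j) (dirDeriv (spaceDir j) φ) (0, t₀) = μ j := by
      have := congrFun (congrFun hhess j) j
      simpa [spaceHess] using this
    rw [h2, hS.grad_eq_zero, hφt] at h1
    linarith
  refine lt_of_le_of_ne hle fun hcon => ?_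
  exact hS.not_diagonal_touching hp.nonneg heq hhess (a := a) ha j (by rw [hφt]; exact hcon.symm)
    hge (by rw [hφt]; exact hpos x₀)

lemma tangent_eq_zero_of_touching (h : IsConcaveFlow Γ f T Ω X ν F σ) {t₀ : ℝ}
    (ht₀ : t₀ ∈ Ioo 0 T) {x₀ y₀ : M} {K : ℝ}
    (hgap : ∀ y, 0 ≤ sphereGap (X t₀) (ν t₀) K x₀ y)
    (htouch : sphereGap (X t₀) (ν t₀) K x₀ y₀ = 0) {e : Fin n → Ambient n}
    (he : ∀ i j, inner ℝ (e i) (e j) = if i = j then (1 : ℝ) else 0)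
    (heν : ∀ i, inner ℝ (e i) (ν t₀ y₀) = (0 : ℝ)) (i : Fin n) :
    inner ℝ (e i) (ν t₀ x₀ - K • (X t₀ x₀ - X t₀ y₀)) = (0 : ℝ) := by
  obtain ⟨φ, α, hφ, hφ0, hα, hG⟩ := h.exists_isGraphAt ht₀ y₀ he heν
  have hgrad : ∀ i, dirDeriv (spaceDir i) φ (0, t₀) = 0 :=
    hG.self_of_nhds.2.grad_eq_zero he heν (by rw [hα])
  have hφ2 : ContDiffAt ℝ 2 φ (0, t₀) := hφ.of_le ENat.LEInfty.out
  have hX := jet2_graphPoint (X t₀ y₀) e (ν t₀ y₀) hφ2 (spaceDir i)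
  have hΔ := (Jet2.const (X t₀ x₀)).sub hX
  have hq := ((Jet2.const (K / 2)).mul (hΔ.inner hΔ)).sub (hΔ.inner (Jet2.const (ν t₀ x₀)))
  have hcont : Tendsto (fun s : ℝ => ((0 : Model n), t₀) + s • (spaceDir i : Model n × ℝ)) (𝓝 0)
      (𝓝 (0, t₀)) := by
    have : Continuous (fun s : ℝ => ((0 : Model n), t₀) + s • (spaceDir i : Model n × ℝ)) := by
      fun_prop
    simpa using this.tendsto 0
  have hY0 : graphPoint (X t₀ y₀) e (ν t₀ y₀) φ (0, t₀) = X t₀ y₀ := by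
    rw [← hG.self_of_nhds.2.point, hα]
  rw [hY0] at hq
  have h2 := (hq.eq_zero_and_nonneg (by
    filter_upwards [hcont.eventually hG] with s hs
    have h3 := hgap (α ((0, t₀) + s • spaceDir i))
    have h4 := hs.2.point
    have h5 : (((0 : Model n), t₀) + s • (spaceDir i : Model n × ℝ)).2 = t₀ := by simp [spaceDir]
    rw [h5] at h4
    rw [sphereGap, h4] at h3
    rw [sphereGap] at htouch
    rw [htouch]
    exact h3)).1
  have hsing : ∑ k, (spaceDir i : Model n × ℝ).1 k • e k = e i := by simp [spaceDir]
  rw [hsing, hgrad, zero_smul, sub_zero] at h2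
  simp only [zero_sub, inner_neg_left, inner_neg_right, inner_zero_right, zero_mul, add_zero,
    zero_add] at h2
  rw [inner_sub_right, inner_smul_right]
  rw [real_inner_comm (e i)] at h2
  linarith

/-- At an interior time, if the gap is nonnegative up to this time, it is strictly positive off the
diagonal. -/
theorem IsConcaveFlow.gap_pos (hn : 1 ≤ n) (h : IsConcaveFlow Γ f T Ω X ν F σ) {t₀ : ℝ}
    (ht₀ : t₀ ∈ Ioo 0 T) {a : ℝ → ℝ} {a' a'' : ℝ}
    (ha : Jet2 (fun s => a (t₀ + s)) (a t₀) a' a'') (hpos : ∀ x, 0 < a' * F t₀ x)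
    (hgap : ∀ᶠ t in 𝓝 t₀, t ≤ t₀ → ∀ x y, 0 ≤ sphereGap (X t) (ν t) (a t * F t x) x y)
    {x₀ y₀ : M} (hxy : x₀ ≠ y₀) : 0 < sphereGap (X t₀) (ν t₀) (a t₀ * F t₀ x₀) x₀ y₀ := by
  have hgap0 := hgap.self_of_nhds le_rfl
  refine lt_of_le_of_ne (hgap0 x₀ y₀) fun hcon => ?_
  have htouch := hcon.symm
  have ht' : t₀ ∈ Ico 0 T := Ioo_subset_Ico_self ht₀
  have hνx := h.inner_normal_self ht' x₀
  have hνy := h.inner_normal_self ht' y₀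
  obtain ⟨μ, hμ, hF, b, hb⟩ := h.frame t₀ ht' x₀
  obtain ⟨μy, -, -, bY, hby⟩ := h.frame t₀ ht' y₀
  obtain ⟨he, heν⟩ := hb.orthonormal_differential (h.orthogonal t₀ ht' x₀)
  obtain ⟨hey, heyν⟩ := hby.orthonormal_differential (h.orthogonal t₀ ht' y₀)
  set K := a t₀ * F t₀ x₀ with hK
  set D := X t₀ x₀ - X t₀ y₀ with hD
  have hD0 : D ≠ 0 := fun h0 => hxy (h.injective t₀ ht' (sub_eq_zero.1 h0))
  have hd2 : inner ℝ D D ≠ (0 : ℝ) := inner_self_ne_zero.2 hD0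
  have htouch' : K / 2 * inner ℝ D D = inner ℝ D (ν t₀ x₀) := by
    rw [sphereGap] at htouch; linarith
  have hnormal : ν t₀ x₀ - K • D = ν t₀ y₀ := by
    refine normal_eq_of_touching hn (h.frontier_subset t₀ ht') hνx (h.inward t₀ ht' x₀)
      (h.outward t₀ ht' y₀) (hgap0 x₀) htouch ?_
    have h1 := tangent_eq_zero_of_touching h ht₀ (hgap0 x₀) htouch hey heyν
    rw [← hD, ← hK] at *
    have h2 := eq_sum_frame_add_normal hey hνy heyν (ν t₀ x₀ - K • D)
    have h3 : ∀ i, inner ℝ (ν t₀ x₀ - K • D) (differential (X t₀) y₀ (bY i)) = (0 : ℝ) :=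
      fun i => by rw [real_inner_comm]; exact h1 i
    simp only [h3, zero_smul, Finset.sum_const_zero, zero_add] at h2
    have h4 : inner ℝ (ν t₀ x₀ - K • D) (ν t₀ x₀ - K • D) = (1 : ℝ) := by
      simp only [inner_sub_left, inner_sub_right, real_inner_smul_left, inner_smul_right, hνx]
      rw [real_inner_comm D (ν t₀ x₀), ← htouch']
      ring
    set r : ℝ := inner ℝ (ν t₀ x₀ - K • D) (ν t₀ y₀)
    rw [h2, real_inner_smul_left, inner_smul_right, hνy] at h4
    have h5 : r = 1 ∨ r = -1 := by
      have : (r - 1) * (r + 1) = 0 := by linarith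
      rcases mul_eq_zero.1 this with h6 | h6
      · left; linarith
      · right; linarith
    rcases h5 with h5 | h5
    · left; rw [h2, h5, one_smul]
    · right; rw [h2, h5, neg_smul, one_smul]
  have hreflν : reflectAlong D (ν t₀ x₀) = ν t₀ y₀ := by
    rw [← hnormal, reflectAlong, ← htouch']
    congr 2
    field_simp
  obtain ⟨p, hp⟩ := h.speed.exists_support hμ
  set e := fun i => differential (X t₀) x₀ (b i) with hedef
  have he' : ∀ i j, inner ℝ (reflectAlong D (e i)) (reflectAlong D (e j)) =
      if i = j then (1 : ℝ) else 0 := fun i j => by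
    rw [inner_reflectAlong_reflectAlong hD0]; exact he i j
  have heν' : ∀ i, inner ℝ (reflectAlong D (e i)) (ν t₀ y₀) = (0 : ℝ) := fun i => by
    rw [← hreflν, inner_reflectAlong_reflectAlong hD0]; exact heν i
  obtain ⟨φ, α, hS, hφ0, hα, hφt, hG⟩ := h.exists_isSpeedGraph ht₀ x₀ he heν hp
  obtain ⟨ψ, β, hS', hψ0, hβ, hψt, hG'⟩ := h.exists_isSpeedGraph ht₀ y₀ he' heν' hp
  have hG0 := hG.self_of_nhds.2
  have hφ2 : ContDiffAt ℝ 2 φ (0, t₀) := hS.smooth.of_le ENat.LEInfty.out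
  have hhess : spaceHess φ (0, t₀) = Matrix.diagonal μ := by
    refine hG0.spaceHess_eq hS.grad_eq_zero hφ2 (h.immersion t₀ ht' _) (b := b) ?_ ?_
    · show IsPrincipalFrame (X t₀) (ν t₀) (α (0, t₀)) μ b
      rw [hα]; exact hb
    · intro i
      show _ = differential (X t₀) (α (0, t₀)) (b i)
      rw [hα]
  have heq : dirDeriv timeDir φ (0, t₀) = ∑ i, p i * spaceHess φ (0, t₀) i i := by
    rw [hφt, hF, ← hp.euler, hhess]; simp
  refine hS.not_offDiagonal_touching hS' hp.nonneg hφ0 hψ0 hνx heν heq hhess (a := a) ha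
    (X₀ := X t₀ x₀) (Y₀ := X t₀ y₀) ?_ hD0 ?_ ?_ (by rw [hφt]; exact hpos x₀)
  · intro i
    rw [hφt]
    exact (h.curvature_lt ht₀ ha hpos hgap hμ hF hb i).le
  · rw [hφt]; exact htouch'
  · rw [← hD, hreflν]
    have h1 : ∀ᶠ z : (Model n × ℝ) × (Model n × ℝ) in 𝓝 ((0, t₀), (0, t₀)), z.1.2 ≤ t₀ → ∀ x y,
        0 ≤ sphereGap (X z.1.2) (ν z.1.2) (a z.1.2 * F z.1.2 x) x y := by
      have : Continuous fun z : (Model n × ℝ) × (Model n × ℝ) => z.1.2 := by fun_prop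
      exact (this.tendsto ((0, t₀), (0, t₀))).eventually hgap
    have h2 := (continuous_fst.tendsto (((0 : Model n), t₀), ((0 : Model n), t₀))).eventually hG
    have h3 := (continuous_snd.tendsto (((0 : Model n), t₀), ((0 : Model n), t₀))).eventually hG'
    filter_upwards [h1, h2, h3] with z g1 g2 g3 hz hzt
    have g4 := g2.2.gap_nonneg (g1 hzt (α z.1) (β z.2))
    have g5 := g3.2.point
    rw [← hz] at g5
    rw [g5] at g4
    exact g4

end FlowTouching

section SliceCalculus

variable {E V : Type*} [NormedAddCommGroup E] [NormedSpace ℝ E] [NormedAddCommGroup V]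

lemma hasDerivAt_line (z v : E) (s : ℝ) : HasDerivAt (fun s : ℝ => z + s • v) v s := by
  simpa using ((hasDerivAt_id s).smul_const v).const_add z

section

variable [NormedSpace ℝ V]

lemma hasDerivAt_comp_line {g : E → V} {z v : E} {s : ℝ}
    (hg : DifferentiableAt ℝ g (z + s • v)) :
    HasDerivAt (fun s : ℝ => g (z + s • v)) (fderiv ℝ g (z + s • v) v) s :=
  hg.hasFDerivAt.comp_hasDerivAt s (hasDerivAt_line z v s)

lemma hasDerivAt_fderiv_comp_line {g : E → V} {z v : E} {s : ℝ}
    (hg : ContDiffAt ℝ 2 g (z + s • v)) :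
    HasDerivAt (fun s : ℝ => fderiv ℝ g (z + s • v) v)
      (fderiv ℝ (fderiv ℝ g) (z + s • v) v v) s := by
  have h1 : DifferentiableAt ℝ (fderiv ℝ g) (z + s • v) :=
    (hg.fderiv_right (m := 1) (by norm_num)).differentiableAt (by simp)
  have h2 := (hasDerivAt_comp_line h1).clm_apply (hasDerivAt_const s v)
  simpa using h2

lemma jet2_comp_line {g : E → V} {z : E} (hg : ContDiffAt ℝ 2 g z) (v : E) :
    Jet2 (fun s : ℝ => g (z + s • v)) (g z) (fderiv ℝ g z v) (fderiv ℝ (fderiv ℝ g) z v v) := by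
  have hcont : Tendsto (fun s : ℝ => z + s • v) (𝓝 0) (𝓝 z) := by
    simpa using (hasDerivAt_line z v 0).continuousAt.tendsto
  refine ⟨fun s => fderiv ℝ g (z + s • v) v, ?_, by simp, by simp, ?_⟩
  · filter_upwards [hcont.eventually (hg.eventually (by simp))] with s hs
    exact hasDerivAt_comp_line (hs.differentiableAt (by simp))
  · have h0 : ContDiffAt ℝ 2 g (z + (0 : ℝ) • v) := by simpa using hg
    have := hasDerivAt_fderiv_comp_line h0
    rwa [zero_smul, add_zero] at this

variable {G : E × ℝ → V} {U : Set E} {I : Set ℝ}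

lemma uniqueDiffOn_cylinder (hU : IsOpen U) (hI : UniqueDiffOn ℝ I) : UniqueDiffOn ℝ (U ×ˢ I) :=
  hU.uniqueDiffOn.prod hI

lemma fderiv_slice_eq (hU : IsOpen U) (hG : ContDiffOn ℝ ∞ G (U ×ˢ I)) {p : E × ℝ}
    (hp : p ∈ U ×ˢ I) : fderiv ℝ (fun z => G (z, p.2)) p.1 =
      (fderivWithin ℝ G (U ×ˢ I) p).comp (ContinuousLinearMap.inl ℝ E ℝ) := by
  have h1 : HasFDerivWithinAt G (fderivWithin ℝ G (U ×ˢ I) p) (U ×ˢ I) (p.1, p.2) :=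
    (hG.differentiableOn (by simp) p hp).hasFDerivWithinAt
  have h2 : HasFDerivAt (fun z : E => (z, p.2)) (ContinuousLinearMap.inl ℝ E ℝ) p.1 :=
    hasFDerivAt_prodMk_left p.1 p.2
  have hmaps : MapsTo (fun z : E => (z, p.2)) U (U ×ˢ I) := fun z hz => ⟨hz, hp.2⟩
  have h3 := h1.comp p.1 (h2.hasFDerivWithinAt (s := U)) hmaps
  exact (h3.hasFDerivAt (hU.mem_nhds hp.1)).fderiv

lemma contDiffOn_fderiv_slice (hU : IsOpen U) (hI : UniqueDiffOn ℝ I)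
    (hG : ContDiffOn ℝ ∞ G (U ×ˢ I)) :
    ContDiffOn ℝ ∞ (fun p : E × ℝ => fderiv ℝ (fun z => G (z, p.2)) p.1) (U ×ˢ I) := by
  have h1 : ContDiffOn ℝ ∞ (fderivWithin ℝ G (U ×ˢ I)) (U ×ˢ I) :=
    hG.fderivWithin (uniqueDiffOn_cylinder hU hI) (by simp)
  exact (h1.clm_comp contDiffOn_const).congr fun p hp => fderiv_slice_eq hU hG hp

lemma fderivWithin_time_eq (hI : UniqueDiffOn ℝ I) (hG : ContDiffOn ℝ ∞ G (U ×ˢ I))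
    {p : E × ℝ} (hp : p ∈ U ×ˢ I) {w : V} (hw : HasDerivWithinAt (fun s => G (p.1, s)) w I p.2) :
    fderivWithin ℝ G (U ×ˢ I) p (0, 1) = w := by
  have h1 : HasFDerivWithinAt G (fderivWithin ℝ G (U ×ˢ I) p) (U ×ˢ I) (p.1, p.2) :=
    (hG.differentiableOn (by simp) p hp).hasFDerivWithinAt
  have h2 : HasDerivAt (fun s : ℝ => (p.1, s)) ((0 : E), (1 : ℝ)) p.2 :=
    (hasDerivAt_const p.2 p.1).prodMk (hasDerivAt_id p.2)
  have h3 := h1.comp_hasDerivWithinAt p.2 (h2.hasDerivWithinAt (s := I)) fun s hs => ⟨hp.1, hs⟩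
  exact (hI p.2 hp.2).eq_deriv _ h3 hw

end

lemma nonneg_of_second_deriv_nonneg {γ γ' γ'' : ℝ → ℝ}
    (h1 : ∀ s ∈ Icc (0 : ℝ) 1, HasDerivAt γ (γ' s) s)
    (h2 : ∀ s ∈ Icc (0 : ℝ) 1, HasDerivAt γ' (γ'' s) s)
    (h3 : ∀ s ∈ Icc (0 : ℝ) 1, 0 ≤ γ'' s) (h0 : γ 0 = 0) (h0' : γ' 0 = 0) : 0 ≤ γ 1 := by
  have m1 : MonotoneOn γ' (Icc 0 1) :=
    monotoneOn_of_hasDerivWithinAt_nonneg (convex_Icc 0 1)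
      (fun s hs => (h2 s hs).continuousAt.continuousWithinAt)
      (fun s hs => (h2 s (interior_subset hs)).hasDerivWithinAt)
      (fun s hs => h3 s (interior_subset hs))
  have m2 : MonotoneOn γ (Icc 0 1) :=
    monotoneOn_of_hasDerivWithinAt_nonneg (convex_Icc 0 1)
      (fun s hs => (h1 s hs).continuousAt.continuousWithinAt)
      (fun s hs => (h1 s (interior_subset hs)).hasDerivWithinAt)
      (fun s hs => by
        have hs' := interior_subset hs
        have := m1 (left_mem_Icc.2 zero_le_one) hs' hs'.1
        rwa [h0'] at this)
  have := m2 (left_mem_Icc.2 zero_le_one) (right_mem_Icc.2 zero_le_one) zero_le_one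
  rwa [h0] at this

/-- If the second derivative of the gap to a sphere touching at `g u` is nonnegative on a convex
set, then the gap is nonnegative there. -/
lemma gap_nonneg_of_convex [InnerProductSpace ℝ V] {g : E → V} {B : Set E} (hB : Convex ℝ B)
    (hg : ∀ w ∈ B, ContDiffAt ℝ 2 g w) {u v : E} (hu : u ∈ B) (hv : v ∈ B) {N : V} {k : ℝ}
    (hN : inner ℝ (fderiv ℝ g u (v - u)) N = 0)
    (hpos : ∀ w ∈ B, 0 ≤ k * inner ℝ (fderiv ℝ g w (v - u)) (fderiv ℝ g w (v - u)) +
      inner ℝ (fderiv ℝ (fderiv ℝ g) w (v - u) (v - u)) (N - k • (g u - g w))) :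
    0 ≤ k / 2 * inner ℝ (g u - g v) (g u - g v) - inner ℝ (g u - g v) N := by
  set ξ := v - u with hξ
  have hmem : ∀ s ∈ Icc (0 : ℝ) 1, u + s • ξ ∈ B := fun s hs =>
    hB.add_smul_sub_mem hu hv hs
  have d1 : ∀ s ∈ Icc (0 : ℝ) 1, HasDerivAt (fun s : ℝ => g u - g (u + s • ξ))
      (-fderiv ℝ g (u + s • ξ) ξ) s := fun s hs =>
    (hasDerivAt_comp_line ((hg _ (hmem s hs)).differentiableAt (by simp))).const_sub _
  have d2 : ∀ s ∈ Icc (0 : ℝ) 1, HasDerivAt (fun s : ℝ => -fderiv ℝ g (u + s • ξ) ξ)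
      (-fderiv ℝ (fderiv ℝ g) (u + s • ξ) ξ ξ) s := fun s hs =>
    (hasDerivAt_fderiv_comp_line (hg _ (hmem s hs))).neg
  have key := nonneg_of_second_deriv_nonneg
    (γ := fun s => k / 2 * inner ℝ (g u - g (u + s • ξ)) (g u - g (u + s • ξ)) -
      inner ℝ (g u - g (u + s • ξ)) N)
    (γ' := fun s => k / 2 * (inner ℝ (g u - g (u + s • ξ)) (-fderiv ℝ g (u + s • ξ) ξ) +
        inner ℝ (-fderiv ℝ g (u + s • ξ) ξ) (g u - g (u + s • ξ))) -
      (inner ℝ (g u - g (u + s • ξ)) 0 + inner ℝ (-fderiv ℝ g (u + s • ξ) ξ) N))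
    (γ'' := fun s => k / 2 * ((inner ℝ (g u - g (u + s • ξ))
          (-fderiv ℝ (fderiv ℝ g) (u + s • ξ) ξ ξ) +
          inner ℝ (-fderiv ℝ g (u + s • ξ) ξ) (-fderiv ℝ g (u + s • ξ) ξ)) +
        (inner ℝ (-fderiv ℝ g (u + s • ξ) ξ) (-fderiv ℝ g (u + s • ξ) ξ) +
          inner ℝ (-fderiv ℝ (fderiv ℝ g) (u + s • ξ) ξ ξ) (g u - g (u + s • ξ)))) -
      ((inner ℝ (g u - g (u + s • ξ)) 0 + inner ℝ (-fderiv ℝ g (u + s • ξ) ξ) 0) +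
        (inner ℝ (-fderiv ℝ g (u + s • ξ) ξ) 0 +
          inner ℝ (-fderiv ℝ (fderiv ℝ g) (u + s • ξ) ξ ξ) N)))
    (fun s hs => (((d1 s hs).inner ℝ (d1 s hs)).const_mul (k / 2)).sub
      ((d1 s hs).inner ℝ (hasDerivAt_const s N)))
    (fun s hs => ((((d1 s hs).inner ℝ (d2 s hs)).add ((d2 s hs).inner ℝ (d1 s hs))).const_mul
      (k / 2)).sub (((d1 s hs).inner ℝ (hasDerivAt_const s (0 : V))).add
        ((d2 s hs).inner ℝ (hasDerivAt_const s N))))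
    (fun s hs => ?_) (by simp) ?_
  · simpa [hξ] using key
  · have h := hpos _ (hmem s hs)
    simp only [inner_sub_right, inner_smul_right] at h
    simp only [inner_zero_right, inner_neg_left, inner_neg_right, inner_sub_left, inner_sub_right]
    rw [real_inner_comm _ (g u), real_inner_comm _ (g (u + s • ξ))]
    linarith
  · simp only [zero_smul, add_zero, sub_self, inner_zero_left, inner_zero_right, inner_neg_left, hN]
    simp

end SliceCalculus

section FlowContinuity

variable {n : ℕ} {M : Type*} [TopologicalSpace M] [ChartedSpace (Model n) M]
  {Γ : Set (Fin n → ℝ)} {f : (Fin n → ℝ) → ℝ} {T : ℝ} {Ω : ℝ → Set (Ambient n)}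
  {X ν : ℝ → M → Ambient n} {F : ℝ → M → ℝ} {σ : ℝ}

lemma IsConcaveFlow.speed_eq (h : IsConcaveFlow Γ f T Ω X ν F σ) {t : ℝ} (ht : t ∈ Ico 0 T)
    (x : M) : F t x = σ * ‖-(F t x • ν t x)‖ := by
  rw [norm_neg, norm_smul, h.norm_eq_one t ht x, mul_one, Real.norm_eq_abs]
  have h1 := h.pos t ht x
  have h2 : |σ| = 1 := by
    have : |σ| * |σ| = 1 := by rw [← abs_mul, h.sign, abs_one]
    nlinarith [abs_nonneg σ]
  have h3 : |F t x| = σ * F t x := by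
    rw [← abs_of_pos h1, abs_mul, h2, one_mul]
  rw [h3, ← mul_assoc, h.sign, one_mul]

lemma IsConcaveFlow.speed_ne_zero (h : IsConcaveFlow Γ f T Ω X ν F σ) {t : ℝ} (ht : t ∈ Ico 0 T)
    (x : M) : F t x ≠ 0 := fun h0 => by
  have := h.pos t ht x
  rw [h0, mul_zero] at this
  exact lt_irrefl _ this

lemma continuousOn_of_chart {Y : Type*} [TopologicalSpace Y] {g : M × ℝ → Y} {I : Set ℝ}
    (hg : ∀ x₀ : M, ContinuousOn
      (fun p : Model n × ℝ => g ((extChartAt (𝓡 n) x₀).symm p.1, p.2))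
      ((extChartAt (𝓡 n) x₀).target ×ˢ I)) : ContinuousOn g (univ ×ˢ I) := by
  rintro ⟨x, t⟩ ⟨-, ht⟩
  have h1 : ContinuousWithinAt (fun q : M × ℝ => (extChartAt (𝓡 n) x q.1, q.2))
      ((extChartAt (𝓡 n) x).source ×ˢ I) (x, t) :=
    (((continuousAt_extChartAt x).comp (f := Prod.fst) (x := (x, t))
      continuousAt_fst).prodMk continuousAt_snd).continuousWithinAt
  have h2 := (hg x _ ⟨mem_extChartAt_target x, ht⟩).comp h1
    (fun q hq => ⟨(extChartAt (𝓡 n) x).map_source hq.1, hq.2⟩)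
  have h3 : ContinuousWithinAt g ((extChartAt (𝓡 n) x).source ×ˢ I) (x, t) := by
    refine h2.congr (fun q hq => ?_) ?_
    · simp only [Function.comp_apply, (extChartAt (𝓡 n) x).left_inv hq.1]
    · simp only [Function.comp_apply, extChartAt_to_inv]
  refine h3.mono_of_mem_nhdsWithin ?_
  have h4 : (extChartAt (𝓡 n) x).source ×ˢ (univ : Set ℝ) ∈ 𝓝 (x, t) :=
    prod_mem_nhds (extChartAt_source_mem_nhds x) univ_mem
  filter_upwards [mem_nhdsWithin_of_mem_nhds h4, self_mem_nhdsWithin] with q h5 h6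
  exact ⟨h5.1, h6.2⟩

/-- The quadratic form `k |dX ξ|² + ⟨D²X(ξ, ξ), ν⟩` is positive definite if `k` exceeds all
principal curvatures. -/
lemma IsPrincipalFrame.quadratic_pos {X ν : M → Ambient n} {x : M} {μ : Fin n → ℝ}
    {b : Fin n → Model n} (hb : IsPrincipalFrame X ν x μ b) (hν : inner ℝ (ν x) (ν x) = (1 : ℝ))
    (horth : ∀ v, inner ℝ (differential X x v) (ν x) = 0)
    (hinj : Function.Injective (differential X x)) {k : ℝ} (hk : ∀ i, μ i < k) {ξ : Model n}
    (hξ : ξ ≠ 0) : 0 < k * inner ℝ (differential X x ξ) (differential X x ξ) +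
      inner ℝ (secondDerivative X x ξ ξ) (ν x) := by
  obtain ⟨he, heν⟩ := hb.orthonormal_differential horth
  set c : Fin n → ℝ := fun i => inner ℝ (differential X x ξ) (differential X x (b i)) with hc
  have h1 : ξ = ∑ i, c i • b i := by
    apply hinj
    rw [eq_sum_frame_add_normal he hν heν (differential X x ξ), horth, zero_smul, add_zero,
      map_sum]
    simp only [map_smul, hc]
  have h2 : inner ℝ (differential X x ξ) (differential X x ξ) = ∑ i, c i * c i := by
    rw [h1]
    simp only [map_sum, map_smul, sum_inner, inner_sum, real_inner_smul_left, inner_smul_right,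
      hb.metric]
    simp
  have h3 : -inner ℝ (secondDerivative X x ξ ξ) (ν x) = ∑ i, μ i * (c i * c i) := by
    rw [h1]
    simp only [map_sum, map_smul, sum_apply, smul_apply,
      sum_inner, real_inner_smul_left, ← Finset.sum_neg_distrib]
    have h4 : ∀ i j, -(c i * (c j * inner ℝ (secondDerivative X x (b j) (b i)) (ν x))) =
        c i * c j * if j = i then μ j else 0 := fun i j => by rw [← hb.curvature]; ring
    simp only [Finset.mul_sum, ← Finset.sum_neg_distrib, h4, mul_ite, mul_zero,
      Finset.sum_ite_eq', Finset.mem_univ, if_true]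
    exact Finset.sum_congr rfl fun i _ => mul_comm _ _
  have h5 : ∃ i, c i ≠ 0 := by
    by_contra! hcon
    exact hξ (by rw [h1]; simp [hcon])
  obtain ⟨i₀, hi₀⟩ := h5
  have h6 : 0 < ∑ i, (k - μ i) * (c i * c i) :=
    Finset.sum_pos' (fun i _ => mul_nonneg (sub_nonneg.2 (hk i).le) (mul_self_nonneg _))
      ⟨i₀, Finset.mem_univ _, mul_pos (sub_pos.2 (hk i₀)) (mul_self_pos.2 hi₀)⟩
  simp only [sub_mul, Finset.sum_sub_distrib, ← Finset.mul_sum] at h6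
  rw [h2]
  linarith

variable [IsManifold (𝓡 n) ∞ M]

lemma IsConcaveFlow.continuousOn_velocity (h : IsConcaveFlow Γ f T Ω X ν F σ) (x₀ : M) :
    ContinuousOn (fun p : Model n × ℝ => -(F p.2 ((extChartAt (𝓡 n) x₀).symm p.1) •
      ν p.2 ((extChartAt (𝓡 n) x₀).symm p.1))) ((extChartAt (𝓡 n) x₀).target ×ˢ Ico 0 T) := by
  have hG := contDiffOn_chartFlow h.smooth x₀
  have h1 : ContDiffOn ℝ ∞ (fderivWithin ℝ (chartFlow X x₀)
      ((extChartAt (𝓡 n) x₀).target ×ˢ Ico 0 T)) ((extChartAt (𝓡 n) x₀).target ×ˢ Ico 0 T) :=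
    hG.fderivWithin (uniqueDiffOn_cylinder (isOpen_extChartAt_target x₀) (uniqueDiffOn_Ico 0 T))
      (by simp)
  refine (h1.continuousOn.clm_apply (continuousOn_const (c := ((0 : Model n), (1 : ℝ))))).congr
    fun p hp => ?_
  exact (fderivWithin_time_eq (uniqueDiffOn_Ico 0 T) hG hp
    (h.flow p.2 hp.2 ((extChartAt (𝓡 n) x₀).symm p.1))).symm

lemma IsConcaveFlow.continuousOn_speed_chart (h : IsConcaveFlow Γ f T Ω X ν F σ) (x₀ : M) :
    ContinuousOn (fun p : Model n × ℝ => F p.2 ((extChartAt (𝓡 n) x₀).symm p.1))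
      ((extChartAt (𝓡 n) x₀).target ×ˢ Ico 0 T) :=
  (continuousOn_const.mul (h.continuousOn_velocity x₀).norm).congr fun _ hp =>
    h.speed_eq hp.2 _

lemma IsConcaveFlow.continuousOn_normal_chart (h : IsConcaveFlow Γ f T Ω X ν F σ) (x₀ : M) :
    ContinuousOn (fun p : Model n × ℝ => ν p.2 ((extChartAt (𝓡 n) x₀).symm p.1))
      ((extChartAt (𝓡 n) x₀).target ×ˢ Ico 0 T) := by
  refine ((((h.continuousOn_speed_chart x₀).inv₀ fun p hp => h.speed_ne_zero hp.2 _).neg).smul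
    (h.continuousOn_velocity x₀)).congr fun p hp => ?_
  show ν p.2 _ = (-(F p.2 _)⁻¹) • (-(F p.2 _ • ν p.2 _))
  rw [neg_smul_neg, smul_smul, inv_mul_cancel₀ (h.speed_ne_zero hp.2 _), one_smul]

/-- The gap is jointly continuous. -/
lemma IsConcaveFlow.continuousOn_gap (h : IsConcaveFlow Γ f T Ω X ν F σ) {a : ℝ → ℝ}
    (ha : Continuous a) : ContinuousOn (fun q : (M × M) × ℝ =>
      sphereGap (X q.2) (ν q.2) (a q.2 * F q.2 q.1.1) q.1.1 q.1.2) (univ ×ˢ Ico 0 T) := by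
  have hX : ContinuousOn (fun p : M × ℝ => X p.2 p.1) (univ ×ˢ Ico 0 T) := h.smooth.continuousOn
  have hν : ContinuousOn (fun p : M × ℝ => ν p.2 p.1) (univ ×ˢ Ico 0 T) :=
    continuousOn_of_chart h.continuousOn_normal_chart
  have hF : ContinuousOn (fun p : M × ℝ => F p.2 p.1) (univ ×ˢ Ico 0 T) :=
    continuousOn_of_chart h.continuousOn_speed_chart
  have c1 : ContinuousOn (fun q : (M × M) × ℝ => (q.1.1, q.2)) (univ ×ˢ Ico 0 T) := by fun_prop
  have c2 : ContinuousOn (fun q : (M × M) × ℝ => (q.1.2, q.2)) (univ ×ˢ Ico 0 T) := by fun_prop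
  have m1 : MapsTo (fun q : (M × M) × ℝ => (q.1.1, q.2)) (univ ×ˢ Ico 0 T) (univ ×ˢ Ico 0 T) :=
    fun q hq => ⟨mem_univ _, hq.2⟩
  have m2 : MapsTo (fun q : (M × M) × ℝ => (q.1.2, q.2)) (univ ×ˢ Ico 0 T) (univ ×ˢ Ico 0 T) :=
    fun q hq => ⟨mem_univ _, hq.2⟩
  have hD := (hX.comp c1 m1).sub (hX.comp c2 m2)
  have hk : ContinuousOn (fun q : (M × M) × ℝ => a q.2 * F q.2 q.1.1 / 2) (univ ×ˢ Ico 0 T) :=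
    (((ha.comp continuous_snd).continuousOn).mul (hF.comp c1 m1)).div_const 2
  exact (hk.mul (hD.inner hD)).sub (hD.inner (hν.comp c1 m1))

lemma IsConcaveFlow.eventually_gap_nonneg_of_pos (h : IsConcaveFlow Γ f T Ω X ν F σ) {a : ℝ → ℝ}
    (ha : Continuous a) {t₀ : ℝ} (ht₀ : t₀ ∈ Ico 0 T) {x₀ y₀ : M}
    (hpos : 0 < sphereGap (X t₀) (ν t₀) (a t₀ * F t₀ x₀) x₀ y₀) :
    ∀ᶠ q : (M × M) × ℝ in 𝓝 ((x₀, y₀), t₀), q.2 ∈ Ico 0 T →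
      0 ≤ sphereGap (X q.2) (ν q.2) (a q.2 * F q.2 q.1.1) q.1.1 q.1.2 := by
  have h1 := (h.continuousOn_gap ha ((x₀, y₀), t₀) ⟨mem_univ _, ht₀⟩).eventually
    (lt_mem_nhds hpos)
  rw [eventually_nhdsWithin_iff] at h1
  filter_upwards [h1] with q hq hqT
  exact (hq ⟨mem_univ _, hqT⟩).le

end FlowContinuity

section FirstTouching

variable {n : ℕ} {M : Type*} [TopologicalSpace M] [ChartedSpace (Model n) M]
  {Γ : Set (Fin n → ℝ)} {f : (Fin n → ℝ) → ℝ} {T : ℝ} {Ω : ℝ → Set (Ambient n)}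
  {X ν : ℝ → M → Ambient n} {F : ℝ → M → ℝ} {σ : ℝ}

/-- The second derivative of the gap at `v` in the direction `ξ`, in the preferred chart at `x₀`. -/
def gapHessian (X ν : ℝ → M → Ambient n) (F : ℝ → M → ℝ) (a : ℝ → ℝ) (x₀ : M)
    (q : (Model n × Model n) × ℝ) (ξ : Model n) : ℝ :=
  a q.2 * F q.2 ((extChartAt (𝓡 n) x₀).symm q.1.1) *
    inner ℝ (fderiv ℝ (fun z => chartFlow X x₀ (z, q.2)) q.1.2 ξ)
      (fderiv ℝ (fun z => chartFlow X x₀ (z, q.2)) q.1.2 ξ) +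
  inner ℝ (fderiv ℝ (fun w => fderiv ℝ (fun z => chartFlow X x₀ (z, q.2)) w) q.1.2 ξ ξ)
    (ν q.2 ((extChartAt (𝓡 n) x₀).symm q.1.1) -
      (a q.2 * F q.2 ((extChartAt (𝓡 n) x₀).symm q.1.1)) •
        (chartFlow X x₀ (q.1.1, q.2) - chartFlow X x₀ (q.1.2, q.2)))

lemma gapHessian_smul (a : ℝ → ℝ) (x₀ : M) (q : (Model n × Model n) × ℝ) (c : ℝ) (ξ : Model n) :
    gapHessian X ν F a x₀ q (c • ξ) = c ^ 2 * gapHessian X ν F a x₀ q ξ := by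
  simp only [gapHessian, map_smul, smul_apply, real_inner_smul_left, inner_smul_right]
  ring

lemma IsConcaveFlow.gapHessian_pos (h : IsConcaveFlow Γ f T Ω X ν F σ) {a : ℝ → ℝ} {t₀ : ℝ}
    (ht₀ : t₀ ∈ Ico 0 T) {x₀ : M} {μ : Fin n → ℝ} {b : Fin n → Model n}
    (hb : IsPrincipalFrame (X t₀) (ν t₀) x₀ μ b) (hμ : ∀ i, μ i < a t₀ * F t₀ x₀) {ξ : Model n}
    (hξ : ξ ≠ 0) : 0 < gapHessian X ν F a x₀
      ((extChartAt (𝓡 n) x₀ x₀, extChartAt (𝓡 n) x₀ x₀), t₀) ξ := by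
  have h1 := hb.quadratic_pos (h.inner_normal_self ht₀ x₀) (h.orthogonal t₀ ht₀ x₀)
    (h.immersion t₀ ht₀ x₀) hμ hξ
  rw [differential_eq_fderiv ((contMDiffAt_slice h.smooth ht₀ x₀).mdifferentiableAt (by simp))]
    at h1
  simp only [gapHessian, sub_self, smul_zero, sub_zero, extChartAt_to_inv]
  exact h1

variable [IsManifold (𝓡 n) ∞ M]

lemma IsConcaveFlow.continuousOn_gapHessian (h : IsConcaveFlow Γ f T Ω X ν F σ) {a : ℝ → ℝ}
    (ha : Continuous a) (x₀ : M) :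
    ContinuousOn (fun r : ((Model n × Model n) × ℝ) × Model n => gapHessian X ν F a x₀ r.1 r.2)
      ((((extChartAt (𝓡 n) x₀).target ×ˢ (extChartAt (𝓡 n) x₀).target) ×ˢ Ico 0 T) ×ˢ univ) := by
  set U := (extChartAt (𝓡 n) x₀).target with hU
  set S := ((U ×ˢ U) ×ˢ Ico 0 T) ×ˢ (univ : Set (Model n)) with hS
  have hUo : IsOpen U := isOpen_extChartAt_target x₀
  have hI := uniqueDiffOn_Ico (0 : ℝ) T
  have hG := contDiffOn_chartFlow h.smooth x₀
  have hG1 := contDiffOn_fderiv_slice hUo hI hG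
  have hG2 := contDiffOn_fderiv_slice hUo hI hG1
  have c1 : ContinuousOn (fun r : ((Model n × Model n) × ℝ) × Model n => (r.1.1.1, r.1.2)) S := by
    fun_prop
  have c2 : ContinuousOn (fun r : ((Model n × Model n) × ℝ) × Model n => (r.1.1.2, r.1.2)) S := by
    fun_prop
  have m1 : MapsTo (fun r : ((Model n × Model n) × ℝ) × Model n => (r.1.1.1, r.1.2)) S
      (U ×ˢ Ico 0 T) := fun r hr => ⟨hr.1.1.1, hr.1.2⟩
  have m2 : MapsTo (fun r : ((Model n × Model n) × ℝ) × Model n => (r.1.1.2, r.1.2)) S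
      (U ×ˢ Ico 0 T) := fun r hr => ⟨hr.1.1.2, hr.1.2⟩
  have cξ : ContinuousOn (fun r : ((Model n × Model n) × ℝ) × Model n => r.2) S := by fun_prop
  have hd := (hG1.continuousOn.comp c2 m2).clm_apply cξ
  have hdd := ((hG2.continuousOn.comp c2 m2).clm_apply cξ).clm_apply cξ
  have hk : ContinuousOn (fun r : ((Model n × Model n) × ℝ) × Model n =>
      a r.1.2 * F r.1.2 ((extChartAt (𝓡 n) x₀).symm r.1.1.1)) S :=
    ((ha.comp (continuous_snd.comp continuous_fst)).continuousOn).mul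
      ((h.continuousOn_speed_chart x₀).comp c1 m1)
  have hN := (h.continuousOn_normal_chart x₀).comp c1 m1
  have hD := (hG.continuousOn.comp c1 m1).sub (hG.continuousOn.comp c2 m2)
  exact (hk.mul (hd.inner hd)).add (hdd.inner (hN.sub (hk.smul hD)))

lemma IsConcaveFlow.eventually_gap_nonneg_diagonal (h : IsConcaveFlow Γ f T Ω X ν F σ) {a : ℝ → ℝ}
    (ha : Continuous a) {t₀ : ℝ} (ht₀ : t₀ ∈ Ico 0 T) {x₀ : M} {μ : Fin n → ℝ}
    {b : Fin n → Model n} (hb : IsPrincipalFrame (X t₀) (ν t₀) x₀ μ b)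
    (hμ : ∀ i, μ i < a t₀ * F t₀ x₀) :
    ∀ᶠ q : (M × M) × ℝ in 𝓝 ((x₀, x₀), t₀), q.2 ∈ Ico 0 T →
      0 ≤ sphereGap (X q.2) (ν q.2) (a q.2 * F q.2 q.1.1) q.1.1 q.1.2 := by
  set U := (extChartAt (𝓡 n) x₀).target with hU
  set z₀ := extChartAt (𝓡 n) x₀ x₀ with hz₀
  have hUo : IsOpen U := isOpen_extChartAt_target x₀
  have hzU : z₀ ∈ U := mem_extChartAt_target x₀
  have h1 : ∀ᶠ q : (Model n × Model n) × ℝ in 𝓝 ((z₀, z₀), t₀), ∀ ξ ∈ Metric.sphere (0 : Model n) 1,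
      q.1.1 ∈ U ∧ q.1.2 ∈ U ∧ (q.2 ∈ Ico 0 T → 0 < gapHessian X ν F a x₀ q ξ) := by
    refine (isCompact_sphere (0 : Model n) 1).eventually_forall_of_forall_eventually fun ξ hξ => ?_
    have hξ0 : ξ ≠ 0 := by
      rintro rfl
      simp at hξ
    have g1 := (h.continuousOn_gapHessian ha x₀ (((z₀, z₀), t₀), ξ)
      ⟨⟨⟨hzU, hzU⟩, ht₀⟩, mem_univ _⟩).eventually (lt_mem_nhds (h.gapHessian_pos ht₀ hb hμ hξ0))
    rw [eventually_nhdsWithin_iff] at g1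
    have g2 : ∀ᶠ r : ((Model n × Model n) × ℝ) × Model n in 𝓝 (((z₀, z₀), t₀), ξ), r.1.1.1 ∈ U :=
      (show Continuous fun r : ((Model n × Model n) × ℝ) × Model n => r.1.1.1 by
        fun_prop).continuousAt.eventually (hUo.mem_nhds hzU)
    have g3 : ∀ᶠ r : ((Model n × Model n) × ℝ) × Model n in 𝓝 (((z₀, z₀), t₀), ξ), r.1.1.2 ∈ U :=
      (show Continuous fun r : ((Model n × Model n) × ℝ) × Model n => r.1.1.2 by
        fun_prop).continuousAt.eventually (hUo.mem_nhds hzU)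
    filter_upwards [g1, g2, g3] with r e1 e2 e3
    exact ⟨e2, e3, fun ht => e1 ⟨⟨⟨e2, e3⟩, ht⟩, mem_univ _⟩⟩
  obtain ⟨ρ, hρ, hball⟩ := Metric.eventually_nhds_iff.1 h1
  obtain ⟨ρ', hρ', hballU⟩ := Metric.isOpen_iff.1 hUo z₀ hzU
  set r := min ρ ρ' with hr
  have hr0 : 0 < r := lt_min hρ hρ'
  have hBU : Metric.ball z₀ r ⊆ U := (Metric.ball_subset_ball (min_le_right _ _)).trans hballU
  have hchart : ∀ᶠ y in 𝓝 x₀, y ∈ (extChartAt (𝓡 n) x₀).source ∧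
      extChartAt (𝓡 n) x₀ y ∈ Metric.ball z₀ r := by
    filter_upwards [extChartAt_source_mem_nhds (I := 𝓡 n) x₀,
      (continuousAt_extChartAt (I := 𝓡 n) x₀).eventually (Metric.ball_mem_nhds z₀ hr0)]
      with y g1 g2 using ⟨g1, g2⟩
  have e1 : ∀ᶠ q : (M × M) × ℝ in 𝓝 ((x₀, x₀), t₀), q.1.1 ∈ (extChartAt (𝓡 n) x₀).source ∧
      extChartAt (𝓡 n) x₀ q.1.1 ∈ Metric.ball z₀ r :=
    ((show Continuous fun q : (M × M) × ℝ => q.1.1 by fun_prop).tendsto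
      ((x₀, x₀), t₀)).eventually hchart
  have e2 : ∀ᶠ q : (M × M) × ℝ in 𝓝 ((x₀, x₀), t₀), q.1.2 ∈ (extChartAt (𝓡 n) x₀).source ∧
      extChartAt (𝓡 n) x₀ q.1.2 ∈ Metric.ball z₀ r :=
    ((show Continuous fun q : (M × M) × ℝ => q.1.2 by fun_prop).tendsto
      ((x₀, x₀), t₀)).eventually hchart
  have e3 : ∀ᶠ q : (M × M) × ℝ in 𝓝 ((x₀, x₀), t₀), q.2 ∈ Metric.ball t₀ r :=
    continuous_snd.continuousAt.eventually (Metric.ball_mem_nhds t₀ hr0)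
  filter_upwards [e1, e2, e3] with q hu hv ht htT
  obtain ⟨⟨x, y⟩, t⟩ := q
  simp only at hu hv ht htT ⊢
  set u := extChartAt (𝓡 n) x₀ x with hudef
  set v := extChartAt (𝓡 n) x₀ y with hvdef
  have hux : (extChartAt (𝓡 n) x₀).symm u = x := (extChartAt (𝓡 n) x₀).left_inv hu.1
  have hvy : (extChartAt (𝓡 n) x₀).symm v = y := (extChartAt (𝓡 n) x₀).left_inv hv.1
  have hpos : ∀ w ∈ Metric.ball z₀ r, ∀ ξ, 0 ≤ gapHessian X ν F a x₀ ((u, w), t) ξ := by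
    intro w hw ξ
    rcases eq_or_ne ξ 0 with rfl | hξ
    · have := gapHessian_smul (X := X) (ν := ν) (F := F) a x₀ ((u, w), t) 0 0
      rw [zero_smul] at this
      rw [this]; simp
    · have hmem : ‖ξ‖⁻¹ • ξ ∈ Metric.sphere (0 : Model n) 1 := by
        rw [mem_sphere_zero_iff_norm, norm_smul, norm_inv, norm_norm,
          inv_mul_cancel₀ (norm_ne_zero_iff.2 hξ)]
      have hd : dist ((u, w), t) ((z₀, z₀), t₀) < ρ := by
        refine lt_of_lt_of_le ?_ (min_le_left ρ ρ')
        simp only [Prod.dist_eq, sup_lt_iff]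
        exact ⟨⟨hu.2, hw⟩, ht⟩
      have h2 := (hball hd _ hmem).2.2 htT
      rw [gapHessian_smul] at h2
      exact (pos_of_mul_pos_right h2 (sq_nonneg _)).le
  have key := gap_nonneg_of_convex (convex_ball z₀ r) (g := X t ∘ (extChartAt (𝓡 n) x₀).symm)
    (fun w hw => (contDiffAt_comp_extChartAt_symm (hBU hw)
      (contMDiffAt_slice h.smooth htT _)).of_le ENat.LEInfty.out) hu.2 hv.2 (N := ν t x)
    (k := a t * F t x) (by
      have := h.inner_fderiv_chart x₀ htT (hBU hu.2) (v - u)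
      rwa [hux] at this)
    (fun w hw => by
      have := hpos w hw (v - u)
      simp only [gapHessian, hux] at this
      exact this)
  simp only [Function.comp_apply, hux, hvy] at key
  exact key

lemma IsConcaveFlow.curvature_le (h : IsConcaveFlow Γ f T Ω X ν F σ) {t : ℝ} (ht : t ∈ Ico 0 T)
    {x : M} {μ : Fin n → ℝ} {b : Fin n → Model n} (hb : IsPrincipalFrame (X t) (ν t) x μ b) {k : ℝ}
    (hgap : ∀ y, 0 ≤ sphereGap (X t) (ν t) k x y) (i : Fin n) : μ i ≤ k := by
  set g := X t ∘ (extChartAt (𝓡 n) x).symm with hg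
  set z := extChartAt (𝓡 n) x x with hz
  have hx : (extChartAt (𝓡 n) x).symm z = x := extChartAt_to_inv x
  have hg2 : ContDiffAt ℝ 2 g z := (contDiffAt_comp_extChartAt_symm (mem_extChartAt_target x)
    (contMDiffAt_slice h.smooth ht _)).of_le ENat.LEInfty.out
  have hΔ := (Jet2.const (X t x)).sub (jet2_comp_line hg2 (b i))
  have hgz : g z = X t x := by rw [hg, Function.comp_apply, hx]
  rw [hgz] at hΔ
  have hq := ((Jet2.const (k / 2)).mul (hΔ.inner hΔ)).sub (hΔ.inner (Jet2.const (ν t x)))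
  have h2 := (hq.eq_zero_and_nonneg (Eventually.of_forall fun s => by
    have := hgap ((extChartAt (𝓡 n) x).symm (z + s • b i))
    rw [sphereGap] at this
    simp only [sub_self, inner_zero_left, mul_zero]
    exact this)).2
  have hd := hb.metric i i
  have hc := hb.curvature i i
  rw [differential_eq_fderiv ((contMDiffAt_slice h.smooth ht x).mdifferentiableAt (by simp))] at hd
  rw [secondDerivative] at hc
  rw [if_pos rfl] at hd hc
  simp only [sub_self, zero_sub, neg_neg, inner_zero_left, inner_zero_right, inner_neg_left,
    inner_neg_right, mul_zero, zero_mul, add_zero, zero_add] at h2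
  rw [hd, hc] at h2
  linarith

end FirstTouching

section Preservation

lemma sphereGap_mono {n : ℕ} {M : Type*} (X ν : M → Ambient n) {k k' : ℝ} (hk : k ≤ k') (x y : M) :
    sphereGap X ν k x y ≤ sphereGap X ν k' x y := by
  have : (0 : ℝ) ≤ inner ℝ (X x - X y) (X x - X y) := real_inner_self_nonneg
  unfold sphereGap
  nlinarith

variable {n : ℕ} {M : Type*} [TopologicalSpace M] [ChartedSpace (Model n) M]
  {Γ : Set (Fin n → ℝ)} {f : (Fin n → ℝ) → ℝ} {T : ℝ} {Ω : ℝ → Set (Ambient n)}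
  {X ν : ℝ → M → Ambient n} {F : ℝ → M → ℝ} {σ : ℝ}

lemma IsConcaveFlow.inner_sub_pos (h : IsConcaveFlow Γ f T Ω X ν F σ) {t : ℝ} (ht : t ∈ Ico 0 T)
    {x y : M} (hxy : x ≠ y) : (0 : ℝ) < inner ℝ (X t x - X t y) (X t x - X t y) :=
  real_inner_self_pos.2 fun h0 => hxy (h.injective t ht (sub_eq_zero.1 h0))

variable [IsManifold (𝓡 n) ∞ M] [CompactSpace M]

/-- Strict positivity of the gap and of its second derivative on the diagonal are open conditions
in time. -/
lemma IsConcaveFlow.eventually_gap_nonneg (h : IsConcaveFlow Γ f T Ω X ν F σ) {a : ℝ → ℝ}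
    (ha : Continuous a) {t₀ : ℝ} (ht₀ : t₀ ∈ Ico 0 T)
    (hoff : ∀ x y, x ≠ y → 0 < sphereGap (X t₀) (ν t₀) (a t₀ * F t₀ x) x y)
    (hdiag : ∀ x, ∃ μ b, IsPrincipalFrame (X t₀) (ν t₀) x μ b ∧ ∀ i, μ i < a t₀ * F t₀ x) :
    ∀ᶠ t in 𝓝 t₀, t ∈ Ico 0 T → ∀ x y, 0 ≤ sphereGap (X t) (ν t) (a t * F t x) x y := by
  have h1 : ∀ᶠ t in 𝓝 t₀, ∀ q ∈ (univ : Set (M × M)), t ∈ Ico 0 T →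
      0 ≤ sphereGap (X t) (ν t) (a t * F t q.1) q.1 q.2 := by
    refine isCompact_univ.eventually_forall_of_forall_eventually fun q _ => ?_
    obtain ⟨x, y⟩ := q
    refine (continuous_swap.tendsto (t₀, (x, y))).eventually
      (p := fun r : (M × M) × ℝ => r.2 ∈ Ico 0 T →
        0 ≤ sphereGap (X r.2) (ν r.2) (a r.2 * F r.2 r.1.1) r.1.1 r.1.2) ?_
    rcases eq_or_ne x y with rfl | hxy
    · obtain ⟨μ, b, hb, hμ⟩ := hdiag x
      exact h.eventually_gap_nonneg_diagonal ha ht₀ hb hμ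
    · exact h.eventually_gap_nonneg_of_pos ha ht₀ (hoff x y hxy)
  filter_upwards [h1] with t ht htT x y
  exact ht (x, y) (mem_univ _) htT

/-- At each time, the hypersurface is non-collapsed for some constant. -/
lemma IsConcaveFlow.exists_gap_nonneg (h : IsConcaveFlow Γ f T Ω X ν F σ) {t : ℝ}
    (ht : t ∈ Ico 0 T) : ∃ c, ∀ x y, 0 ≤ sphereGap (X t) (ν t) (σ * c * F t x) x y := by
  have hmono : ∀ {c c' : ℝ}, c ≤ c' → ∀ x y, sphereGap (X t) (ν t) (σ * c * F t x) x y ≤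
      sphereGap (X t) (ν t) (σ * c' * F t x) x y := fun hc x y => by
    refine sphereGap_mono _ _ ?_ x y
    have := h.pos t ht x
    nlinarith
  have hslice : ∀ (p : M × M) (c : ℝ), (∀ᶠ q : (M × M) × ℝ in 𝓝 (p, t), q.2 ∈ Ico 0 T →
      0 ≤ sphereGap (X q.2) (ν q.2) (σ * c * F q.2 q.1.1) q.1.1 q.1.2) →
      ∀ᶠ q in 𝓝 p, 0 ≤ sphereGap (X t) (ν t) (σ * c * F t q.1) q.1 q.2 := fun p c hp => by
    have hc : Continuous fun q : M × M => (q, t) := by fun_prop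
    filter_upwards [(hc.tendsto p).eventually hp] with q hq using hq ht
  have key : ∃ c, ∀ q ∈ (univ : Set (M × M)),
      0 ≤ sphereGap (X t) (ν t) (σ * c * F t q.1) q.1 q.2 := by
    refine isCompact_univ.induction_on
      (p := fun s : Set (M × M) => ∃ c, ∀ q ∈ s, 0 ≤ sphereGap (X t) (ν t) (σ * c * F t q.1) q.1 q.2)
      ⟨0, fun q hq => hq.elim⟩ ?_ ?_ ?_
    · rintro s s' hss' ⟨c, hc⟩
      exact ⟨c, fun q hq => hc q (hss' hq)⟩
    · rintro s s' ⟨c, hc⟩ ⟨c', hc'⟩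
      refine ⟨max c c', ?_⟩
      rintro q (hq | hq)
      · exact (hc q hq).trans (hmono (le_max_left _ _) _ _)
      · exact (hc' q hq).trans (hmono (le_max_right _ _) _ _)
    · rintro ⟨x, y⟩ -
      have hFpos := h.pos t ht x
      suffices hs : ∃ c, ∀ᶠ q in 𝓝 (x, y), 0 ≤ sphereGap (X t) (ν t) (σ * c * F t q.1) q.1 q.2 by
        obtain ⟨c, hc⟩ := hs
        exact ⟨_, mem_nhdsWithin_of_mem_nhds hc, c, fun q hq => hq⟩
      rcases eq_or_ne x y with rfl | hxy
      · obtain ⟨μ, -, -, b, hb⟩ := h.frame t ht x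
        obtain ⟨B, hB⟩ := (Set.finite_range μ).bddAbove
        refine ⟨(B + 1) / (σ * F t x), hslice _ _ ?_⟩
        refine h.eventually_gap_nonneg_diagonal (a := fun _ => σ * ((B + 1) / (σ * F t x)))
          continuous_const ht hb fun i => ?_
        have h1 : σ * ((B + 1) / (σ * F t x)) * F t x = B + 1 := by
          rw [mul_right_comm, mul_div_cancel₀ _ hFpos.ne']
        rw [h1]
        have := hB (mem_range_self i)
        linarith
      · set w : ℝ := inner ℝ (X t x - X t y) (ν t x) with hw
        have hd := h.inner_sub_pos ht hxy
        set d : ℝ := inner ℝ (X t x - X t y) (X t x - X t y) with hddef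
        refine ⟨(2 * (w + 1) / d) / (σ * F t x), hslice _ _ ?_⟩
        refine h.eventually_gap_nonneg_of_pos
          (a := fun _ => σ * ((2 * (w + 1) / d) / (σ * F t x))) continuous_const ht ?_
        have h1 : σ * ((2 * (w + 1) / d) / (σ * F t x)) * F t x = 2 * (w + 1) / d := by
          rw [mul_right_comm, mul_div_cancel₀ _ hFpos.ne']
        have h2 : 2 * (w + 1) / d / 2 * d = w + 1 := by field_simp
        rw [h1, sphereGap, ← hw, ← hddef, h2]
        linarith
  obtain ⟨c, hc⟩ := key
  exact ⟨c, fun x y => hc (x, y) (mem_univ _)⟩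

/-- The perturbed comparison: the gap for the curvature `σ (c + ε (1 + t - t₁)) F` stays
nonnegative. -/
lemma IsConcaveFlow.gap_nonneg_perturbed (hn : 1 ≤ n) (h : IsConcaveFlow Γ f T Ω X ν F σ)
    {t₁ t₂ : ℝ} (ht₁ : t₁ ∈ Ico 0 T) (ht₂ : t₂ ∈ Ico 0 T) {c ε : ℝ} (hε : 0 < ε)
    (hgap : ∀ x y, 0 ≤ sphereGap (X t₁) (ν t₁) (σ * c * F t₁ x) x y) {t : ℝ} (ht : t ∈ Icc t₁ t₂)
    (x y : M) : 0 ≤ sphereGap (X t) (ν t) (σ * (c + ε * (1 + (t - t₁))) * F t x) x y := by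
  set a : ℝ → ℝ := fun t => σ * (c + ε * (1 + (t - t₁))) with ha
  have hac : Continuous a := by fun_prop
  set s : Set ℝ := {t | ∀ t' ∈ Icc t₁ t, ∀ x y, 0 ≤ sphereGap (X t') (ν t') (a t' * F t' x) x y}
    with hs
  have hlt : ∀ x, σ * c * F t₁ x < a t₁ * F t₁ x := fun x => by
    have h1 : a t₁ * F t₁ x = σ * c * F t₁ x + ε * (σ * F t₁ x) := by simp only [ha]; ring
    rw [h1]
    have := mul_pos hε (h.pos t₁ ht₁ x)
    linarith
  have hstart : t₁ ∈ s := fun t' ht' x y => by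
    obtain rfl : t' = t₁ := le_antisymm ht'.2 ht'.1
    exact (hgap x y).trans (sphereGap_mono _ _ (hlt x).le x y)
  have hcontt : ∀ x y, ContinuousOn (fun t => sphereGap (X t) (ν t) (a t * F t x) x y) (Ico 0 T) :=
    fun x y => (h.continuousOn_gap hac).comp (f := fun t => ((x, y), t)) (by fun_prop)
      fun t ht => ⟨mem_univ _, ht⟩
  have hclosed : IsClosed (s ∩ Icc t₁ t₂) := by
    refine isClosed_of_closure_subset fun t ht => ?_
    have htI : t ∈ Icc t₁ t₂ := closure_minimal inter_subset_right isClosed_Icc ht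
    have hbefore : ∀ t' ∈ Ico t₁ t, ∀ x y, 0 ≤ sphereGap (X t') (ν t') (a t' * F t' x) x y := by
      intro t' ht'
      obtain ⟨t'', h1, h2⟩ := mem_closure_iff.1 ht _ isOpen_Ioi ht'.2
      exact h2.1 t' ⟨ht'.1, le_of_lt h1⟩
    refine ⟨fun t' ht' x y => ?_, htI⟩
    rcases ht'.2.lt_or_eq with h1 | rfl
    · exact hbefore t' ⟨ht'.1, h1⟩ x y
    · rcases htI.1.eq_or_lt with rfl | h1
      · exact hstart t₁ ht' x y
      · have hcw := (hcontt x y t' ⟨ht₁.1.trans htI.1, htI.2.trans_lt ht₂.2⟩).mono_of_mem_nhdsWithin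
          (s := Iio t') (mem_of_superset (Ioo_mem_nhdsLT h1) fun r hr =>
            ⟨ht₁.1.trans hr.1.le, hr.2.trans (htI.2.trans_lt ht₂.2)⟩)
        refine ge_of_tendsto hcw ?_
        filter_upwards [Ioo_mem_nhdsLT h1] with r hr
        exact hbefore r ⟨hr.1.le, hr.2⟩ x y
  have hstep : ∀ t ∈ s ∩ Ico t₁ t₂, s ∈ 𝓝[>] t := by
    rintro t ⟨hts, htI⟩
    have htT : t ∈ Ico 0 T := ⟨ht₁.1.trans htI.1, htI.2.trans ht₂.2⟩
    have hnext : ∀ᶠ t' in 𝓝 t, t' ∈ Ico 0 T → ∀ x y,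
        0 ≤ sphereGap (X t') (ν t') (a t' * F t' x) x y := by
      rcases htI.1.eq_or_lt with rfl | h1
      · refine h.eventually_gap_nonneg hac htT (fun x y hxy => ?_) fun x => ?_
        · have h1 := hgap x y
          have h2 := h.inner_sub_pos htT hxy
          have h3 := hlt x
          unfold sphereGap at h1 ⊢
          nlinarith
        · obtain ⟨μ, -, -, b, hb⟩ := h.frame t₁ ht₁ x
          exact ⟨μ, b, hb, fun i => (h.curvature_le ht₁ hb (hgap x) i).trans_lt (hlt x)⟩
      · have htI' : t ∈ Ioo 0 T := ⟨ht₁.1.trans_lt h1, htT.2⟩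
        have hjet : Jet2 (fun r => a (t + r)) (a t) (σ * ε) 0 := by
          refine ⟨fun _ => σ * ε, Eventually.of_forall fun r => ?_, by simp, rfl,
            hasDerivAt_const _ _⟩
          have := ((((((hasDerivAt_id r).const_add t).sub_const t₁).const_add 1).const_mul
            ε).const_add c).const_mul σ
          simpa [ha] using this
        have hpast : ∀ᶠ t' in 𝓝 t, t' ≤ t → ∀ x y,
            0 ≤ sphereGap (X t') (ν t') (a t' * F t' x) x y := by
          filter_upwards [lt_mem_nhds h1] with t' h2 h3 x y
          exact hts t' ⟨h2.le, h3⟩ x y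
        have hpos : ∀ x, 0 < σ * ε * F t x := fun x => by
          have := mul_pos hε (h.pos t htT x)
          linarith
        refine h.eventually_gap_nonneg hac htT
          (fun x y hxy => h.gap_pos hn htI' hjet hpos hpast hxy) fun x => ?_
        obtain ⟨μ, hμ, hF, b, hb⟩ := h.frame t htT x
        exact ⟨μ, b, hb, h.curvature_lt htI' hjet hpos hpast hμ hF hb⟩
    obtain ⟨δ, hδ, hball⟩ := Metric.eventually_nhds_iff.1 hnext
    have h1 : Ioo t (min (t + δ) T) ∈ 𝓝[>] t :=
      Ioo_mem_nhdsGT (lt_min (by linarith) htT.2)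
    filter_upwards [h1] with t' ht' r hr
    rcases le_or_gt r t with hrt | hrt
    · exact hts r ⟨hr.1, hrt⟩
    · refine hball ?_ ⟨ht₁.1.trans hr.1, hr.2.trans_lt (ht'.2.trans_le (min_le_right _ _))⟩
      have := ht'.2.trans_le (min_le_left _ _)
      rw [Real.dist_eq, abs_of_pos (by linarith)]
      linarith [hr.2]
  exact hclosed.Icc_subset_of_forall_mem_nhdsWithin hstart hstep ht t ⟨ht.1, le_rfl⟩ x y

/-- Non-collapsing with constant `c` is preserved by the flow. -/
theorem IsConcaveFlow.gap_nonneg (hn : 1 ≤ n) (h : IsConcaveFlow Γ f T Ω X ν F σ)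
    {t₁ t₂ : ℝ} (ht₁ : t₁ ∈ Ico 0 T) (ht₂ : t₂ ∈ Ico 0 T) (ht : t₁ ≤ t₂) {c : ℝ}
    (hgap : ∀ x y, 0 ≤ sphereGap (X t₁) (ν t₁) (σ * c * F t₁ x) x y) (x y : M) :
    0 ≤ sphereGap (X t₂) (ν t₂) (σ * c * F t₂ x) x y := by
  have hcont : Continuous fun ε : ℝ =>
      sphereGap (X t₂) (ν t₂) (σ * (c + ε * (1 + (t₂ - t₁))) * F t₂ x) x y := by
    unfold sphereGap
    fun_prop
  have hlim := (hcont.tendsto 0).mono_left (nhdsWithin_le_nhds (s := Ioi 0))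
  rw [zero_mul, add_zero] at hlim
  refine ge_of_tendsto hlim ?_
  filter_upwards [self_mem_nhdsWithin] with ε hε
  exact h.gap_nonneg_perturbed hn ht₁ ht₂ hε hgap ⟨ht, le_rfl⟩ x y

end Preservation

section NonCollapsing

lemma real_iInf_eq_neg_iSup_neg {ι : Sort*} (g : ι → ℝ) : ⨅ i, g i = -⨆ i, -g i := by
  rw [iInf, Real.sInf_def, iSup, ← Set.image_neg_eq_neg, ← range_comp]
  rfl

lemma sphereZ_neg {n : ℕ} {M : Type*} (X ν : M → Ambient n) (x y : M) :
    sphereZ X (fun x => -ν x) x y = -sphereZ X ν x y := by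
  rw [sphereZ, sphereZ, inner_neg_right, mul_neg, neg_div]

lemma sphereZ_le_iff {n : ℕ} {M : Type*} {X ν : M → Ambient n} {x y : M} (hxy : X x ≠ X y)
    (k : ℝ) : sphereZ X ν x y ≤ k ↔ 0 ≤ sphereGap X ν k x y := by
  have h1 : 0 < ‖X x - X y‖ ^ 2 := pow_pos (norm_pos_iff.2 (sub_ne_zero.2 hxy)) 2
  rw [sphereZ, sphereGap, div_le_iff₀ h1, real_inner_self_eq_norm_sq]
  constructor <;> intro h <;> linarith

lemma exists_ne_of_chartedSpace {n : ℕ} (hn : 1 ≤ n) {M : Type*} [TopologicalSpace M]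
    [ChartedSpace (Model n) M] (x : M) : ∃ y : M, y ≠ x := by
  have : Nonempty (Fin n) := ⟨⟨0, hn⟩⟩
  have h1 : (extChartAt (𝓡 n) x).target ∈ 𝓝[≠] (extChartAt (𝓡 n) x x) :=
    mem_nhdsWithin_of_mem_nhds ((isOpen_extChartAt_target x).mem_nhds (mem_extChartAt_target x))
  have : (𝓝[≠] (extChartAt (𝓡 n) x x)).NeBot :=
    Module.punctured_nhds_neBot ℝ (Model n) _
  obtain ⟨z, hz, hne⟩ := ((Filter.Eventually.and h1 self_mem_nhdsWithin)).exists
  refine ⟨(extChartAt (𝓡 n) x).symm z, fun hcon => hne ?_⟩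
  rw [← (extChartAt (𝓡 n) x).right_inv hz, hcon]
  rfl

variable {n : ℕ} {M : Type*} [TopologicalSpace M] [ChartedSpace (Model n) M]
  {Γ : Set (Fin n → ℝ)} {f : (Fin n → ℝ) → ℝ} {T : ℝ} {Ω : ℝ → Set (Ambient n)}
  {X ν : ℝ → M → Ambient n} {F : ℝ → M → ℝ} {σ : ℝ}

lemma IsConcaveFlow.notMem (h : IsConcaveFlow Γ f T Ω X ν F σ) {t : ℝ} (ht : t ∈ Ico 0 T) (x : M) :
    X t x ∉ Ω t := fun hx => by
  have hc : Continuous fun s : ℝ => X t x + s • ν t x := by fun_prop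
  have h1 : ∀ᶠ s : ℝ in 𝓝 0, X t x + s • ν t x ∈ Ω t :=
    (hc.tendsto 0).eventually ((h.isOpen t ht).mem_nhds (by simpa using hx))
  obtain ⟨s, hs1, hs2⟩ := ((h.outward t ht x).and (nhdsWithin_le_nhds h1)).exists
  exact hs1 hs2

lemma norm_sub_center_sq {V : Type*} [NormedAddCommGroup V] [InnerProductSpace ℝ V]
    {N : V} (hN : inner ℝ N N = (1 : ℝ)) (A B : V) {r : ℝ} (hr : r ≠ 0) :
    ‖B - (A - r • N)‖ ^ 2 =
      r ^ 2 + 2 * r * (r⁻¹ / 2 * inner ℝ (A - B) (A - B) - inner ℝ (A - B) N) := by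
  have h1 : B - (A - r • N) = r • N - (A - B) := by abel
  rw [h1, ← real_inner_self_eq_norm_sq]
  generalize A - B = D
  rw [inner_sub_left, inner_sub_right, inner_sub_right, real_inner_smul_left,
    real_inner_smul_left, inner_smul_right, inner_smul_right, hN, real_inner_comm D N]
  field_simp
  ring

variable [IsManifold (𝓡 n) ∞ M]

/-- The center of a ball inside `Ω t` which touches at `X t x` lies on the inward normal. -/
lemma IsConcaveFlow.center_eq (h : IsConcaveFlow Γ f T Ω X ν F σ) {t : ℝ} (ht : t ∈ Ico 0 T)
    {x : M} {r : ℝ} (hr : 0 < r) {p : Ambient n} (hball : Metric.ball p r ⊆ Ω t)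
    (hx : X t x ∈ Metric.sphere p r) : p = X t x - r • ν t x := by
  have hν := h.inner_normal_self ht x
  have hfar : ∀ y, r ^ 2 ≤ inner ℝ (X t y - p) (X t y - p) := fun y => by
    rw [real_inner_self_eq_norm_sq]
    have : r ≤ ‖X t y - p‖ := by
      by_contra! hcon
      exact h.notMem ht y (hball (by rwa [Metric.mem_ball, dist_eq_norm]))
    gcongr
  have hxr : inner ℝ (X t x - p) (X t x - p) = r ^ 2 := by
    rw [real_inner_self_eq_norm_sq, ← dist_eq_norm, hx]
  obtain ⟨μ, -, -, b, hb⟩ := h.frame t ht x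
  obtain ⟨he, heν⟩ := hb.orthonormal_differential (h.orthogonal t ht x)
  have htan : ∀ i, inner ℝ (X t x - p) (differential (X t) x (b i)) = (0 : ℝ) := fun i => by
    rw [differential_eq_fderiv ((contMDiffAt_slice h.smooth ht x).mdifferentiableAt (by simp))]
    set g := X t ∘ (extChartAt (𝓡 n) x).symm with hg
    set z := extChartAt (𝓡 n) x x with hz
    have hgz : g z = X t x := by rw [hg, Function.comp_apply, hz, extChartAt_to_inv]
    have hg2 : ContDiffAt ℝ 2 g z := (contDiffAt_comp_extChartAt_symm (mem_extChartAt_target x)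
      (contMDiffAt_slice h.smooth ht _)).of_le ENat.LEInfty.out
    have hΔ := (jet2_comp_line hg2 (b i)).sub (Jet2.const p)
    have h2 := ((hΔ.inner hΔ).eq_zero_and_nonneg (Eventually.of_forall fun s => by
      rw [hgz, hxr]
      exact hfar _)).1
    rw [hgz, sub_zero, real_inner_comm (X t x - p)] at h2
    linarith
  have hdec := eq_sum_frame_add_normal he hν heν (X t x - p)
  simp only [htan, zero_smul, Finset.sum_const_zero, zero_add] at hdec
  set c : ℝ := inner ℝ (X t x - p) (ν t x) with hc
  have hcr : c * c = r ^ 2 := by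
    rw [hdec, real_inner_smul_left, inner_smul_right, hν, mul_one] at hxr
    exact hxr
  have hc' : c = r ∨ c = -r := by
    have : (c - r) * (c + r) = 0 := by linarith
    rcases mul_eq_zero.1 this with h6 | h6
    · left; linarith
    · right; linarith
  rcases hc' with hc' | hc'
  · rw [hc'] at hdec
    rw [← hdec]; abel
  · exfalso
    rw [hc'] at hdec
    have h1 : ∀ᶠ s : ℝ in 𝓝[>] 0, X t x + s • ν t x ∈ Ω t := by
      filter_upwards [Ioo_mem_nhdsGT hr] with s hs
      refine hball ?_
      have h2 : X t x + s • ν t x - p = (s - r) • ν t x := by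
        rw [add_sub_right_comm, hdec, ← add_smul]; congr 1; ring
      rw [Metric.mem_ball, dist_eq_norm, h2, norm_smul, h.norm_eq_one t ht x, mul_one,
        Real.norm_eq_abs, abs_lt]
      constructor <;> linarith [hs.1, hs.2]
    obtain ⟨s, hs1, hs2⟩ := ((h.outward t ht x).and h1).exists
    exact hs1 hs2

/-- A ball of radius `r` inside `Ω t` touches at `X t x` if and only if `Z(x, y) ≤ 1 / r` for
all `y`. -/
lemma IsConcaveFlow.exists_ball_iff (h : IsConcaveFlow Γ f T Ω X ν F σ) {t : ℝ} (ht : t ∈ Ico 0 T)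
    (x : M) {r : ℝ} (hr : 0 < r) :
    (∃ p, Metric.ball p r ⊆ Ω t ∧ X t x ∈ Metric.sphere p r) ↔
      ∀ y, 0 ≤ sphereGap (X t) (ν t) r⁻¹ x y := by
  have hν := h.inner_normal_self ht x
  have hsq : ∀ y, ‖X t y - (X t x - r • ν t x)‖ ^ 2 =
      r ^ 2 + 2 * r * sphereGap (X t) (ν t) r⁻¹ x y := fun y =>
    norm_sub_center_sq hν _ _ hr.ne'
  constructor
  · rintro ⟨p, hball, hx⟩ y
    have hp := h.center_eq ht hr hball hx
    have h1 : r ≤ ‖X t y - p‖ := by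
      by_contra! hcon
      exact h.notMem ht y (hball (by rwa [Metric.mem_ball, dist_eq_norm]))
    have h2 : r ^ 2 ≤ ‖X t y - p‖ ^ 2 := by gcongr
    rw [hp, hsq] at h2
    have h3 : 0 ≤ 2 * r * sphereGap (X t) (ν t) r⁻¹ x y := by linarith
    exact nonneg_of_mul_nonneg_right h3 (by linarith)
  · intro hgap
    refine ⟨X t x - r • ν t x, ?_, ?_⟩
    · refine subset_of_disjoint_frontier (convex_ball _ r).isPreconnected ?_ ?_
      · intro Y hY hYf
        obtain ⟨y, rfl⟩ := h.frontier_subset t ht hYf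
        rw [Metric.mem_ball, dist_eq_norm] at hY
        have h1 : ‖X t y - (X t x - r • ν t x)‖ ^ 2 < r ^ 2 := by gcongr
        rw [hsq] at h1
        have := mul_nonneg (mul_nonneg zero_le_two hr.le) (hgap y)
        linarith
      · obtain ⟨s, hs1, hs2⟩ := ((h.inward t ht x).and (Ioo_mem_nhdsGT hr)).exists
        refine ⟨_, ?_, hs1⟩
        have h2 : X t x - s • ν t x - (X t x - r • ν t x) = (r - s) • ν t x := by
          rw [sub_smul]; abel
        rw [Metric.mem_ball, dist_eq_norm, h2, norm_smul, h.norm_eq_one t ht x, mul_one,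
          Real.norm_eq_abs, abs_lt]
        constructor <;> linarith [hs2.1, hs2.2]
    · rw [mem_sphere_iff_norm, sub_sub_cancel, norm_smul, h.norm_eq_one t ht x, mul_one,
        Real.norm_of_nonneg hr.le]

lemma IsConcaveFlow.interiorNonCollapsed_iff (h : IsConcaveFlow Γ f T Ω X ν F σ) {t : ℝ}
    (ht : t ∈ Ico 0 T) {δ : ℝ} (hδ : 0 < δ) :
    InteriorNonCollapsed δ (Ω t) (X t) (fun x => σ * F t x) ↔
      ∀ x y, 0 ≤ sphereGap (X t) (ν t) (σ * δ⁻¹ * F t x) x y := by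
  refine forall_congr' fun x => ?_
  rw [h.exists_ball_iff ht x (div_pos hδ (h.pos t ht x))]
  have h1 : (δ / (σ * F t x))⁻¹ = σ * δ⁻¹ * F t x := by rw [inv_div]; ring
  rw [h1]

variable [CompactSpace M]

/-- Interior non-collapsing on the scale of the speed is preserved. -/
theorem IsConcaveFlow.interiorNonCollapsed (hn : 1 ≤ n) (h : IsConcaveFlow Γ f T Ω X ν F σ)
    {t₁ t₂ : ℝ} (ht₁ : t₁ ∈ Ico 0 T) (ht₂ : t₂ ∈ Ico 0 T) (ht : t₁ ≤ t₂) {δ : ℝ} (hδ : 0 < δ)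
    (hnc : InteriorNonCollapsed δ (Ω t₁) (X t₁) (fun x => σ * F t₁ x)) :
    InteriorNonCollapsed δ (Ω t₂) (X t₂) (fun x => σ * F t₂ x) :=
  (h.interiorNonCollapsed_iff ht₂ hδ).2
    (h.gap_nonneg hn ht₁ ht₂ ht ((h.interiorNonCollapsed_iff ht₁ hδ).1 hnc))

/-- The largest interior sphere curvature relative to the speed is non-increasing. -/
theorem IsConcaveFlow.antitoneOn (hn : 1 ≤ n) [Nonempty M] (h : IsConcaveFlow Γ f T Ω X ν F σ) :
    AntitoneOn (fun t => ⨆ x, interiorSphereCurvature (X t) (ν t) x / (σ * F t x)) (Ico 0 T) := by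
  have hne : ∀ x : M, Nonempty {y : M // y ≠ x} := fun x =>
    let ⟨y, hy⟩ := exists_ne_of_chartedSpace hn x
    ⟨⟨y, hy⟩⟩
  have hZ : ∀ t ∈ Ico 0 T, ∀ c : ℝ,
      (∀ x y, 0 ≤ sphereGap (X t) (ν t) (σ * c * F t x) x y) → ∀ x,
      (∀ y : {y : M // y ≠ x}, sphereZ (X t) (ν t) x y ≤ c * (σ * F t x)) ∧
      interiorSphereCurvature (X t) (ν t) x / (σ * F t x) ≤ c := by
    intro t ht c hgap x
    have h1 : ∀ y : {y : M // y ≠ x}, sphereZ (X t) (ν t) x y ≤ c * (σ * F t x) := fun y => by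
      rw [sphereZ_le_iff fun hcon => y.2 (h.injective t ht hcon).symm]
      have := hgap x y
      rwa [show σ * c * F t x = c * (σ * F t x) by ring] at this
    refine ⟨h1, ?_⟩
    have := hne x
    rw [div_le_iff₀ (h.pos t ht x)]
    exact ciSup_le h1
  intro t₁ ht₁ t₂ ht₂ ht
  obtain ⟨c₀, hc₀⟩ := h.exists_gap_nonneg ht₁
  set c := ⨆ x, interiorSphereCurvature (X t₁) (ν t₁) x / (σ * F t₁ x) with hc
  have hbdd : BddAbove (range fun x => interiorSphereCurvature (X t₁) (ν t₁) x / (σ * F t₁ x)) :=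
    ⟨c₀, by rintro _ ⟨x, rfl⟩; exact (hZ t₁ ht₁ c₀ hc₀ x).2⟩
  have hgap : ∀ x y, 0 ≤ sphereGap (X t₁) (ν t₁) (σ * c * F t₁ x) x y := by
    intro x y
    rcases eq_or_ne y x with rfl | hyx
    · simp [sphereGap]
    · rw [← sphereZ_le_iff fun hcon => hyx (h.injective t₁ ht₁ hcon).symm]
      have h1 : sphereZ (X t₁) (ν t₁) x y ≤ interiorSphereCurvature (X t₁) (ν t₁) x :=
        le_ciSup (f := fun y : {y : M // y ≠ x} => sphereZ (X t₁) (ν t₁) x y)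
          ⟨c₀ * (σ * F t₁ x), by rintro _ ⟨y', rfl⟩; exact (hZ t₁ ht₁ c₀ hc₀ x).1 y'⟩ ⟨y, hyx⟩
      have h2 : interiorSphereCurvature (X t₁) (ν t₁) x / (σ * F t₁ x) ≤ c := le_ciSup hbdd x
      rw [div_le_iff₀ (h.pos t₁ ht₁ x)] at h2
      linarith
  exact ciSup_le fun x => (hZ t₂ ht₂ c (h.gap_nonneg hn ht₁ ht₂ ht hgap) x).2

end NonCollapsing

section EmbeddedSolution

variable {n : ℕ} {M : Type*} [TopologicalSpace M] [ChartedSpace (Model n) M]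
  {Γ : Set (Fin n → ℝ)} {f : (Fin n → ℝ) → ℝ} {T : ℝ} {Ω : ℝ → Set (Ambient n)}
  {X ν : ℝ → M → Ambient n}

lemma IsSpeedFunction.isConcaveSpeed (hf : IsSpeedFunction Γ f) (hc : ConcaveOn ℝ Γ f) :
    IsConcaveSpeed Γ f :=
  ⟨hf.isOpen_cone, hf.smul_mem, hf.perm_mem, hf.contDiffOn.differentiableOn (by norm_num),
    hf.symmetric, hf.monotoneOn, hf.homogeneous, hc⟩

/-- The dual speed `κ ↦ -f(-κ)` of a convex speed is concave. -/
lemma IsSpeedFunction.isConcaveSpeed_dual (hf : IsSpeedFunction Γ f) (hc : ConvexOn ℝ Γ f) :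
    IsConcaveSpeed {κ | -κ ∈ Γ} (fun κ => -f (-κ)) := by
  refine ⟨hf.isOpen_cone.preimage continuous_neg, fun κ hκ c hc => ?_, fun κ hκ σ => ?_, ?_,
    fun κ hκ σ => ?_, fun κ hκ μ hμ hle => ?_, fun κ hκ c hc => ?_, ?_, ?_⟩
  · have := hf.smul_mem _ hκ c hc
    rwa [smul_neg] at this
  · exact hf.perm_mem _ hκ σ
  · have h1 : DifferentiableOn ℝ f Γ := hf.contDiffOn.differentiableOn (by norm_num)
    exact (h1.comp (f := fun κ => -κ) (s := {κ | -κ ∈ Γ}) (by fun_prop) fun κ hκ => hκ).neg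
  · exact congrArg Neg.neg (hf.symmetric _ hκ σ)
  · exact neg_le_neg (hf.monotoneOn hμ hκ (neg_le_neg hle))
  · have := hf.homogeneous _ hκ c hc
    rw [smul_neg] at this
    rw [this, mul_neg]
  · exact hf.convex_cone.neg
  · intro κ hκ μ hμ a b ha hb hab
    have := hc.2 hκ hμ ha hb hab
    rw [smul_neg, smul_neg, ← neg_add] at this
    simp only [smul_eq_mul] at this ⊢
    linarith

lemma frontier_compl_closure_subset {V : Type*} [TopologicalSpace V] (s : Set V) :
    frontier (closure s)ᶜ ⊆ frontier s := by
  rw [frontier_compl]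
  exact frontier_closure_subset

lemma IsEmbeddedSolution.exists_isPrincipalFrame [IsManifold (𝓡 n) ∞ M]
    (hX : IsEmbeddedSolution Γ f T Ω X ν) {t : ℝ} (ht : t ∈ Ico 0 T) (x : M) :
    ∃ b, IsPrincipalFrame (X t) (ν t) x (principalCurvatures (X t) (ν t) x) b :=
  CurvatureFlow.exists_isPrincipalFrame (X t) (ν t) x (hX.immersion t ht x)
    (secondDerivative_symm (contMDiffAt_slice hX.smooth ht x))

variable [IsManifold (𝓡 n) ∞ M]

lemma IsEmbeddedSolution.isConcaveFlow (hX : IsEmbeddedSolution Γ f T Ω X ν)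
    (hf : IsSpeedFunction Γ f) (hpos : ∀ t ∈ Ico 0 T, ∀ x, 0 < speed f (X t) (ν t) x)
    (hc : ConcaveOn ℝ Γ f) :
    IsConcaveFlow Γ f T Ω X ν (fun t => speed f (X t) (ν t)) 1 where
  speed := hf.isConcaveSpeed hc
  smooth := hX.smooth
  injective t ht := (hX.isEmbedding t ht).injective
  immersion := hX.immersion
  norm_eq_one t ht := (hX.outwardNormal t ht).norm_eq_one
  orthogonal t ht := (hX.outwardNormal t ht).orthogonal
  flow := hX.flow
  frame t ht x := ⟨_, hX.curvatures_mem t ht x, rfl, hX.exists_isPrincipalFrame ht x⟩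
  sign := one_mul 1
  pos t ht x := by rw [one_mul]; exact hpos t ht x
  isOpen t ht := (hX.outwardNormal t ht).isOpen
  frontier_subset t ht := (hX.outwardNormal t ht).frontier_eq.subset
  inward t ht := (hX.outwardNormal t ht).inward
  outward t ht x := ((hX.outwardNormal t ht).outward x).mono fun _ hs hcon =>
    hs (subset_closure hcon)

/-- A flow by a convex speed, seen from the outside, is a flow by the dual concave speed. -/
lemma IsEmbeddedSolution.isConcaveFlow_dual (hX : IsEmbeddedSolution Γ f T Ω X ν)
    (hf : IsSpeedFunction Γ f) (hpos : ∀ t ∈ Ico 0 T, ∀ x, 0 < speed f (X t) (ν t) x)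
    (hc : ConvexOn ℝ Γ f) :
    IsConcaveFlow {κ | -κ ∈ Γ} (fun κ => -f (-κ)) T (fun t => (closure (Ω t))ᶜ) X
      (fun t x => -ν t x) (fun t x => -speed f (X t) (ν t) x) (-1) where
  speed := hf.isConcaveSpeed_dual hc
  smooth := hX.smooth
  injective t ht := (hX.isEmbedding t ht).injective
  immersion := hX.immersion
  norm_eq_one t ht x := by rw [norm_neg]; exact (hX.outwardNormal t ht).norm_eq_one x
  orthogonal t ht x v := by
    rw [inner_neg_right, (hX.outwardNormal t ht).orthogonal x v, neg_zero]
  flow t ht x := by rw [neg_smul_neg]; exact hX.flow t ht x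
  frame t ht x := by
    obtain ⟨b, hb⟩ := hX.exists_isPrincipalFrame ht x
    refine ⟨-principalCurvatures (X t) (ν t) x, ?_, ?_, b, hb.neg⟩
    · show - -_ ∈ Γ
      rw [neg_neg]
      exact hX.curvatures_mem t ht x
    · rw [neg_neg]; rfl
  sign := by norm_num
  pos t ht x := by rw [neg_mul_neg, one_mul]; exact hpos t ht x
  isOpen t _ := isClosed_closure.isOpen_compl
  frontier_subset t ht := (frontier_compl_closure_subset _).trans
    (hX.outwardNormal t ht).frontier_eq.subset
  inward t ht x := by
    simp only [smul_neg, sub_neg_eq_add]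
    exact (hX.outwardNormal t ht).outward x
  outward t ht x := ((hX.outwardNormal t ht).inward x).mono fun s hs hcon => by
    rw [smul_neg, ← sub_eq_add_neg] at hcon
    exact hcon (subset_closure hs)

lemma IsEmbeddedSolution.one_le_dim (hX : IsEmbeddedSolution Γ f T Ω X ν)
    (hf : IsSpeedFunction Γ f) (hpos : ∀ t ∈ Ico 0 T, ∀ x, 0 < speed f (X t) (ν t) x) {t : ℝ}
    (ht : t ∈ Ico 0 T) (x : M) : 1 ≤ n := by
  by_contra! hn
  obtain rfl : n = 0 := by omega
  have h1 := hf.homogeneous _ (hX.curvatures_mem t ht x) 2 two_pos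
  rw [Subsingleton.elim ((2 : ℝ) • principalCurvatures (X t) (ν t) x)
    (principalCurvatures (X t) (ν t) x)] at h1
  have h2 : 0 < f (principalCurvatures (X t) (ν t) x) := hpos t ht x
  linarith

end EmbeddedSolution
end CurvatureFlow

end

theorem corollary2 {n : ℕ} {M : Type*} [TopologicalSpace M] [T2Space M] [CompactSpace M]
    [ChartedSpace (EuclideanSpace ℝ (Fin n)) M] [IsManifold (𝓡 n) ∞ M]
    (Γ : Set (Fin n → ℝ)) (f : (Fin n → ℝ) → ℝ) (hf : CurvatureFlow.IsSpeedFunction Γ f)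
    (T : ℝ) (Ω : ℝ → Set (EuclideanSpace ℝ (Fin (n + 1))))
    (X ν : ℝ → M → EuclideanSpace ℝ (Fin (n + 1)))
    (hX : CurvatureFlow.IsEmbeddedSolution Γ f T Ω X ν)
    (hpos : ∀ t ∈ Set.Ico 0 T, ∀ x, 0 < CurvatureFlow.speed f (X t) (ν t) x) :
    (ConvexOn ℝ Γ f →
      MonotoneOn (fun t => ⨅ x, CurvatureFlow.exteriorSphereCurvature (X t) (ν t) x /
        CurvatureFlow.speed f (X t) (ν t) x) (Set.Ico 0 T) ∧
      ∀ δ : ℝ, 0 < δ → ∀ t₁ ∈ Set.Ico 0 T, ∀ t₂ ∈ Set.Ico 0 T, t₁ ≤ t₂ →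
        CurvatureFlow.ExteriorNonCollapsed δ (Ω t₁) (X t₁)
          (CurvatureFlow.speed f (X t₁) (ν t₁)) →
        CurvatureFlow.ExteriorNonCollapsed δ (Ω t₂) (X t₂)
          (CurvatureFlow.speed f (X t₂) (ν t₂))) ∧
    (ConcaveOn ℝ Γ f →
      AntitoneOn (fun t => ⨆ x, CurvatureFlow.interiorSphereCurvature (X t) (ν t) x /
        CurvatureFlow.speed f (X t) (ν t) x) (Set.Ico 0 T) ∧
      ∀ δ : ℝ, 0 < δ → ∀ t₁ ∈ Set.Ico 0 T, ∀ t₂ ∈ Set.Ico 0 T, t₁ ≤ t₂ →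
        CurvatureFlow.InteriorNonCollapsed δ (Ω t₁) (X t₁)
          (CurvatureFlow.speed f (X t₁) (ν t₁)) →
        CurvatureFlow.InteriorNonCollapsed δ (Ω t₂) (X t₂)
          (CurvatureFlow.speed f (X t₂) (ν t₂))) := by
  rcases isEmpty_or_nonempty M with hM | hM
  · refine ⟨fun _ => ⟨fun t₁ _ t₂ _ _ => ?_, fun δ _ t₁ _ t₂ _ _ _ x => hM.elim x⟩,
      fun _ => ⟨fun t₁ _ t₂ _ _ => ?_, fun δ _ t₁ _ t₂ _ _ _ x => hM.elim x⟩⟩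
    · simp only [Real.iInf_of_isEmpty, le_refl]
    · simp only [Real.iSup_of_isEmpty, le_refl]
  have hn : ∀ t ∈ Set.Ico 0 T, 1 ≤ n := fun t ht =>
    hX.one_le_dim hf hpos ht (Classical.arbitrary M)
  refine ⟨fun hc => ?_, fun hc => ?_⟩
  · have h := hX.isConcaveFlow_dual hf hpos hc
    refine ⟨fun t₁ ht₁ t₂ ht₂ ht => ?_, fun δ hδ t₁ ht₁ t₂ ht₂ ht hnc => ?_⟩
    · have h1 := h.antitoneOn (hn t₁ ht₁) ht₁ ht₂ ht
      have h2 : ∀ t, ⨅ x, CurvatureFlow.exteriorSphereCurvature (X t) (ν t) x /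
          CurvatureFlow.speed f (X t) (ν t) x =
          -⨆ x, CurvatureFlow.interiorSphereCurvature (X t) (fun x => -ν t x) x /
            (-1 * -CurvatureFlow.speed f (X t) (ν t) x) := fun t => by
        rw [CurvatureFlow.real_iInf_eq_neg_iSup_neg]
        simp only [CurvatureFlow.exteriorSphereCurvature, CurvatureFlow.interiorSphereCurvature,
          CurvatureFlow.real_iInf_eq_neg_iSup_neg, CurvatureFlow.sphereZ_neg, neg_div, neg_neg,
          neg_mul_neg, one_mul]
      simp only [h2]
      exact neg_le_neg h1
    · have h1 := h.interiorNonCollapsed (hn t₁ ht₁) ht₁ ht₂ ht hδ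
      simp only [neg_mul_neg, one_mul] at h1
      exact h1 hnc
  · have h := hX.isConcaveFlow hf hpos hc
    refine ⟨fun t₁ ht₁ t₂ ht₂ ht => ?_, fun δ hδ t₁ ht₁ t₂ ht₂ ht hnc => ?_⟩
    · have h1 := h.antitoneOn (hn t₁ ht₁) ht₁ ht₂ ht
      simp only [one_mul] at h1
      exact h1
    · have h1 := h.interiorNonCollapsed (hn t₁ ht₁) ht₁ ht₂ ht hδ
      simp only [one_mul] at h1
      exact h1 hnc
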